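/- Let $d,n\ge 1$ and let $r_i,s_i>0$ $(i=1,\dots,d)$ be known durations. For an unknown $\lambda\in(0,\infty)^d$, let $x_1,\dots,x_d,y_1,\dots,y_d$ be independent, with $x_i$ Poisson of mean $r_i\lambda_i$ and $y_i$ Poisson of mean $s_i\lambda_i$; write $p(x\mid\lambda)$ and $p(y\mid\lambda)$ for their joint probabilities. A predictive distribution is a family $q(\cdot\mid x)$, $x\in\mathbb{N}^d$, of probability distributions on $\mathbb{N}^d$. Its Kullback--Leibler risk at $\lambda$ is $R(\lambda,q)=\sum_x p(x\mid\lambda)\sum_y p(y\mid\lambda)\log\frac{p(y\mid\lambda)}{q(y\mid x)}\in[0,\infty]$. We say that $q$ dominates $q'$ if $R(\lambda,q)\le R(\lambda,q')$ for all $\lambda$, with strict inequality for some $\lambda$. The Bayesian predictive distribution based on a (possibly improper) prior density $\pi$ is $p_\pi(y\mid x)=\int p(x\mid\lambda)p(y\mid\lambda)\pi(\lambda)\,d\lambda\big/\int p(x\mid\lambda)\pi(\lambda)\,d\lambda$, and $p_{\mathrm J}$ is the one based on the Jeffreys prior $\prod_i\lambda_i^{-1/2}$. Let $V_1,\dots,V_n$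 be linear subspaces of $\mathbb{R}^d$ with $k_j=\dim V_j$, let $s_{V_j}(\theta)$ be the squared Euclidean distance from $\theta$ to $V_j$, and let $0<\alpha_j\le(d-k_j-2)/2$ for $j=1,\dots,n$. Put $$f(\theta)=\sum_{j=1}^n\ \sum_{a\in\{1,-1\}^d}\bigl(s_{V_j}(a_1\theta_1,\dots,a_d\theta_d)\bigr)^{-\alpha_j},\qquad \pi_{f,\mathrm J}(\lambda)=f(\theta)\prod_{i=1}^d\lambda_i^{-1/2},$$ where either (a) all $r_i$ are equal, all $s_i$ are equal, and $\theta_i=\sqrt{\lambda_i}$; or (b) the durations are arbitrary and $\theta_i=\sqrt{\lambda_i/\gamma_i}$ with $\gamma_i=\frac1{r_i}-\frac1{r_i+s_i}$. Then in both cases $p_{\mathrm J}$ and the Bayesian predictive distribution $p_{f,\mathrm J}$ based on the mix subspace shrinkage prior $\pi_{f,\mathrm J}$ are well defined, $p_{f,\mathrm J}$ dominates $p_{\mathrm J}$, and $p_{f,\mathrm J}$ is nearly minimax: with $B=\frac12\sum_{i=1}^d\log\frac{r_i+s_i}{r_i}$, every predictive distribution $q$ satisfies $\sup_\lambda R(\lambda,q)\ge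 B$, while $R(\lambda,p_{f,\mathrm J})<1.04\,B$ for every $\lambda$. -/

import Mathlib

open MeasureTheory ProbabilityTheory

open scoped ENNReal

noncomputable section

namespace PoissonPrediction

/-- The law on `ℕ^d` of a vector of independent Poisson variables, the `i`-th with mean `m i`. -/
def poissonVec {d : ℕ} (m : Fin d → ℝ) : Measure (Fin d → ℕ) :=
  Measure.pi fun i => poissonMeasure (m i).toNNReal

/-- The probability `p(x ∣ lam)` of the count vector `x` for durations `t` and intensities `lam`. -/
def likelihood {d : ℕ} (t lam : Fin d → ℝ) (x : Fin d → ℕ) : ℝ≥0∞ :=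
  poissonVec (t * lam) {x}

/-- `likelihood` is the usual product of Poisson probabilities. -/
theorem likelihood_eq {d : ℕ} (t lam : Fin d → ℝ) (ht : ∀ i, 0 ≤ t i * lam i) (x : Fin d → ℕ) :
    likelihood t lam x =
      ENNReal.ofReal (∏ i, Real.exp (-(t i * lam i)) * (t i * lam i) ^ x i / (x i).factorial) := by
  rw [likelihood, poissonVec, Measure.pi_singleton, ENNReal.ofReal_prod_of_nonneg]
  · refine Finset.prod_congr rfl fun i _ => ?_
    rw [poissonMeasure_singleton, Pi.mul_apply, Real.coe_toNNReal _ (ht i)]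
  · intro i _
    have := ht i
    positivity

/-- The parameter space `(0, ∞)^d`. -/
def paramSpace (d : ℕ) : Set (Fin d → ℝ) := {lam | ∀ i, 0 < lam i}

/-- The Bayesian predictive probability of `y` given `x`, based on the (possibly improper,
possibly unnormalized) prior density `π` on the parameter space. -/
def bayesPredictiveMass {d : ℕ} (r s : Fin d → ℝ) (π : (Fin d → ℝ) → ℝ≥0∞)
    (x y : Fin d → ℕ) : ℝ≥0∞ :=
  (∫⁻ lam in paramSpace d, likelihood r lam x * likelihood s lam y * π lam) /
    (∫⁻ lam in paramSpace d, likelihood r lam x * π lam)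

/-- The Bayesian predictive distribution: the measure on `ℕ^d` (depending on the observation `x`)
with the above point masses. -/
def bayesPredictive {d : ℕ} (r s : Fin d → ℝ) (π : (Fin d → ℝ) → ℝ≥0∞)
    (x : Fin d → ℕ) : Measure (Fin d → ℕ) :=
  Measure.count.withDensity (bayesPredictiveMass r s π x)

/-- A predictive distribution assigns to each observation a probability measure on `ℕ^d`. -/
def IsPredictive {d : ℕ} (q : (Fin d → ℕ) → Measure (Fin d → ℕ)) : Prop :=
  ∀ x, IsProbabilityMeasure (q x)

/-- The Kullback–Leibler risk at `lam` of the predictive distribution `q`: the expectation, over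
the observation `x`, of the divergence from the law of `y` to `q x`. -/
def klRisk {d : ℕ} (r s : Fin d → ℝ) (q : (Fin d → ℕ) → Measure (Fin d → ℕ))
    (lam : Fin d → ℝ) : ℝ≥0∞ :=
  ∫⁻ x, InformationTheory.klDiv (poissonVec (s * lam)) (q x) ∂(poissonVec (r * lam))

/-- `q` dominates `q'`: its risk is nowhere larger, and somewhere smaller. -/
def Dominates {d : ℕ} (r s : Fin d → ℝ) (q q' : (Fin d → ℕ) → Measure (Fin d → ℕ)) : Prop :=
  (∀ lam ∈ paramSpace d, klRisk r s q lam ≤ klRisk r s q' lam) ∧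
    ∃ lam ∈ paramSpace d, klRisk r s q lam < klRisk r s q' lam

/-- The constant `(1/2) ∑ log ((r_i + s_i) / r_i)`. -/
def minimaxBound {d : ℕ} (r s : Fin d → ℝ) : ℝ :=
  0.5 * ∑ i, Real.log ((r i + s i) / r i)

/-- `B` is a minimax lower bound: every predictive distribution has maximal risk at least `B`. -/
def IsMinimaxLowerBound {d : ℕ} (r s : Fin d → ℝ) (B : ℝ) : Prop :=
  ∀ q : (Fin d → ℕ) → Measure (Fin d → ℕ), IsPredictive q →
    ENNReal.ofReal B ≤ ⨆ lam ∈ paramSpace d, klRisk r s q lam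

/-- `q` is nearly minimax: its risk is everywhere less than `1.04` times the minimax lower bound
`minimaxBound r s`; that this number is a minimax lower bound is part of the notion. -/
def NearlyMinimax {d : ℕ} (r s : Fin d → ℝ) (q : (Fin d → ℕ) → Measure (Fin d → ℕ)) : Prop :=
  IsMinimaxLowerBound r s (minimaxBound r s) ∧
    ∀ lam ∈ paramSpace d, klRisk r s q lam < ENNReal.ofReal (1.04 * minimaxBound r s)

/-- The prior density `f(θ) ∏ lam_i^(-1/2)`, where `θ_i = √(lam_i / c_i)`. -/
def priorJ {d : ℕ} (c : Fin d → ℝ) (f : (Fin d → ℝ) → ℝ) (lam : Fin d → ℝ) : ℝ≥0∞ :=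
  ENNReal.ofReal (f (fun i => √(lam i / c i)) * ∏ i, lam i ^ (-(1 / 2) : ℝ))

/-- The Jeffreys prior density `∏ lam_i^(-1/2)`. -/
def jeffreysPrior {d : ℕ} (lam : Fin d → ℝ) : ℝ≥0∞ :=
  ENNReal.ofReal (∏ i, lam i ^ (-(1 / 2) : ℝ))

/-- The squared Euclidean distance from `θ` to the linear subspace `V`. -/
def sqDist {d : ℕ} (V : Submodule ℝ (EuclideanSpace ℝ (Fin d))) (θ : Fin d → ℝ) : ℝ :=
  Metric.infDist (WithLp.toLp 2 θ) (V : Set (EuclideanSpace ℝ (Fin d))) ^ 2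

/-- The mix subspace shrinkage function `∑_j ∑_a s_{V_j}(a θ)^(-α_j)`, where `a` runs over
`{1, -1}^d` and acts coordinatewise. -/
def mixSubspace {d n : ℕ} (V : Fin n → Submodule ℝ (EuclideanSpace ℝ (Fin d))) (α : Fin n → ℝ)
    (θ : Fin d → ℝ) : ℝ :=
  ∑ j, ∑ a ∈ Fintype.piFinset (fun _ : Fin d => ({1, -1} : Finset ℝ)),
    sqDist (V j) (a * θ) ^ (-α j)

/-- The constants `γ_i = 1 / r_i - 1 / (r_i + s_i)`. -/
def gam {d : ℕ} (r s : Fin d → ℝ) (i : Fin d) : ℝ := 1 / r i - 1 / (r i + s i)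

/-- The predictive distribution based on the prior `priorJ c (mixSubspace V α)`. -/
def mixPredictive {d n : ℕ} (r s c : Fin d → ℝ)
    (V : Fin n → Submodule ℝ (EuclideanSpace ℝ (Fin d))) (α : Fin n → ℝ) :
    (Fin d → ℕ) → Measure (Fin d → ℕ) :=
  bayesPredictive r s (priorJ c (mixSubspace V α))

/-- The predictive distribution based on the Jeffreys prior. -/
def jeffreysPredictive {d : ℕ} (r s : Fin d → ℝ) : (Fin d → ℕ) → Measure (Fin d → ℕ) :=
  bayesPredictive r s jeffreysPrior

/-- Both predictive distributions are well defined, and the one based on the mix subspace shrinkage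
prior dominates the one based on the Jeffreys prior and is nearly minimax. -/
def MixImproves {d n : ℕ} (r s c : Fin d → ℝ)
    (V : Fin n → Submodule ℝ (EuclideanSpace ℝ (Fin d))) (α : Fin n → ℝ) : Prop :=
  IsPredictive (jeffreysPredictive r s) ∧ IsPredictive (mixPredictive r s c V α) ∧
    Dominates r s (mixPredictive r s c V α) (jeffreysPredictive r s) ∧
    NearlyMinimax r s (mixPredictive r s c V α)

end PoissonPrediction

end

noncomputable section

namespace PoissonPrediction

/-! ### Finite products of measures -/

/-! Domination. The inequality log u ≤ u - 1 gives R(q) + 1 ≤ R(q') + E[q'(y|x) / q(y|x)]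
(`klRisk_add_one_le`), so it is enough that the expected ratio of p_J to p_f is below 1. That ratio
is the posterior mean of f(θ) under the Jeffreys prior given x with durations r, divided by the one
given x + y with durations r + s. Whatever λ is, x given z = x + y is a binomial thinning of z.
Hence it suffices that, for each z, averaging the first mean over the thinning of z stays strictly
below the second (`sum_binomial_gammaMean_lt`).

The sum over signs in f replaces √(λ_i / c_i) by a symmetric variable with density proportional to
θ^(2x) exp(-ρ θ²), where ρ = r_i c_i. The central identity (`rootMeasure_conv_gaussianReal`) is that
Gaussian noise of variance (1/ρ - 1/τ)/2, added to such a variable with count z and rate τ, produces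
the binomial mixture over x of the variables with rate ρ. Both choices of θ make γ_i / c_i constant
in i, so the noise is isotropic. What remains is strict superharmonicity: an isotropic Gaussian
average of s_V^(-α) is smaller than the central value (`lintegral_sqDist_rpow_gaussian_lt`). This
follows from writing s^(-α) as a Laplace transform, for which Gaussian averages are explicit.

Upper bound. The Jeffreys risk splits over coordinates. Each coordinate contributes (1/2)
log((r+s)/r) plus an increment, from mean rl to mean (r+s)l, of a function whose derivative log μ -
E log(K + 1/2), with K Poisson of mean μ, is below 0.02/μ (`log_sub_poissonMean_log_lt`). The
increment is therefore below 0.02 log((r+s)/r), whence the factor 1.04; p_f inherits the bound by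
domination.

Lower bound. The supremum of a risk is at least its average over a proper prior, here independent
gamma laws of shape 2 and rate b, and that average is at least the one of the Bayes rule. The Bayes
rule has risk at least the sum of 2 log((r+s+b)/(r+b)) - (3/2) log((r+s)/r) - 3/(rλ) over
coordinates (`le_coordRisk_two`). Since 1/λ has prior mean b, letting b → 0 leaves exactly B. -/

theorem lintegral_pi_prod {d : ℕ} {X : Fin d → Type*} [∀ i, MeasurableSpace (X i)]
    (μ : ∀ i, Measure (X i)) [∀ i, SigmaFinite (μ i)] (f : ∀ i, X i → ℝ≥0∞)
    (hf : ∀ i, Measurable (f i)) :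
    ∫⁻ x, ∏ i, f i (x i) ∂Measure.pi μ = ∏ i, ∫⁻ y, f i y ∂μ i := by
  induction d with
  | zero => simp
  | succ n ih =>
    have hmp := (measurePreserving_piFinSuccAbove μ 0).symm
    rw [← hmp.lintegral_comp_emb (MeasurableEquiv.measurableEmbedding _)]
    have h : ∀ x : X 0 × (∀ j : Fin n, X (Fin.succAbove 0 j)),
        ∏ i, f i ((MeasurableEquiv.piFinSuccAbove X 0).symm x i) =
          f 0 x.1 * ∏ j : Fin n, f (Fin.succAbove 0 j) (x.2 j) := by
      intro x
      rw [Fin.prod_univ_succAbove _ 0]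
      simp only [MeasurableEquiv.piFinSuccAbove_symm_apply, Fin.insertNthEquiv, Equiv.coe_fn_mk,
        Fin.insertNth_apply_same, Fin.insertNth_apply_succAbove]
    simp_rw [h]
    rw [lintegral_prod_mul (g := fun y : ∀ j : Fin n, X (Fin.succAbove 0 j) =>
      ∏ j, f (Fin.succAbove 0 j) (y j)) (hf 0).aemeasurable (Finset.measurable_prod _ fun j _ =>
        (hf _).comp (measurable_pi_apply j)).aemeasurable, ih _ _ fun j => hf _,
      Fin.prod_univ_succAbove _ 0]

theorem pi_withDensity {d : ℕ} {X : Fin d → Type*} [∀ i, MeasurableSpace (X i)]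
    (μ : ∀ i, Measure (X i)) [∀ i, SigmaFinite (μ i)] (f : ∀ i, X i → ℝ≥0∞)
    (hf : ∀ i, Measurable (f i)) [∀ i, SigmaFinite ((μ i).withDensity (f i))] :
    Measure.pi (fun i => (μ i).withDensity (f i)) =
      (Measure.pi μ).withDensity fun x => ∏ i, f i (x i) := by
  refine Measure.pi_eq fun s hs => ?_
  rw [withDensity_apply _ (MeasurableSet.univ_pi hs),
    ← lintegral_indicator (MeasurableSet.univ_pi hs)]
  have h : ∀ x : ∀ i, X i, (Set.univ.pi s).indicator (fun x => ∏ i, f i (x i)) x =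
      ∏ i, (s i).indicator (f i) (x i) := by
    intro x
    by_cases hx : x ∈ Set.univ.pi s
    · rw [Set.indicator_of_mem hx]
      exact Finset.prod_congr rfl fun i _ => (Set.indicator_of_mem (hx i trivial) _).symm
    · rw [Set.indicator_of_notMem hx]
      simp only [Set.mem_pi, Set.mem_univ, true_imp_iff, not_forall] at hx
      obtain ⟨i, hi⟩ := hx
      exact (Finset.prod_eq_zero (Finset.mem_univ i) (Set.indicator_of_notMem hi _)).symm
  simp_rw [h]
  rw [lintegral_pi_prod _ _ fun i => (hf i).indicator (hs i)]
  refine Finset.prod_congr rfl fun i _ => ?_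
  rw [lintegral_indicator (hs i), withDensity_apply _ (hs i)]

/-- Distributivity of products over sums, checked on boxes. It expands both the choice of a sign and
the choice of a thinned count in every coordinate. -/
theorem pi_sum {d : ℕ} {X : Fin d → Type*} {κ : Type*} [DecidableEq κ]
    [∀ i, MeasurableSpace (X i)]
    (S : Fin d → Finset κ) (ν : ∀ i, κ → Measure (X i)) [∀ i b, IsFiniteMeasure (ν i b)] :
    Measure.pi (fun i => ∑ b ∈ S i, ν i b) =
      ∑ a ∈ Fintype.piFinset S, Measure.pi fun i => ν i (a i) := by
  refine Measure.pi_eq fun s hs => ?_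
  simp only [Measure.coe_finsetSum, Finset.sum_apply, Measure.pi_pi]
  rw [Finset.prod_univ_sum]

theorem pi_smul {d : ℕ} {X : Fin d → Type*} [∀ i, MeasurableSpace (X i)]
    (c : Fin d → ℝ≥0∞) (hc : ∀ i, c i ≠ ∞) (ν : ∀ i, Measure (X i)) [∀ i, IsFiniteMeasure (ν i)] :
    Measure.pi (fun i => c i • ν i) = (∏ i, c i) • Measure.pi ν := by
  have : ∀ i, IsFiniteMeasure (c i • ν i) := fun i => (ν i).smul_finite (hc i)
  refine Measure.pi_eq fun s hs => ?_
  simp [Measure.pi_pi, Finset.prod_mul_distrib]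

/-! ### Kullback–Leibler divergence on a countable space -/

section KL

theorem absolutelyContinuous_of_singleton_ne_zero {Ω : Type*} [MeasurableSpace Ω]
    (P Q : Measure Ω) (hQ : ∀ y, Q {y} ≠ 0) : P ≪ Q := by
  intro s hs
  have : s = ∅ := by
    by_contra hne
    obtain ⟨y, hy⟩ := Set.nonempty_iff_ne_empty.mpr hne
    exact hQ y (measure_mono_null (Set.singleton_subset_iff.mpr hy) hs)
  simp [this]

variable {Ω : Type*} [MeasurableSpace Ω] [MeasurableSingletonClass Ω]

theorem rnDeriv_eq_div_singleton (P Q : Measure Ω) [IsFiniteMeasure P] [IsFiniteMeasure Q]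
    (hQ : ∀ y, Q {y} ≠ 0) (y : Ω) : P.rnDeriv Q y = P {y} / Q {y} := by
  have h := Measure.withDensity_rnDeriv_eq P Q (absolutelyContinuous_of_singleton_ne_zero P Q hQ)
  have h2 : (Q.withDensity (P.rnDeriv Q)) {y} = P {y} := by rw [h]
  rw [withDensity_apply _ (measurableSet_singleton y), lintegral_singleton] at h2
  rw [← h2, ENNReal.mul_div_cancel_right (hQ y) (measure_ne_top Q _)]

variable [Countable Ω]

/-- The correction q - p makes every summand nonnegative, so the series makes sense in `ℝ≥0∞`
without any integrability assumption. -/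
theorem klDiv_eq_tsum (P Q : Measure Ω) [IsFiniteMeasure P] [IsFiniteMeasure Q]
    (hQ : ∀ y, Q {y} ≠ 0) :
    InformationTheory.klDiv P Q = ∑' y, ENNReal.ofReal
      (P.real {y} * Real.log (P.real {y} / Q.real {y}) + Q.real {y} - P.real {y}) := by
  rw [InformationTheory.klDiv_eq_lintegral_klFun_of_ac
    (absolutelyContinuous_of_singleton_ne_zero P Q hQ), lintegral_countable']
  refine tsum_congr fun y => ?_
  have hq : 0 < Q.real {y} := ENNReal.toReal_pos (hQ y) (measure_ne_top Q _)
  rw [rnDeriv_eq_div_singleton P Q hQ, ENNReal.toReal_div, ← measureReal_def, ← measureReal_def,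
    ← ofReal_measureReal (μ := Q) (s := {y}),
    ← ENNReal.ofReal_mul (InformationTheory.klFun_nonneg (by positivity)),
    InformationTheory.klFun_apply]
  congr 1
  field_simp

/-- Comparison of the divergences from `P` to two measures, in terms of their density ratio. -/
theorem klDiv_add_one_le (P A B : Measure Ω) [IsProbabilityMeasure P] [IsProbabilityMeasure A]
    [IsProbabilityMeasure B] (hP : ∀ y, P {y} ≠ 0) (hA : ∀ y, A {y} ≠ 0) :
    InformationTheory.klDiv P A + 1 ≤
      InformationTheory.klDiv P B + ∑' y, P {y} * (B {y} / A {y}) := by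
  by_cases hB : ∀ y, B {y} ≠ 0
  · rw [klDiv_eq_tsum P A hA, klDiv_eq_tsum P B hB]
    have one : ∀ (Q : Measure Ω) [IsProbabilityMeasure Q], ∑' y, ENNReal.ofReal (Q.real {y}) = 1 := by
      intro Q _
      have : ∫⁻ _, 1 ∂Q = 1 := by simp
      rw [lintegral_countable'] at this
      simpa using this
    -- The terms p, a and b are distributed so that no subtraction of extended reals occurs; each of
    -- them sums to 1 and drops out afterwards.
    have key : ∀ y,
        ENNReal.ofReal (P.real {y} * Real.log (P.real {y} / A.real {y}) + A.real {y} - P.real {y})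
          + ENNReal.ofReal (P.real {y}) + ENNReal.ofReal (B.real {y}) ≤
        ENNReal.ofReal (P.real {y} * Real.log (P.real {y} / B.real {y}) + B.real {y} - P.real {y})
          + P {y} * (B {y} / A {y}) + ENNReal.ofReal (A.real {y}) := by
      intro y
      have hp : 0 < P.real {y} := ENNReal.toReal_pos (hP y) (measure_ne_top P _)
      have ha : 0 < A.real {y} := ENNReal.toReal_pos (hA y) (measure_ne_top A _)
      have hb : 0 < B.real {y} := ENNReal.toReal_pos (hB y) (measure_ne_top B _)
      have e : P {y} * (B {y} / A {y}) =
          ENNReal.ofReal (P.real {y} * (B.real {y} / A.real {y})) := by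
        rw [ENNReal.ofReal_mul hp.le, ENNReal.ofReal_div_of_pos ha]
        simp
      generalize P.real {y} = p at *
      generalize A.real {y} = a at *
      generalize B.real {y} = b at *
      have kl_nonneg : ∀ q : ℝ, 0 < q → 0 ≤ p * Real.log (p / q) + q - p := by
        intro q hq
        have h := Real.one_sub_inv_le_log_of_pos (div_pos hp hq)
        have h2 : p * (1 - (p / q)⁻¹) = p - q := by field_simp
        nlinarith [mul_le_mul_of_nonneg_left h hp.le]
      rw [e, ← ENNReal.ofReal_add (kl_nonneg a ha) hp.le, ← ENNReal.ofReal_add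
        (add_nonneg (kl_nonneg a ha) hp.le) hb.le, ← ENNReal.ofReal_add (kl_nonneg b hb)
        (by positivity), ← ENNReal.ofReal_add (add_nonneg (kl_nonneg b hb) (by positivity)) ha.le]
      refine ENNReal.ofReal_le_ofReal ?_
      have h := Real.log_le_sub_one_of_pos (div_pos hb ha)
      rw [Real.log_div hb.ne' ha.ne'] at h
      rw [Real.log_div hp.ne' ha.ne', Real.log_div hp.ne' hb.ne']
      nlinarith [mul_le_mul_of_nonneg_left h hp.le]
    have sum_le := ENNReal.tsum_le_tsum key
    rw [ENNReal.tsum_add, ENNReal.tsum_add, ENNReal.tsum_add, ENNReal.tsum_add, one P, one A,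
      one B] at sum_le
    exact (ENNReal.add_le_add_iff_right ENNReal.one_ne_top).mp sum_le
  -- If `B` misses a point, which `P` charges, its divergence is infinite and nothing is left to
  -- prove.
  · push Not at hB
    obtain ⟨y, hy⟩ := hB
    rw [InformationTheory.klDiv_of_not_ac fun h => hP y (h hy)]
    simp

end KL

end PoissonPrediction

namespace PoissonPrediction

/-! ### Poisson expectations as functions of the mean -/

/-- The expectation of `g` under the Poisson law with mean `μ`. -/
def poissonMean (g : ℕ → ℝ) (μ : ℝ) : ℝ := Real.exp (-μ) * ∑' k : ℕ, μ ^ k / k.factorial * g k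

/-- Growth at most geometric with ratio two. -/
def HasGrowth (g : ℕ → ℝ) : Prop := ∃ C : ℝ, ∀ k, |g k| ≤ C * 2 ^ k

namespace HasGrowth

variable {g h : ℕ → ℝ}

theorem const (c : ℝ) : HasGrowth fun _ => c :=
  ⟨|c|, fun _ => le_mul_of_one_le_right (abs_nonneg c) (one_le_pow₀ one_le_two)⟩

theorem add (hg : HasGrowth g) (hh : HasGrowth h) : HasGrowth fun k => g k + h k := by
  obtain ⟨C, hC⟩ := hg
  obtain ⟨D, hD⟩ := hh
  exact ⟨C + D, fun k => (abs_add_le _ _).trans (by linarith [hC k, hD k])⟩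

theorem const_mul (hg : HasGrowth g) (c : ℝ) : HasGrowth fun k => c * g k := by
  obtain ⟨C, hC⟩ := hg
  refine ⟨|c| * C, fun k => ?_⟩
  rw [abs_mul, mul_assoc]
  exact mul_le_mul_of_nonneg_left (hC k) (abs_nonneg c)

theorem neg (hg : HasGrowth g) : HasGrowth fun k => -g k := by
  simpa using hg.const_mul (-1)

theorem sub (hg : HasGrowth g) (hh : HasGrowth h) : HasGrowth fun k => g k - h k := by
  simpa [sub_eq_add_neg] using hg.add hh.neg

theorem mono (hh : HasGrowth h) (hgh : ∀ k, |g k| ≤ |h k|) : HasGrowth g := by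
  obtain ⟨C, hC⟩ := hh
  exact ⟨C, fun k => (hgh k).trans (hC k)⟩

theorem shift (hg : HasGrowth g) : HasGrowth fun k => g (k + 1) := by
  obtain ⟨C, hC⟩ := hg
  exact ⟨C * 2, fun k => (hC (k + 1)).trans (by rw [pow_succ]; linarith)⟩

/-- Ratio two is exactly what makes the class closed under summation, as 2^k + 2^k = 2^(k+1).
Powers, harmonic numbers and log Γ enter the class this way. -/
theorem of_diff (hg : HasGrowth fun k => g (k + 1) - g k) : HasGrowth g := by
  obtain ⟨C, hC⟩ := hg
  refine ⟨|g 0| + C, fun k => ?_⟩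
  have hC0 : 0 ≤ C := by simpa using (abs_nonneg _).trans (hC 0)
  induction k with
  | zero => simpa using hC0
  | succ k ih =>
    have h1 : |g (k + 1)| ≤ |g (k + 1) - g k| + |g k| := by
      simpa using abs_add_le (g (k + 1) - g k) (g k)
    have h2 : C * 2 ^ k ≤ (|g 0| + C) * 2 ^ k := by
      gcongr
      linarith [abs_nonneg (g 0)]
    have := hC k
    rw [pow_succ]
    linarith

theorem cast : HasGrowth fun k => (k : ℝ) :=
  of_diff (by simpa using const 1)

theorem sq : HasGrowth fun k => (k : ℝ) ^ 2 := by
  refine of_diff ((((cast.const_mul 2).add (const 1))).mono fun k => le_of_eq ?_)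
  congr 1
  push_cast
  ring

theorem cube : HasGrowth fun k => (k : ℝ) ^ 3 := by
  refine of_diff ((((sq.const_mul 3).add (cast.const_mul 3)).add (const 1)).mono fun k =>
    le_of_eq ?_)
  congr 1
  push_cast
  ring

theorem summable (hg : HasGrowth g) (μ : ℝ) :
    Summable fun k : ℕ => μ ^ k / k.factorial * g k := by
  obtain ⟨C, hC⟩ := hg
  refine Summable.of_norm_bounded (g := fun k : ℕ => C * ((2 * |μ|) ^ k / k.factorial))
    ((Real.summable_pow_div_factorial _).mul_left C) fun k => ?_
  rw [Real.norm_eq_abs, abs_mul, abs_div, abs_pow, Nat.abs_cast, mul_pow]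
  calc |μ| ^ k / k.factorial * |g k| ≤ |μ| ^ k / k.factorial * (C * 2 ^ k) := by
        gcongr
        exact hC k
    _ = _ := by ring

end HasGrowth

variable {g h : ℕ → ℝ}

theorem hasDerivAt_tsum_poisson (hg : HasGrowth g) (μ : ℝ) :
    HasDerivAt (fun μ : ℝ => ∑' k : ℕ, μ ^ k / k.factorial * g k)
      (∑' k : ℕ, μ ^ k / k.factorial * g (k + 1)) μ := by
  obtain ⟨C, hC⟩ := id hg
  have hC0 : 0 ≤ C := by simpa using (abs_nonneg _).trans (hC 0)
  -- Termwise differentiation needs a uniform summable bound only near `μ`, and the ball of this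
  -- radius contains both `μ` and 0.
  set R := |μ| + 1 with hR
  have hu : Summable fun k : ℕ => ((k : ℝ) * R ^ (k - 1) / k.factorial) * (C * 2 ^ k) := by
    rw [← summable_nat_add_iff 1]
    refine ((Real.summable_pow_div_factorial (2 * R)).mul_left (2 * C)).congr fun k => ?_
    rw [Nat.factorial_succ]
    push_cast
    have : ((k : ℝ) + 1) ≠ 0 := by positivity
    have : (k.factorial : ℝ) ≠ 0 := by positivity
    rw [mul_pow, pow_succ]
    field_simp
  have key := hasDerivAt_tsum_of_isPreconnected (t := Metric.ball (0 : ℝ) R)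
    (g := fun k μ => μ ^ k / k.factorial * g k)
    (g' := fun k μ => ((k : ℝ) * μ ^ (k - 1) / k.factorial) * g k) (y₀ := μ) (y := μ) hu
    Metric.isOpen_ball (convex_ball _ _).isPreconnected
    (fun k y _ => ((hasDerivAt_pow k y).div_const _).mul_const _) (fun k y hy => ?_)
    (by simp [hR]) (hg.summable μ) (by simp [hR])
  · refine key.congr_deriv ?_
    have hs : Summable fun k : ℕ => ((k : ℝ) * μ ^ (k - 1) / k.factorial) * g k := by
      rw [← summable_nat_add_iff 1]
      refine (hg.shift.summable μ).congr fun k => ?_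
      rw [Nat.factorial_succ]
      push_cast
      field_simp
    rw [hs.tsum_eq_zero_add]
    simp only [Nat.cast_zero, zero_mul, zero_div, zero_add]
    refine tsum_congr fun k => ?_
    rw [Nat.factorial_succ]
    push_cast
    field_simp
  · rw [Real.norm_eq_abs, abs_mul, abs_div, abs_mul, abs_pow, Nat.abs_cast, Nat.abs_cast]
    have : |y| ≤ R := by simpa using (Metric.mem_ball.mp hy).le
    gcongr
    exact hC k

/-- Differentiating the factor exp(-μ) turns the shift into a forward difference. Thus the
derivative for log Γ involves only log, and that for harmonic numbers only 1/(k+1), which is what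
makes the monotonicity arguments below possible. -/
theorem hasDerivAt_poissonMean (hg : HasGrowth g) (μ : ℝ) :
    HasDerivAt (poissonMean g) (poissonMean (fun k => g (k + 1) - g k) μ) μ := by
  have h1 : HasDerivAt (fun μ : ℝ => Real.exp (-μ)) (-Real.exp (-μ)) μ := by
    simpa using (hasDerivAt_neg μ).exp
  refine (h1.mul (hasDerivAt_tsum_poisson hg μ)).congr_deriv ?_
  rw [poissonMean]
  simp_rw [mul_sub]
  rw [(hg.shift.summable μ).tsum_sub (hg.summable μ)]
  ring

theorem poissonMean_add (hg : HasGrowth g) (hh : HasGrowth h) (μ : ℝ) :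
    poissonMean (fun k => g k + h k) μ = poissonMean g μ + poissonMean h μ := by
  simp_rw [poissonMean, mul_add]
  rw [(hg.summable μ).tsum_add (hh.summable μ), mul_add]

theorem poissonMean_const_mul (c μ : ℝ) :
    poissonMean (fun k => c * g k) μ = c * poissonMean g μ := by
  simp_rw [poissonMean, mul_left_comm _ c, tsum_mul_left]
  ring

theorem poissonMean_sub (hg : HasGrowth g) (hh : HasGrowth h) (μ : ℝ) :
    poissonMean (fun k => g k - h k) μ = poissonMean g μ - poissonMean h μ := by
  simp_rw [poissonMean, mul_sub]
  rw [(hg.summable μ).tsum_sub (hh.summable μ), mul_sub]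

theorem poissonMean_const (c μ : ℝ) : poissonMean (fun _ => c) μ = c := by
  have h : ∑' k : ℕ, μ ^ k / k.factorial = Real.exp μ := by
    rw [Real.exp_eq_exp_ℝ, NormedSpace.exp_eq_tsum_div]
  rw [poissonMean, tsum_mul_right, h, ← mul_assoc, ← Real.exp_add]
  simp

theorem poissonMean_mono (hg : HasGrowth g) (hh : HasGrowth h) (hgh : ∀ k, g k ≤ h k) {μ : ℝ}
    (hμ : 0 ≤ μ) : poissonMean g μ ≤ poissonMean h μ := by
  refine mul_le_mul_of_nonneg_left ((hg.summable μ).tsum_le_tsum (fun k => ?_) (hh.summable μ))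
    (Real.exp_pos _).le
  exact mul_le_mul_of_nonneg_left (hgh k) (by positivity)

theorem poissonMean_single (j : ℕ) (c μ : ℝ) :
    poissonMean (fun k => if k = j then c else 0) μ = Real.exp (-μ) * (μ ^ j / j.factorial * c) := by
  rw [poissonMean, tsum_eq_single j]
  · simp
  · intro k hk
    simp [hk]

theorem HasGrowth.single (j : ℕ) (c : ℝ) : HasGrowth fun k => if k = j then c else 0 :=
  (HasGrowth.const c).mono fun k => by split_ifs <;> simp

/-- The Stein–Chen identity of the Poisson law. -/
theorem mul_poissonMean_shift (hg : HasGrowth fun k => k * g k) (μ : ℝ) :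
    μ * poissonMean (fun k => g (k + 1)) μ = poissonMean (fun k => k * g k) μ := by
  rw [poissonMean, poissonMean, (hg.summable μ).tsum_eq_zero_add, mul_left_comm, ← tsum_mul_left]
  simp only [Nat.cast_zero, zero_mul, mul_zero, zero_add]
  congr 1
  refine tsum_congr fun k => ?_
  rw [Nat.factorial_succ]
  push_cast
  field_simp
  ring

theorem poissonMean_cast (μ : ℝ) : poissonMean (fun k => (k : ℝ)) μ = μ := by
  have h := mul_poissonMean_shift (g := fun _ => 1) (by simpa using HasGrowth.cast) μ
  rw [poissonMean_const] at h
  simpa using h.symm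

theorem poissonMean_sq (μ : ℝ) : poissonMean (fun k => (k : ℝ) ^ 2) μ = μ ^ 2 + μ := by
  have h := mul_poissonMean_shift (g := fun k => (k : ℝ)) (by simpa [sq] using HasGrowth.sq) μ
  simp only [Nat.cast_add, Nat.cast_one] at h
  rw [poissonMean_add HasGrowth.cast (HasGrowth.const 1), poissonMean_cast, poissonMean_const] at h
  simp only [← sq] at h
  linarith

theorem poissonMean_cube (μ : ℝ) :
    poissonMean (fun k => (k : ℝ) ^ 3) μ = μ ^ 3 + 3 * μ ^ 2 + μ := by
  have h := mul_poissonMean_shift (g := fun k => (k : ℝ) ^ 2)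
    (by simpa [← pow_succ'] using HasGrowth.cube) μ
  simp only [Nat.cast_add, Nat.cast_one, add_sq, one_pow, mul_one, ← pow_succ'] at h
  rw [poissonMean_add (HasGrowth.sq.add (HasGrowth.cast.const_mul 2)) (HasGrowth.const 1),
    poissonMean_add HasGrowth.sq (HasGrowth.cast.const_mul 2), poissonMean_const_mul,
    poissonMean_sq, poissonMean_cast, poissonMean_const] at h
  linarith

theorem integrable_poissonMeasure (hg : HasGrowth g) {μ : ℝ} (hμ : 0 ≤ μ) :
    Integrable g (poissonMeasure μ.toNNReal) := by
  rw [integrable_poissonMeasure_iff]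
  refine ((hg.summable μ).norm.mul_left (Real.exp (-μ))).congr fun k => ?_
  rw [Real.coe_toNNReal _ hμ, norm_mul, Real.norm_of_nonneg (r := μ ^ k / k.factorial)
    (by positivity)]
  ring

theorem integral_poissonMeasure_eq (g : ℕ → ℝ) {μ : ℝ} (hμ : 0 ≤ μ) :
    ∫ k, g k ∂poissonMeasure μ.toNNReal = poissonMean g μ := by
  rw [integral_poissonMeasure, poissonMean, ← tsum_mul_left]
  refine tsum_congr fun k => ?_
  rw [Real.coe_toNNReal _ hμ, smul_eq_mul]
  ring

end PoissonPrediction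

namespace PoissonPrediction

/-! ### Bounds for Poisson expectations of logarithms -/

/-- The difference of the two sides has derivative (u - 1)³ / u, hence its minimum at u = 1, where
it vanishes. -/
theorem log_le_cubic {u : ℝ} (hu : 0 < u) :
    Real.log u ≤ (u - 1) - (u - 1) ^ 2 / 2 + (u - 1) ^ 3 / 3 := by
  have hd : ∀ x : ℝ, 0 < x → HasDerivAt
      (fun u => (u - 1) - (u - 1) ^ 2 / 2 + (u - 1) ^ 3 / 3 - Real.log u) ((x - 1) ^ 3 / x) x := by
    intro x hx
    have h1 : HasDerivAt (fun u : ℝ => u - 1) 1 x := (hasDerivAt_id x).sub_const 1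
    refine (((h1.sub ((h1.pow 2).div_const 2)).add ((h1.pow 3).div_const 3)).sub
      (Real.hasDerivAt_log hx.ne')).congr_deriv ?_
    field_simp
    ring
  have key : 0 ≤ (u - 1) - (u - 1) ^ 2 / 2 + (u - 1) ^ 3 / 3 - Real.log u := by
    rcases le_total 1 u with h | h
    · have hm : MonotoneOn (fun u : ℝ => (u - 1) - (u - 1) ^ 2 / 2 + (u - 1) ^ 3 / 3 - Real.log u)
          (Set.Ici 1) := by
        refine monotoneOn_of_hasDerivWithinAt_nonneg (f' := fun x => (x - 1) ^ 3 / x)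
          (convex_Ici 1) (fun x hx => (hd x (lt_of_lt_of_le one_pos hx)).continuousAt.continuousWithinAt)
          (fun x hx => ?_) fun x hx => ?_
        all_goals rw [interior_Ici] at hx
        · exact (hd x (one_pos.trans hx)).hasDerivWithinAt
        · have : (1 : ℝ) < x := hx
          have : 0 ≤ x - 1 := by linarith
          positivity
      simpa using hm (Set.self_mem_Ici) h h
    · have hm : AntitoneOn (fun u : ℝ => (u - 1) - (u - 1) ^ 2 / 2 + (u - 1) ^ 3 / 3 - Real.log u)
          (Set.Ioc 0 1) := by
        refine antitoneOn_of_hasDerivWithinAt_nonpos (f' := fun x => (x - 1) ^ 3 / x)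
          (convex_Ioc 0 1) (fun x hx => (hd x hx.1).continuousAt.continuousWithinAt)
          (fun x hx => ?_) fun x hx => ?_
        all_goals rw [interior_Ioc] at hx
        · exact (hd x hx.1).hasDerivWithinAt
        · have h3 : (x - 1) ^ 3 ≤ 0 := Odd.pow_nonpos (by decide) (by linarith [hx.2])
          exact div_nonpos_of_nonpos_of_nonneg h3 hx.1.le
      simpa using hm ⟨hu, h⟩ ⟨one_pos, le_rfl⟩ h
  linarith

theorem hasGrowth_log {a : ℝ} (ha : 0 < a) : HasGrowth fun k => Real.log (k + a) := by
  refine ((HasGrowth.cast.add (HasGrowth.const (a + a⁻¹)))).mono fun k => ?_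
  have hk : 0 < (k : ℝ) + a := by positivity
  have h1 := Real.log_le_sub_one_of_pos hk
  have h2 := Real.one_sub_inv_le_log_of_pos hk
  have h3 : ((k : ℝ) + a)⁻¹ ≤ a⁻¹ := inv_anti₀ ha (by simp)
  have h4 : 0 < a⁻¹ := by positivity
  rw [abs_of_nonneg (a := (k : ℝ) + (a + a⁻¹)) (by positivity), abs_le]
  have : (0 : ℝ) ≤ k := by positivity
  constructor <;> linarith

/-- Taylor expansion about μ gives the leading correction (2 - 1/2)/μ. The coefficient 3/2 has to be
sharp, since it decides the constant of the minimax bound; the coefficient 3 of 1/μ² may be crude.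
-/
theorem poissonMean_log_add_two_le {μ : ℝ} (hμ : 0 < μ) :
    poissonMean (fun k => Real.log (k + 2)) μ ≤ Real.log μ + 3 / 2 / μ + 3 / μ ^ 2 := by
  have hlog : ∀ k : ℕ, Real.log (k + 2) = Real.log μ + Real.log ((k + 2) / μ) := by
    intro k
    rw [Real.log_div (by positivity) hμ.ne']
    ring
  -- For μ ≥ 1 the third-order bound is averaged using the first three moments, leaving 1/(3μ²) +
  -- 8/(3μ³) ≤ 3/μ². For μ ≤ 1 the tangent line already suffices.
  rcases le_total 1 μ with h1 | h1
  · have hb : ∀ k : ℕ, Real.log (k + 2) ≤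
        ((1 / (3 * μ ^ 3) * (k : ℝ) ^ 3 + ((6 - 3 * μ) / (3 * μ ^ 3) - 1 / (2 * μ ^ 2)) * (k : ℝ) ^ 2)
          + (1 / μ - (4 - 2 * μ) / (2 * μ ^ 2) + (2 - μ) ^ 2 / μ ^ 3) * k) +
          (Real.log μ + (2 - μ) / μ - (2 - μ) ^ 2 / (2 * μ ^ 2) + (2 - μ) ^ 3 / (3 * μ ^ 3)) := by
      intro k
      rw [hlog k]
      refine (add_le_add_right (log_le_cubic (by positivity : 0 < ((k : ℝ) + 2) / μ))
        (Real.log μ)).trans (le_of_eq ?_)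
      field_simp
      ring
    have g1 := HasGrowth.cube.const_mul (1 / (3 * μ ^ 3))
    have g2 := HasGrowth.sq.const_mul ((6 - 3 * μ) / (3 * μ ^ 3) - 1 / (2 * μ ^ 2))
    have g3 := HasGrowth.cast.const_mul (1 / μ - (4 - 2 * μ) / (2 * μ ^ 2) + (2 - μ) ^ 2 / μ ^ 3)
    have g4 := HasGrowth.const
      (Real.log μ + (2 - μ) / μ - (2 - μ) ^ 2 / (2 * μ ^ 2) + (2 - μ) ^ 3 / (3 * μ ^ 3))
    have h := poissonMean_mono (hasGrowth_log two_pos) (((g1.add g2).add g3).add g4) hb hμ.le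
    rw [poissonMean_add ((g1.add g2).add g3) g4, poissonMean_add (g1.add g2) g3,
      poissonMean_add g1 g2, poissonMean_const_mul, poissonMean_const_mul, poissonMean_const_mul,
      poissonMean_const, poissonMean_cube, poissonMean_sq, poissonMean_cast] at h
    have e : 3 / 2 / μ + 1 / (3 * μ ^ 2) + 8 / (3 * μ ^ 3) ≤ 3 / 2 / μ + 3 / μ ^ 2 := by
      have : 8 / (3 * μ ^ 3) ≤ 8 / (3 * μ ^ 2) := by
        gcongr
        norm_num
      have e2 : 3 / μ ^ 2 = 1 / (3 * μ ^ 2) + 8 / (3 * μ ^ 2) := by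
        field_simp
        norm_num
      linarith
    have e3 : 1 / (3 * μ ^ 3) * (μ ^ 3 + 3 * μ ^ 2 + μ) +
          ((6 - 3 * μ) / (3 * μ ^ 3) - 1 / (2 * μ ^ 2)) * (μ ^ 2 + μ) +
          (1 / μ - (4 - 2 * μ) / (2 * μ ^ 2) + (2 - μ) ^ 2 / μ ^ 3) * μ +
          (Real.log μ + (2 - μ) / μ - (2 - μ) ^ 2 / (2 * μ ^ 2) + (2 - μ) ^ 3 / (3 * μ ^ 3)) =
        Real.log μ + (3 / 2 / μ + 1 / (3 * μ ^ 2) + 8 / (3 * μ ^ 3)) := by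
      field_simp
      ring
    linarith
  · have hb : ∀ k : ℕ, Real.log (k + 2) ≤ 1 / μ * k + (Real.log μ + 2 / μ - 1) := by
      intro k
      rw [hlog k]
      have := Real.log_le_sub_one_of_pos (by positivity : 0 < ((k : ℝ) + 2) / μ)
      have e : ((k : ℝ) + 2) / μ = 1 / μ * k + 2 / μ := by ring
      linarith
    have g1 := HasGrowth.cast.const_mul (1 / μ)
    have g2 := HasGrowth.const (Real.log μ + 2 / μ - 1)
    have h := poissonMean_mono (hasGrowth_log two_pos) (g1.add g2) hb hμ.le
    rw [poissonMean_add g1 g2, poissonMean_const_mul, poissonMean_const, poissonMean_cast] at h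
    have e1 : 1 / μ * μ = 1 := by field_simp
    have e2 : 2 / μ ≤ 3 / 2 / μ + 3 / μ ^ 2 := by
      have : 1 / μ ≤ 1 / μ ^ 2 := by
        gcongr
        nlinarith
      have e3 : 2 / μ = 3 / 2 / μ + 1 / 2 * (1 / μ) := by ring
      have e4 : 3 / μ ^ 2 = 3 * (1 / μ ^ 2) := by ring
      have : 0 < 1 / μ ^ 2 := by positivity
      linarith
    linarith

/-- The correction term is shaped to telescope: at x = 1/(2(k+1)) it is the difference of
1/(24(k+1/2)²) at k and at k + 1. The derivative of the gap is a sum of nonnegative multiples of x⁴.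
-/
theorem log_div_le_artanh {x : ℝ} (h0 : 0 ≤ x) (h1 : x < 1) :
    Real.log (1 + x) - Real.log (1 - x) ≤ 2 * x + 2 / 3 * x ^ 3 / (1 - x ^ 2) ^ 2 := by
  have hpos : ∀ y ∈ Set.Ico (0 : ℝ) 1, 0 < 1 - y ^ 2 := fun y hy => by nlinarith [hy.1, hy.2]
  have hd : ∀ y ∈ Set.Ico (0 : ℝ) 1, HasDerivAt
      (fun x => 2 * x + 2 / 3 * x ^ 3 / (1 - x ^ 2) ^ 2 - (Real.log (1 + x) - Real.log (1 - x)))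
      (2 + (2 / 3 * (3 * y ^ 2) * (1 - y ^ 2) ^ 2 - 2 / 3 * y ^ 3 * (2 * (1 - y ^ 2) * (-(2 * y))))
        / ((1 - y ^ 2) ^ 2) ^ 2 - (1 / (1 + y) - -1 / (1 - y))) y := by
    intro y hy
    have hy2 := hpos y hy
    have d1 : HasDerivAt (fun x : ℝ => 2 * x) 2 y := by simpa using (hasDerivAt_id y).const_mul 2
    have d2 : HasDerivAt (fun x : ℝ => 2 / 3 * x ^ 3) (2 / 3 * (3 * y ^ 2)) y := by
      simpa using (hasDerivAt_pow 3 y).const_mul (2 / 3)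
    have d3 : HasDerivAt (fun x : ℝ => 1 - x ^ 2) (-(2 * y)) y := by
      simpa using (hasDerivAt_pow 2 y).const_sub 1
    have d4 : HasDerivAt (fun x : ℝ => (1 - x ^ 2) ^ 2) (2 * (1 - y ^ 2) * (-(2 * y))) y := by
      exact (d3.pow 2).congr_deriv (by simp)
    have d5 : HasDerivAt (fun x : ℝ => Real.log (1 + x)) (1 / (1 + y)) y :=
      ((hasDerivAt_id y).const_add 1).log (by have := hy.1; simp; positivity)
    have d6 : HasDerivAt (fun x : ℝ => Real.log (1 - x)) (-1 / (1 - y)) y :=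
      ((hasDerivAt_id y).const_sub 1).log (by have := hy.2; simp; linarith)
    exact (d1.add (d2.div d4 (by positivity))).sub (d5.sub d6)
  have hm : MonotoneOn
      (fun x : ℝ => 2 * x + 2 / 3 * x ^ 3 / (1 - x ^ 2) ^ 2 - (Real.log (1 + x) - Real.log (1 - x)))
      (Set.Ico 0 1) := by
    refine monotoneOn_of_hasDerivWithinAt_nonneg (convex_Ico 0 1)
      (fun y hy => (hd y hy).continuousAt.continuousWithinAt)
      (fun y hy => (hd y (interior_subset hy)).hasDerivWithinAt) fun y hy => ?_
    have hy' := interior_subset hy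
    have hy2 := hpos y hy'
    have h3 : 0 < 1 + y := by linarith [hy'.1]
    have h4 : 0 < 1 - y := by linarith [hy'.2]
    have h0 := hy'.1
    have e : 2 + (2 / 3 * (3 * y ^ 2) * (1 - y ^ 2) ^ 2 - 2 / 3 * y ^ 3 *
        (2 * (1 - y ^ 2) * (-(2 * y)))) / ((1 - y ^ 2) ^ 2) ^ 2 - (1 / (1 + y) - -1 / (1 - y)) =
        2 * y ^ 4 / (1 - y ^ 2) ^ 2 + 8 / 3 * y ^ 4 / (1 - y ^ 2) ^ 3 := by
      have e1 : 1 / (1 + y) - -1 / (1 - y) = 2 / (1 - y ^ 2) := by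
        rw [show 1 - y ^ 2 = (1 + y) * (1 - y) by ring]
        field_simp
        ring
      rw [e1]
      field_simp
      ring
    rw [e]
    positivity
  have := hm ⟨le_rfl, one_pos⟩ ⟨h0, h1⟩ h0
  simp at this
  linarith

/-- Moving everything but γ to one side gives a sequence in k that decreases, by the previous bound,
and stays above log m - H_m for every later m; the limit of the latter is -γ. -/
theorem harmonic_sub_le (k : ℕ) :
    (harmonic k : ℝ) - Real.eulerMascheroniConstant ≤
      Real.log (k + 1 / 2) + 1 / (24 * (k + 1 / 2 : ℝ) ^ 2) := by
  have hanti : Antitone fun k : ℕ =>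
      Real.log (k + 1 / 2) + 1 / (24 * (k + 1 / 2 : ℝ) ^ 2) - (harmonic k : ℝ) := by
    refine antitone_nat_of_succ_le fun k => ?_
    rw [harmonic_succ]
    push_cast
    have hk : (0 : ℝ) ≤ k := by positivity
    have hx0 : (0 : ℝ) ≤ 1 / (2 * (k + 1)) := by positivity
    have hx1 : 1 / (2 * (k + 1) : ℝ) < 1 := by
      rw [div_lt_one (by positivity)]
      linarith
    have h := log_div_le_artanh hx0 hx1
    have e1 : 1 + 1 / (2 * (k + 1) : ℝ) = (k + 1 + 1 / 2) / (k + 1) := by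
      field_simp
    have e2 : 1 - 1 / (2 * (k + 1) : ℝ) = (k + 1 / 2) / (k + 1) := by
      field_simp
      ring
    have e3 : 2 * (1 / (2 * (k + 1) : ℝ)) +
        2 / 3 * (1 / (2 * (k + 1) : ℝ)) ^ 3 / (1 - (1 / (2 * (k + 1) : ℝ)) ^ 2) ^ 2 =
        (k + 1 : ℝ)⁻¹ + (1 / (24 * (k + 1 / 2 : ℝ) ^ 2) - 1 / (24 * (k + 1 + 1 / 2 : ℝ) ^ 2)) := by
      have e4 : 1 - (1 / (2 * (k + 1) : ℝ)) ^ 2 =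
          ((k + 1 / 2) * (k + 1 + 1 / 2)) / (k + 1) ^ 2 := by
        field_simp
        ring
      rw [e4]
      field_simp
      ring
    rw [e3, e1, e2, Real.log_div (by positivity) (by positivity),
      Real.log_div (by positivity) (by positivity)] at h
    linarith
  have hlim : Filter.Tendsto (fun n => -Real.eulerMascheroniSeq' n) Filter.atTop
      (nhds (-Real.eulerMascheroniConstant)) := Real.tendsto_eulerMascheroniSeq'.neg
  have := le_of_tendsto hlim (b := Real.log (k + 1 / 2) + 1 / (24 * (k + 1 / 2 : ℝ) ^ 2) -
      (harmonic k : ℝ)) (by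
    -- Indices at least k + 1 avoid the special value of `Real.eulerMascheroniSeq'` at 0.
    filter_upwards [Filter.eventually_ge_atTop (k + 1)] with m hm
    refine le_trans ?_ (hanti (by omega : k ≤ m))
    have hm0 : m ≠ 0 := by omega
    have hm1 : (0 : ℝ) < m := by positivity
    have h1 : Real.log m ≤ Real.log (m + 1 / 2) := Real.log_le_log hm1 (by linarith)
    have h2 : 0 ≤ 1 / (24 * (m + 1 / 2 : ℝ) ^ 2) := by positivity
    simp only [Real.eulerMascheroniSeq', hm0, if_false]
    linarith)
  linarith

theorem hasGrowth_inv_succ : HasGrowth fun k => 1 / ((k : ℝ) + 1) :=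
  (HasGrowth.const 1).mono fun k => by
    rw [abs_of_nonneg (by positivity), abs_one, div_le_one (by positivity)]
    linarith [k.cast_nonneg (α := ℝ)]

theorem poissonMean_inv_succ {μ : ℝ} (hμ : 0 < μ) :
    poissonMean (fun k => 1 / ((k : ℝ) + 1)) μ = (1 - Real.exp (-μ)) / μ := by
  -- With the convention 1/0 = 0 the product is 0 at k = 0, so the Stein–Chen identity produces the
  -- probability of a positive count.
  have e : (fun k : ℕ => (k : ℝ) * (1 / (k : ℝ))) = fun k : ℕ => 1 - if k = 0 then 1 else 0 := by
    funext k
    by_cases hk : k = 0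
    · simp [hk]
    · have : (k : ℝ) ≠ 0 := by exact_mod_cast hk
      simp [hk, this]
  have hg : HasGrowth fun k : ℕ => (k : ℝ) * (1 / (k : ℝ)) := by
    rw [e]
    exact (HasGrowth.const 1).sub (HasGrowth.single 0 1)
  have h := mul_poissonMean_shift hg μ
  rw [e, poissonMean_sub (HasGrowth.const 1) (HasGrowth.single 0 1), poissonMean_const,
    poissonMean_single] at h
  simp only [Nat.cast_add, Nat.cast_one] at h
  rw [eq_div_iff hμ.ne', mul_comm, h]
  simp

theorem hasGrowth_harmonic : HasGrowth fun k => (harmonic k : ℝ) := by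
  refine HasGrowth.of_diff (hasGrowth_inv_succ.mono fun k => le_of_eq ?_)
  rw [harmonic_succ]
  push_cast
  congr 1
  ring

/-- The function E H_K - log μ - exp(-μ)/(1+μ) has derivative -exp(-μ)/(μ(1+μ)²), so it decreases;
it is at least its limit at infinity, which is bounded below by γ. -/
theorem le_poissonMean_harmonic {μ : ℝ} (hμ : 0 < μ) :
    Real.eulerMascheroniConstant + Real.log μ + Real.exp (-μ) / (1 + μ) ≤
      poissonMean (fun k => (harmonic k : ℝ)) μ := by
  have hd : ∀ x : ℝ, 0 < x → HasDerivAt (fun μ => poissonMean (fun k => (harmonic k : ℝ)) μ -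
      Real.log μ - Real.exp (-μ) / (1 + μ)) (-(Real.exp (-x) / (x * (1 + x) ^ 2))) x := by
    intro x hx
    have d1 := hasDerivAt_poissonMean hasGrowth_harmonic x
    have e1 : (fun k : ℕ => ((harmonic (k + 1) : ℚ) : ℝ) - ((harmonic k : ℚ) : ℝ)) =
        fun k : ℕ => 1 / ((k : ℝ) + 1) := by
      funext k
      rw [harmonic_succ]
      push_cast
      ring
    rw [e1, poissonMean_inv_succ hx] at d1
    have d2 : HasDerivAt (fun μ : ℝ => Real.exp (-μ)) (-Real.exp (-x)) x := by
      simpa using (hasDerivAt_neg x).exp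
    have d3 : HasDerivAt (fun μ : ℝ => 1 + μ) 1 x := (hasDerivAt_id x).const_add 1
    refine ((d1.sub (Real.hasDerivAt_log hx.ne')).sub
      (d2.div d3 (by positivity))).congr_deriv ?_
    field_simp
    ring
  have hanti : AntitoneOn (fun μ => poissonMean (fun k => (harmonic k : ℝ)) μ -
      Real.log μ - Real.exp (-μ) / (1 + μ)) (Set.Ioi 0) := by
    refine antitoneOn_of_hasDerivWithinAt_nonpos (convex_Ioi 0)
      (fun x hx => (hd x hx).continuousAt.continuousWithinAt)
      (fun x hx => (hd x (interior_subset hx)).hasDerivWithinAt) fun x hx => ?_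
    have : 0 < x := interior_subset hx
    exact neg_nonpos.mpr (by positivity)
  -- Monotonicity does the real work, so near infinity a crude bound with the right limit is enough:
  -- tangent inequalities for log reduce it to the explicit mean of 1/(k+1).
  have hlow : ∀ ν : ℝ, 0 < ν → Real.eulerMascheroniConstant - 3 / ν ≤
      poissonMean (fun k => (harmonic k : ℝ)) ν - Real.log ν - Real.exp (-ν) / (1 + ν) := by
    intro ν hν
    have hb : ∀ k : ℕ, (Real.eulerMascheroniConstant + Real.log ν + 1) - (ν + 2) * (1 / (k + 1)) ≤
        (harmonic k : ℝ) := by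
      intro k
      have h1 : Real.eulerMascheroniConstant + Real.log (k + 1) - 2 * (1 / (k + 1)) ≤
          (harmonic k : ℝ) := by
        rcases Nat.eq_zero_or_pos k with rfl | hk
        · have := Real.eulerMascheroniConstant_lt_two_thirds
          simp
          linarith
        · have h2 := Real.eulerMascheroniConstant_lt_eulerMascheroniSeq' k
          simp only [Real.eulerMascheroniSeq', hk.ne', if_false] at h2
          have hk1 : (1 : ℝ) ≤ k := by exact_mod_cast hk
          have h3 := Real.log_le_sub_one_of_pos (by positivity : 0 < ((k : ℝ) + 1) / k)
          rw [Real.log_div (by positivity) (by positivity)] at h3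
          have h4 : ((k : ℝ) + 1) / k - 1 ≤ 2 * (1 / (k + 1)) := by
            rw [div_sub_one (by positivity), ← mul_div_assoc, div_le_div_iff₀ (by positivity)
              (by positivity)]
            linarith
          linarith
      have h5 := Real.one_sub_inv_le_log_of_pos (by positivity : 0 < ((k : ℝ) + 1) / ν)
      rw [Real.log_div (by positivity) hν.ne', inv_div] at h5
      have e : ν / ((k : ℝ) + 1) = ν * (1 / (k + 1)) := by ring
      linarith
    have g1 := HasGrowth.const (Real.eulerMascheroniConstant + Real.log ν + 1)
    have g2 := hasGrowth_inv_succ.const_mul (ν + 2)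
    have h := poissonMean_mono (g1.sub g2) hasGrowth_harmonic hb hν.le
    rw [poissonMean_sub g1 g2, poissonMean_const, poissonMean_const_mul,
      poissonMean_inv_succ hν] at h
    have hexp := Real.exp_pos (-ν)
    have h6 : (ν + 2) * ((1 - Real.exp (-ν)) / ν) ≤ 1 + 2 / ν - Real.exp (-ν) := by
      have : (ν + 2) * ((1 - Real.exp (-ν)) / ν) =
          1 + 2 / ν - Real.exp (-ν) - 2 * Real.exp (-ν) / ν := by
        field_simp
        ring
      have : 0 < 2 * Real.exp (-ν) / ν := by positivity
      linarith
    have h7 : Real.exp (-ν) / (1 + ν) ≤ Real.exp (-ν) :=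
      div_le_self hexp.le (by linarith)
    have h8 : 2 / ν ≤ 3 / ν := by gcongr; norm_num
    linarith
  have hlim : Filter.Tendsto (fun ν : ℝ => Real.eulerMascheroniConstant - 3 / ν) Filter.atTop
      (nhds Real.eulerMascheroniConstant) := by
    simpa using (tendsto_const_nhds (x := Real.eulerMascheroniConstant)).sub
      ((tendsto_const_nhds (x := (3 : ℝ))).div_atTop Filter.tendsto_id)
  have := le_of_tendsto hlim (b := poissonMean (fun k => (harmonic k : ℝ)) μ -
      Real.log μ - Real.exp (-μ) / (1 + μ)) (by
    filter_upwards [Filter.eventually_ge_atTop μ] with ν hν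
    exact (hlow ν (hμ.trans_le hν)).trans (hanti hμ (hμ.trans_le hν) hν))
  linarith

/-- The two harmonic bounds leave E[1/(24(K+1/2)²)] - exp(-μ)/(1+μ). Multiplied by μ, the first term
becomes E[K/(24(K-1/2)²)] by the Stein–Chen identity; its excess over 0.02 sits on small counts and
is beaten by μ exp(-μ)/(1+μ). -/
theorem log_sub_poissonMean_log_lt {μ : ℝ} (hμ : 0 < μ) :
    Real.log μ - poissonMean (fun k => Real.log (k + 1 / 2)) μ < 0.02 / μ := by
  have gc : HasGrowth fun k : ℕ => 1 / (24 * (k + 1 / 2 : ℝ) ^ 2) :=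
    (HasGrowth.const 1).mono fun k => by
      rw [abs_of_nonneg (by positivity), abs_one, div_le_one (by positivity)]
      nlinarith [k.cast_nonneg (α := ℝ)]
  have gl := hasGrowth_log (a := 1 / 2) (by norm_num)
  have gh := hasGrowth_harmonic
  have h1 := poissonMean_mono (gh.sub (HasGrowth.const Real.eulerMascheroniConstant))
    (gl.add gc) harmonic_sub_le hμ.le
  rw [poissonMean_sub gh (HasGrowth.const _), poissonMean_const, poissonMean_add gl gc] at h1
  have h2 := le_poissonMean_harmonic hμ
  -- The constant 0.02 is the exact value at k = 3. The counts 1 and 2 exceed it; the slack at 0, 4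
  -- and 5 is recorded because the polynomial inequality below uses it.
  have hb : ∀ k : ℕ, (k : ℝ) * (1 / (24 * (k - 1 / 2 : ℝ) ^ 2)) ≤
      ((((0.02 + if k = 0 then (-0.02 : ℝ) else 0) + if k = 1 then (0.147 : ℝ) else 0) +
        if k = 2 then (0.0171 : ℝ) else 0) + if k = 4 then (-0.0063 : ℝ) else 0) +
        if k = 5 then (-0.0097 : ℝ) else 0 := by
    intro k
    by_cases h6 : 6 ≤ k
    · have h7 : (6 : ℝ) ≤ k := by exact_mod_cast h6
      have e : (k : ℝ) * (1 / (24 * (k - 1 / 2 : ℝ) ^ 2)) ≤ 0.02 := by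
        rw [mul_one_div, div_le_iff₀ (by nlinarith)]
        nlinarith
      have : k ≠ 0 := by omega
      have : k ≠ 1 := by omega
      have : k ≠ 2 := by omega
      have : k ≠ 4 := by omega
      have : k ≠ 5 := by omega
      simp_all
    · interval_cases k <;> norm_num
  have g0 := HasGrowth.const 0.02
  have g1 := g0.add (HasGrowth.single 0 (-0.02))
  have g2 := g1.add (HasGrowth.single 1 0.147)
  have g3 := g2.add (HasGrowth.single 2 0.0171)
  have g4 := g3.add (HasGrowth.single 4 (-0.0063))
  have g5 := g4.add (HasGrowth.single 5 (-0.0097))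
  have gk : HasGrowth fun k : ℕ => (k : ℝ) * (1 / (24 * (k - 1 / 2 : ℝ) ^ 2)) := by
    refine (HasGrowth.cast).mono fun k => ?_
    rw [abs_mul]
    refine mul_le_of_le_one_right (abs_nonneg _) ?_
    have : 1 / 4 ≤ (k - 1 / 2 : ℝ) ^ 2 := by
      rcases Nat.eq_zero_or_pos k with rfl | hk
      · norm_num
      · have : (1 : ℝ) ≤ k := by exact_mod_cast hk
        nlinarith
    rw [abs_of_nonneg (by positivity), div_le_one (by positivity)]
    linarith
  have h3 := mul_poissonMean_shift gk μ
  have h4 := poissonMean_mono gk g5 hb hμ.le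
  rw [poissonMean_add g4 (HasGrowth.single _ _), poissonMean_add g3 (HasGrowth.single _ _),
    poissonMean_add g2 (HasGrowth.single _ _), poissonMean_add g1 (HasGrowth.single _ _),
    poissonMean_add g0 (HasGrowth.single _ _), poissonMean_const, poissonMean_single,
    poissonMean_single, poissonMean_single, poissonMean_single, poissonMean_single, ← h3] at h4
  have e5 : (fun k : ℕ => 1 / (24 * (((k + 1 : ℕ) : ℝ) - 1 / 2) ^ 2)) =
      fun k : ℕ => 1 / (24 * (k + 1 / 2 : ℝ) ^ 2) := by
    funext k
    push_cast
    congr 3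
    ring
  rw [e5] at h4
  norm_num [Nat.factorial] at h4
  have hpoly : -0.02 + 0.147 * μ + 0.0171 / 2 * μ ^ 2 - 0.0063 / 24 * μ ^ 4 -
      0.0097 / 120 * μ ^ 5 < μ / (1 + μ) := by
    rw [lt_div_iff₀ (by positivity)]
    rcases le_total μ 4 with h4' | h4'
    · have : 0 < μ ^ 4 := by positivity
      have : 0 < μ ^ 5 := by positivity
      have : 0 < μ ^ 6 := by positivity
      nlinarith [mul_nonneg hμ.le (sub_nonneg.mpr h4'),
        mul_nonneg (sq_nonneg μ) (sub_nonneg.mpr h4')]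
    · have h5' : 4 * μ ^ 4 ≤ μ ^ 5 := by nlinarith [pow_pos hμ 4]
      have h6' : 16 * μ ^ 4 ≤ μ ^ 6 := by nlinarith [pow_pos hμ 5]
      -- For μ ≥ 4 the terms of degree 5 and 6 are bounded by multiples of μ⁴, and 0.0029 is a
      -- rounded-down total coefficient of μ⁴; a factor μ then splits off. The cubic is smallest on
      -- μ > 0 near 5.3.
      have hcubic : 0 < 0.873 - 0.15555 * μ - 0.00855 * μ ^ 2 + 0.0029 * μ ^ 3 := by
        nlinarith [mul_nonneg hμ.le (sq_nonneg (μ - 5.3)), sq_nonneg (μ - 5.3)]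
      nlinarith [mul_pos hμ hcubic]
  have hexp := Real.exp_pos (-μ)
  have h5 := mul_lt_mul_of_pos_left hpoly hexp
  have h6 : μ * (Real.log μ - poissonMean (fun k => Real.log (k + 1 / 2)) μ) ≤
      μ * poissonMean (fun k : ℕ => 1 / (24 * (k + 1 / 2 : ℝ) ^ 2)) μ -
        Real.exp (-μ) * (μ / (1 + μ)) := by
    have : Real.log μ - poissonMean (fun k => Real.log (k + 1 / 2)) μ ≤
      poissonMean (fun k : ℕ => 1 / (24 * (k + 1 / 2 : ℝ) ^ 2)) μ -
        Real.exp (-μ) / (1 + μ) := by linarith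
    refine (mul_le_mul_of_nonneg_left this hμ.le).trans (le_of_eq ?_)
    ring
  rw [lt_div_iff₀' hμ]
  norm_num at h6 ⊢
  nlinarith

end PoissonPrediction

namespace PoissonPrediction

/-! ### Gaussian averages of negative powers of the distance to a subspace -/

/-- Completing the square: the integrand times the Gaussian density is a constant multiple of the
density with mean -2τva/D and variance v/D, where D = 1 + 2τv. -/
theorem lintegral_exp_sq_gaussianReal {v : NNReal} (hv : v ≠ 0) {τ : ℝ} (hτ : 0 ≤ τ) (a : ℝ) :
    ∫⁻ w, ENNReal.ofReal (Real.exp (-τ * (a + w) ^ 2)) ∂gaussianReal 0 v =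
      ENNReal.ofReal ((1 + 2 * τ * v) ^ (-(1 / 2) : ℝ) *
        Real.exp (-(τ / (1 + 2 * τ * v)) * a ^ 2)) := by
  have hv0 : 0 < (v : ℝ) := by positivity
  set D : ℝ := 1 + 2 * τ * v with hD
  have hDpos : 0 < D := by positivity
  obtain ⟨v', hv'⟩ : ∃ v' : NNReal, (v' : ℝ) = v / D := ⟨NNReal.mk (v / D) (by positivity), rfl⟩
  have hv'0 : v' ≠ 0 := by
    rw [← NNReal.coe_ne_zero, hv']
    positivity
  have key : ∀ w, gaussianPDFReal 0 v w * Real.exp (-τ * (a + w) ^ 2) =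
      (D ^ (-(1 / 2) : ℝ) * Real.exp (-(τ / D) * a ^ 2)) *
        gaussianPDFReal (-(2 * τ * v * a) / D) v' w := by
    intro w
    have e1 : (√(2 * Real.pi * v))⁻¹ = D ^ (-(1 / 2) : ℝ) * (√(2 * Real.pi * v'))⁻¹ := by
      rw [Real.rpow_neg hDpos.le, ← Real.sqrt_eq_rpow, ← mul_inv, ← Real.sqrt_mul hDpos.le, hv']
      congr 2
      field_simp
    have e2 : Real.exp (-(w - 0) ^ 2 / (2 * v)) * Real.exp (-τ * (a + w) ^ 2) =
        Real.exp (-(τ / D) * a ^ 2) *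
          Real.exp (-(w - -(2 * τ * v * a) / D) ^ 2 / (2 * v')) := by
      rw [← Real.exp_add, ← Real.exp_add, hv']
      congr 1
      field_simp
      rw [hD]
      ring
    rw [gaussianPDFReal, gaussianPDFReal, mul_assoc, e2, e1]
    ring
  rw [gaussianReal_of_var_ne_zero _ hv, lintegral_withDensity_eq_lintegral_mul _
    (measurable_gaussianPDF 0 v) (by fun_prop)]
  simp_rw [Pi.mul_apply, gaussianPDF, ← ENNReal.ofReal_mul (gaussianPDFReal_nonneg 0 v _), key,
    ENNReal.ofReal_mul (by positivity : 0 ≤ D ^ (-(1 / 2) : ℝ) * Real.exp (-(τ / D) * a ^ 2))]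
  rw [lintegral_const_mul _ (by fun_prop), lintegral_gaussianPDFReal_eq_one _ hv'0, mul_one]

variable {d : ℕ}

theorem sqDist_eq_norm_sq (V : Submodule ℝ (EuclideanSpace ℝ (Fin d))) (θ : Fin d → ℝ) :
    sqDist V θ = ‖Vᗮ.starProjection (WithLp.toLp 2 θ)‖ ^ 2 := by
  rw [sqDist, Metric.infDist_eq_iInf, Submodule.starProjection_orthogonal_val,
    Submodule.starProjection_minimal]
  simp only [dist_eq_norm]
  rfl

/-- An orthonormal basis whose leading vectors span the orthogonal complement of `V`. -/
theorem exists_adapted_basis (V : Submodule ℝ (EuclideanSpace ℝ (Fin d))) :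
    ∃ (b : OrthonormalBasis (Fin d) ℝ (EuclideanSpace ℝ (Fin d))) (I : Finset (Fin d)),
      I.card + Module.finrank ℝ V = d ∧
        ∀ θ, sqDist V θ = ∑ i ∈ I, inner ℝ (b i) (WithLp.toLp 2 θ) ^ 2 := by
  set c := stdOrthonormalBasis ℝ Vᗮ with hc
  set m := Module.finrank ℝ Vᗮ with hm
  have hmd : m + Module.finrank ℝ V = d := by
    have := V.finrank_add_finrank_orthogonal
    rw [finrank_euclideanSpace_fin] at this
    omega
  have hle : m ≤ d := by omega
  set s : Set (Fin d) := {i | (i : ℕ) < m} with hs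
  let u : Fin d → EuclideanSpace ℝ (Fin d) := fun i => if h : (i : ℕ) < m then (c ⟨i, h⟩ : _) else 0
  have hu : Orthonormal ℝ (s.domRestrict u) := by
    have h1 : Orthonormal ℝ fun j : Fin m => (c j : EuclideanSpace ℝ (Fin d)) :=
      c.orthonormal.comp_linearIsometry Vᗮ.subtypeₗᵢ
    have h2 := h1.comp (fun i : s => (⟨i.1, i.2⟩ : Fin m)) fun i j hij => by
      have := congrArg Fin.val hij
      exact Subtype.ext (Fin.ext this)
    convert! h2 using 1
    funext i
    have : (i.1 : ℕ) < m := i.2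
    simp [Set.domRestrict, u, this]
  obtain ⟨b, hb⟩ := hu.exists_orthonormalBasis_extension_of_card_eq (by simp)
  refine ⟨b, Finset.univ.map (Fin.castLEEmb hle), by simpa using hmd, fun θ => ?_⟩
  rw [sqDist_eq_norm_sq, Finset.sum_map]
  have h3 : ∀ j : Fin m, b (Fin.castLEEmb hle j) = (c j : EuclideanSpace ℝ (Fin d)) := by
    intro j
    rw [hb _ (by simp [hs])]
    simp [u]
  simp_rw [h3]
  have h4 := c.sum_sq_norm_inner_right (Vᗮ.orthogonalProjectionOnto (WithLp.toLp 2 θ))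
  simp only [Submodule.inner_orthogonalProjectionOnto_eq_of_mem_left, Real.norm_eq_abs, sq_abs] at h4
  rw [h4]
  rfl

theorem measurable_sqDist (V : Submodule ℝ (EuclideanSpace ℝ (Fin d))) : Measurable (sqDist V) := by
  unfold sqDist
  have h : Measurable fun θ : Fin d → ℝ => (WithLp.toLp 2 θ : EuclideanSpace ℝ (Fin d)) := by
    fun_prop
  exact ((Metric.continuous_infDist_pt _).measurable.comp h).pow_const 2

/-- By rotation invariance the Gaussian vector may be expanded in a basis adapted to `V`. The
integral then factors, and only the d - k coordinates orthogonal to `V` contribute. -/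
theorem lintegral_exp_sqDist_gaussian (V : Submodule ℝ (EuclideanSpace ℝ (Fin d))) {v : NNReal}
    (hv : v ≠ 0) {τ : ℝ} (hτ : 0 ≤ τ) (θ : Fin d → ℝ) :
    ∫⁻ w, ENNReal.ofReal (Real.exp (-τ * sqDist V (θ + w)))
        ∂Measure.pi (fun _ : Fin d => gaussianReal 0 v) =
      ENNReal.ofReal ((1 + 2 * τ * v) ^ (-(((d : ℝ) - Module.finrank ℝ V) / 2)) *
        Real.exp (-(τ / (1 + 2 * τ * v)) * sqDist V θ)) := by
  have hvpos : 0 < (v : ℝ) := by positivity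
  obtain ⟨b, I, hI, hb⟩ := exists_adapted_basis V
  have hmap : Measure.pi (fun _ : Fin d => gaussianReal 0 v) =
      (Measure.pi (fun _ : Fin d => gaussianReal 0 1)).map fun x i => √v * x i := by
    rw [Measure.pi_map_pi (by fun_prop)]
    congr 1
    funext i
    rw [gaussianReal_map_const_mul]
    congr 1
    · simp
    · ext
      simp
  have hrot : (Measure.pi (fun _ : Fin d => gaussianReal 0 1)).map (WithLp.toLp 2) =
      (Measure.pi (fun _ : Fin d => gaussianReal 0 1)).map fun x => ∑ i, x i • b i := by
    rw [map_pi_eq_stdGaussian, ← stdGaussian_eq_map_pi_orthonormalBasis b]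
  have hF : Measurable fun y : EuclideanSpace ℝ (Fin d) =>
      ENNReal.ofReal (Real.exp (-τ * sqDist V (θ + √v • y.ofLp))) := by
    have := measurable_sqDist V
    fun_prop
  rw [hmap, lintegral_map (by have := measurable_sqDist V; fun_prop) (by fun_prop)]
  have h1 : ∫⁻ x, ENNReal.ofReal (Real.exp (-τ * sqDist V (θ + fun i => √v * x i)))
      ∂Measure.pi (fun _ : Fin d => gaussianReal 0 1) =
      ∫⁻ y, ENNReal.ofReal (Real.exp (-τ * sqDist V (θ + √v • y.ofLp)))
        ∂(Measure.pi (fun _ : Fin d => gaussianReal 0 1)).map (WithLp.toLp 2) := by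
    rw [lintegral_map hF (by fun_prop)]
    rfl
  rw [h1, hrot, lintegral_map hF (by fun_prop)]
  set A : Fin d → ℝ := fun i => inner ℝ (b i) (WithLp.toLp 2 θ) with hA
  have h2 : ∀ x : Fin d → ℝ, sqDist V (θ + √v • (∑ i, x i • b i).ofLp) =
      ∑ i ∈ I, (A i + √v * x i) ^ 2 := by
    intro x
    rw [hb]
    refine Finset.sum_congr rfl fun i _ => ?_
    rw [show WithLp.toLp 2 (θ + √v • (∑ i, x i • b i).ofLp) =
      WithLp.toLp 2 θ + √v • ∑ i, x i • b i from rfl, inner_add_right, inner_smul_right]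
    congr 3
    simp [inner_sum, inner_smul_right, b.inner_eq_ite]
  have h3 : ∀ x : Fin d → ℝ,
      ENNReal.ofReal (Real.exp (-τ * sqDist V (θ + √v • (∑ i, x i • b i).ofLp))) =
      ∏ i, if i ∈ I then ENNReal.ofReal (Real.exp (-τ * (A i + √v * x i) ^ 2)) else 1 := by
    intro x
    rw [h2, Finset.mul_sum, Real.exp_sum, ENNReal.ofReal_prod_of_nonneg
      fun i _ => (Real.exp_pos _).le, Finset.prod_ite_mem, Finset.univ_inter]
  simp_rw [h3]
  rw [lintegral_pi_prod (fun _ : Fin d => gaussianReal 0 1)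
    (fun i t => if i ∈ I then ENNReal.ofReal (Real.exp (-τ * (A i + √v * t) ^ 2)) else 1)
    (fun i => by split_ifs <;> fun_prop)]
  have h4 : ∀ i, ∫⁻ t, (if i ∈ I then ENNReal.ofReal (Real.exp (-τ * (A i + √v * t) ^ 2)) else 1)
      ∂gaussianReal 0 1 = if i ∈ I then ENNReal.ofReal ((1 + 2 * τ * v) ^ (-(1 / 2) : ℝ) *
        Real.exp (-(τ / (1 + 2 * τ * v)) * A i ^ 2)) else 1 := by
    intro i
    split_ifs
    · rw [← lintegral_exp_sq_gaussianReal hv hτ]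
      have : gaussianReal 0 v = (gaussianReal 0 1).map (√v * ·) := by
        rw [gaussianReal_map_const_mul]
        congr 1
        · simp
        · ext
          simp
      rw [this, lintegral_map (by fun_prop) (by fun_prop)]
    · simp
  simp_rw [h4]
  rw [Finset.prod_ite_mem, Finset.univ_inter, ← ENNReal.ofReal_prod_of_nonneg
    fun i _ => by positivity, Finset.prod_mul_distrib, Finset.prod_const, ← Real.exp_sum,
    ← Finset.mul_sum, hb, ← Real.rpow_natCast, ← Real.rpow_mul (by positivity)]
  congr 3
  have : (I.card : ℝ) + Module.finrank ℝ V = d := by exact_mod_cast hI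
  linarith

end PoissonPrediction

/-! ### Strict superharmonicity under Gaussian averaging -/

namespace PoissonPrediction

theorem lintegral_rpow_mul_exp {α t : ℝ} (hα : 0 < α) (ht : 0 < t) :
    ∫⁻ u in Set.Ioi 0, ENNReal.ofReal (u ^ (α - 1) * Real.exp (-u * t)) =
      ENNReal.ofReal (Real.Gamma α * t ^ (-α)) := by
  have h := Real.integral_rpow_mul_exp_neg_mul_Ioi hα ht
  have e : ∀ u : ℝ, Real.exp (-(t * u)) = Real.exp (-u * t) := fun u => by ring_nf
  simp_rw [e] at h
  have hpos : 0 < (1 / t) ^ α * Real.Gamma α := mul_pos (by positivity) (Real.Gamma_pos_of_pos hα)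
  -- The integral is nonzero, whereas a non-integrable function would have integral 0 by convention.
  have hi : Integrable (fun u : ℝ => u ^ (α - 1) * Real.exp (-u * t))
      (volume.restrict (Set.Ioi 0)) := by
    by_contra hni
    rw [integral_undef hni] at h
    exact hpos.ne h
  rw [← ofReal_integral_eq_lintegral_ofReal hi, h]
  · rw [one_div, Real.inv_rpow ht.le, Real.rpow_neg ht.le, mul_comm]
  · filter_upwards [ae_restrict_mem measurableSet_Ioi] with u hu
    have : (0 : ℝ) < u := hu
    positivity

variable {d : ℕ}

theorem sqDist_nonneg (V : Submodule ℝ (EuclideanSpace ℝ (Fin d))) (θ : Fin d → ℝ) :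
    0 ≤ sqDist V θ := sq_nonneg _

/-- Strict superharmonicity of negative powers of the distance to a subspace: the average over a
Gaussian perturbation of the point is smaller than the value at the point. -/
theorem lintegral_sqDist_rpow_gaussian_lt (V : Submodule ℝ (EuclideanSpace ℝ (Fin d)))
    {v : NNReal} (hv : v ≠ 0) {α : ℝ} (hα : 0 < α)
    (hα' : α ≤ ((d : ℝ) - Module.finrank ℝ V - 2) / 2) {θ : Fin d → ℝ} (hθ : 0 < sqDist V θ) :
    ∫⁻ w, ENNReal.ofReal (sqDist V (θ + w) ^ (-α)) ∂Measure.pi (fun _ : Fin d => gaussianReal 0 v)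
      < ENNReal.ofReal (sqDist V θ ^ (-α)) := by
  have hvpos : 0 < (v : ℝ) := by positivity
  have hm := measurable_sqDist V
  set N := Measure.pi (fun _ : Fin d => gaussianReal 0 v)
  have hΓ := Real.Gamma_pos_of_pos hα
  set s := sqDist V θ with hs
  set c : ℝ := 1 / (2 * v) with hc
  have hcpos : 0 < c := by positivity
  set G : ℝ → ℝ≥0∞ := fun u => ENNReal.ofReal (u ^ (α - 1) * Real.exp (-u * s)) with hG
  have hGm : Measurable G := by fun_prop
  have hGtot : ∫⁻ u in Set.Ioi 0, G u = ENNReal.ofReal (Real.Gamma α * s ^ (-α)) :=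
    lintegral_rpow_mul_exp hα hθ
  -- Laplace representation of s^(-α), then Tonelli and the explicit Gaussian average. Only an
  -- inequality holds pointwise: on `V` itself `0 ^ (-α)` is 0 by convention.
  have h1 : ENNReal.ofReal (Real.Gamma α) * ∫⁻ w, ENNReal.ofReal (sqDist V (θ + w) ^ (-α)) ∂N ≤
      ∫⁻ τ in Set.Ioi 0, ENNReal.ofReal (τ ^ (α - 1) *
        ((1 + 2 * τ * v) ^ (-(((d : ℝ) - Module.finrank ℝ V) / 2)) *
        Real.exp (-(τ / (1 + 2 * τ * v)) * s))) := by
    rw [← lintegral_const_mul _ (by fun_prop)]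
    calc ∫⁻ w, ENNReal.ofReal (Real.Gamma α) * ENNReal.ofReal (sqDist V (θ + w) ^ (-α)) ∂N
        ≤ ∫⁻ w, ∫⁻ τ in Set.Ioi 0, ENNReal.ofReal (τ ^ (α - 1)) *
            ENNReal.ofReal (Real.exp (-τ * sqDist V (θ + w))) ∂volume ∂N := by
          refine lintegral_mono fun w => ?_
          rcases (sqDist_nonneg V (θ + w)).eq_or_lt with h0 | h0
          · simp [← h0, Real.zero_rpow (neg_ne_zero.mpr hα.ne')]
          · rw [← ENNReal.ofReal_mul hΓ.le, ← lintegral_rpow_mul_exp hα h0]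
            refine le_of_eq (setLIntegral_congr_fun measurableSet_Ioi fun τ hτ => ?_)
            have : (0 : ℝ) < τ := hτ
            exact ENNReal.ofReal_mul (by positivity)
      _ = ∫⁻ τ in Set.Ioi 0, ∫⁻ w, ENNReal.ofReal (τ ^ (α - 1)) *
            ENNReal.ofReal (Real.exp (-τ * sqDist V (θ + w))) ∂N ∂volume := by
          refine lintegral_lintegral_swap (Measurable.aemeasurable ?_)
          fun_prop
      _ = _ := by
          refine setLIntegral_congr_fun measurableSet_Ioi fun τ hτ => ?_
          have hτ0 : (0 : ℝ) < τ := hτ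
          rw [lintegral_const_mul _ (by fun_prop), lintegral_exp_sqDist_gaussian V hv hτ0.le,
            ← ENNReal.ofReal_mul (by positivity)]
  have hderiv : ∀ τ ∈ Set.Ioi (0 : ℝ), HasDerivWithinAt (fun τ : ℝ => τ / (1 + 2 * τ * v))
      (1 / (1 + 2 * τ * v) ^ 2) (Set.Ioi 0) τ := by
    intro τ hτ
    have hτ0 : (0 : ℝ) < τ := hτ
    have d1 : HasDerivAt (fun τ : ℝ => 1 + 2 * τ * v) (2 * v) τ := by
      simpa using ((((hasDerivAt_id τ).const_mul 2).mul_const (v : ℝ))).const_add 1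
    refine (((hasDerivAt_id τ).div d1 (by positivity)).congr_deriv ?_).hasDerivWithinAt
    simp only [id]
    congr 1
    ring
  have hinj : Set.InjOn (fun τ : ℝ => τ / (1 + 2 * τ * v)) (Set.Ioi 0) := by
    intro x hx y hy hxy
    have hx0 : (0 : ℝ) < x := hx
    have hy0 : (0 : ℝ) < y := hy
    simp only at hxy
    rw [div_eq_div_iff (by positivity) (by positivity)] at hxy
    linarith
  -- Substitution u = τ/D with D = 1 + 2τv. Jacobian and power of u combine to τ^(α-1) D^(-(α+1)),
  -- which dominates because D ≥ 1 and α + 1 ≤ (d - k)/2; the bound on the exponent is used exactly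
  -- here.
  have h2 : ∫⁻ τ in Set.Ioi 0, ENNReal.ofReal (τ ^ (α - 1) *
        ((1 + 2 * τ * v) ^ (-(((d : ℝ) - Module.finrank ℝ V) / 2)) *
        Real.exp (-(τ / (1 + 2 * τ * v)) * s))) ≤
      ∫⁻ u in (fun τ : ℝ => τ / (1 + 2 * τ * v)) '' Set.Ioi 0, G u := by
    rw [lintegral_image_eq_lintegral_abs_deriv_mul measurableSet_Ioi hderiv hinj]
    refine setLIntegral_mono' measurableSet_Ioi fun τ hτ => ?_
    have hτ0 : (0 : ℝ) < τ := hτ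
    have hD : 1 ≤ 1 + 2 * τ * v := by
      have : 0 ≤ 2 * τ * v := by positivity
      linarith
    have hD0 : 0 < 1 + 2 * τ * v := by linarith
    rw [hG, ← ENNReal.ofReal_mul (abs_nonneg _)]
    refine ENNReal.ofReal_le_ofReal ?_
    rw [abs_of_nonneg (by positivity), Real.div_rpow hτ0.le hD0.le, ← mul_assoc, ← mul_assoc]
    refine mul_le_mul_of_nonneg_right ?_ (Real.exp_pos _).le
    have e : 1 / (1 + 2 * τ * v) ^ 2 * (τ ^ (α - 1) / (1 + 2 * τ * v) ^ (α - 1)) =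
        τ ^ (α - 1) * (1 + 2 * τ * v) ^ (-(α + 1)) := by
      rw [Real.rpow_neg hD0.le, show α + 1 = 2 + (α - 1) by ring, Real.rpow_add hD0,
        Real.rpow_two]
      field_simp
    rw [e]
    refine mul_le_mul_of_nonneg_left ?_ (by positivity)
    exact Real.rpow_le_rpow_of_exponent_le hD (by linarith)
  -- The new variable stays below 1/(2v). The missing tail has positive mass, and this gives
  -- strictness even at the extreme exponent.
  have h3 : ∫⁻ u in (fun τ : ℝ => τ / (1 + 2 * τ * v)) '' Set.Ioi 0, G u ≤
      ∫⁻ u in Set.Ioo 0 c, G u := by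
    refine lintegral_mono_set ?_
    rintro _ ⟨τ, hτ, rfl⟩
    have hτ0 : (0 : ℝ) < τ := hτ
    refine ⟨by positivity, ?_⟩
    simp only [hc]
    rw [div_lt_div_iff₀ (by positivity) (by positivity)]
    linarith
  have hsplit : ∫⁻ u in Set.Ioi 0, G u =
      (∫⁻ u in Set.Ioo 0 c, G u) + ∫⁻ u in Set.Ici c, G u := by
    rw [← lintegral_union measurableSet_Ici]
    · rw [Set.Ioo_union_Ici_eq_Ioi hcpos]
    · exact Set.disjoint_left.mpr fun x hx hx' => not_lt.mpr hx' hx.2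
  have hpos : ∫⁻ u in Set.Ici c, G u ≠ 0 := by
    rw [← pos_iff_ne_zero, setLIntegral_pos_iff hGm]
    have : Set.Ici c ⊆ Function.support G ∩ Set.Ici c := by
      intro u hu
      have hu0 : 0 < u := hcpos.trans_le hu
      refine ⟨?_, hu⟩
      simp only [hG, Function.mem_support, ne_eq, ENNReal.ofReal_eq_zero, not_le]
      positivity
    refine lt_of_lt_of_le ?_ (measure_mono this)
    simp
  have h4 : ∫⁻ u in Set.Ioo 0 c, G u < ∫⁻ u in Set.Ioi 0, G u := by
    rw [hsplit]
    refine ENNReal.lt_add_right (ne_of_lt ?_) hpos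
    calc ∫⁻ u in Set.Ioo 0 c, G u ≤ ∫⁻ u in Set.Ioi 0, G u :=
          lintegral_mono_set Set.Ioo_subset_Ioi_self
      _ < ∞ := by rw [hGtot]; exact ENNReal.ofReal_lt_top
  have h5 := ((h1.trans h2).trans h3).trans_lt h4
  rw [hGtot, ENNReal.ofReal_mul hΓ.le] at h5
  exact lt_of_mul_lt_mul_left' h5

theorem sqDist_eq_zero_iff (V : Submodule ℝ (EuclideanSpace ℝ (Fin d))) (θ : Fin d → ℝ) :
    sqDist V θ = 0 ↔ WithLp.toLp 2 θ ∈ V := by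
  rw [sqDist, sq_eq_zero_iff, ← IsClosed.mem_iff_infDist_zero V.closed_of_finiteDimensional
    ⟨0, V.zero_mem⟩]
  rfl

theorem ae_sqDist_pos (V : Submodule ℝ (EuclideanSpace ℝ (Fin d))) (hV : Module.finrank ℝ V < d) :
    ∀ᵐ θ : Fin d → ℝ, 0 < sqDist V θ := by
  set W : Submodule ℝ (Fin d → ℝ) :=
    V.comap (WithLp.linearEquiv 2 ℝ (Fin d → ℝ)).symm.toLinearMap with hW
  have hne : W ≠ ⊤ := by
    intro h
    have h2 : V = ⊤ := by
      rw [Submodule.eq_top_iff']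
      intro x
      have : WithLp.ofLp x ∈ W := by rw [h]; trivial
      exact this
    rw [h2, finrank_top, finrank_euclideanSpace_fin] at hV
    exact lt_irrefl _ hV
  have h0 := Measure.addHaar_submodule (volume : Measure (Fin d → ℝ)) W hne
  filter_upwards [measure_eq_zero_iff_ae_notMem.mp h0] with θ hθ
  refine (sqDist_nonneg V θ).lt_of_ne fun h => hθ ?_
  exact (sqDist_eq_zero_iff V θ).mp h.symm

end PoissonPrediction

namespace PoissonPrediction

/-! ### The symmetrized square root of a gamma law -/

theorem Gamma_nat_add_half_eq (n : ℕ) :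
    Real.Gamma (n + 1 / 2) = (2 * n).factorial * √Real.pi / (4 ^ n * n.factorial) := by
  induction n with
  | zero => simp [-one_div, Real.Gamma_one_half_eq]
  | succ n ih =>
    rw [show ((n + 1 : ℕ) : ℝ) + 1 / 2 = (n + 1 / 2) + 1 by push_cast; ring,
      Real.Gamma_add_one (by positivity), ih, show 2 * (n + 1) = 2 * n + 1 + 1 by ring,
      Nat.factorial_succ, Nat.factorial_succ, Nat.factorial_succ]
    push_cast
    field_simp
    ring

theorem integrable_pow_mul_exp_neg_mul_sq {b : ℝ} (hb : 0 < b) (j : ℕ) :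
    Integrable fun y : ℝ => y ^ j * Real.exp (-b * y ^ 2) := by
  have h := integrable_rpow_mul_exp_neg_mul_sq hb (s := j)
    (lt_of_lt_of_le (by norm_num) (Nat.cast_nonneg j))
  simpa using h

theorem integral_even_pow_mul_exp_neg_mul_sq {b : ℝ} (hb : 0 < b) (j : ℕ) :
    ∫ y : ℝ, y ^ (2 * j) * Real.exp (-b * y ^ 2) = Real.Gamma (j + 1 / 2) / (b ^ j * √b) := by
  have h1 : ∀ y : ℝ, y ^ (2 * j) * Real.exp (-b * y ^ 2) =
      |y| ^ (2 * j) * Real.exp (-b * |y| ^ 2) := by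
    intro y
    rw [pow_mul, pow_mul, sq_abs]
  rw [integral_congr_ae (ae_of_all _ h1),
    integral_comp_abs (f := fun y => y ^ (2 * j) * Real.exp (-b * y ^ 2))]
  have h2 := integral_rpow_mul_exp_neg_mul_rpow (p := 2) (q := (2 * j : ℕ)) two_pos
    (lt_of_lt_of_le (by norm_num) (Nat.cast_nonneg _)) hb
  simp only [Real.rpow_natCast, Real.rpow_two] at h2
  rw [h2, show (((2 * j : ℕ) : ℝ) + 1) / 2 = j + 1 / 2 by push_cast; ring,
    show -(((2 * j : ℕ) : ℝ) + 1) / 2 = -(j + 1 / 2) by push_cast; ring, Real.rpow_neg hb.le,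
    Real.rpow_add hb, Real.rpow_natCast, ← Real.sqrt_eq_rpow]
  field_simp

theorem integral_odd_pow_mul_exp_neg_mul_sq (b : ℝ) (j : ℕ) :
    ∫ y : ℝ, y ^ (2 * j + 1) * Real.exp (-b * y ^ 2) = 0 := by
  have h := integral_neg_eq_self (fun y : ℝ => y ^ (2 * j + 1) * Real.exp (-b * y ^ 2)) volume
  have h1 : ∀ y : ℝ, (-y) ^ (2 * j + 1) * Real.exp (-b * (-y) ^ 2) =
      -(y ^ (2 * j + 1) * Real.exp (-b * y ^ 2)) := by
    intro y
    rw [Odd.neg_pow ⟨j, rfl⟩, neg_sq]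
    ring
  simp_rw [h1, integral_neg] at h
  linarith

theorem sum_range_even {M : Type*} [AddCommMonoid M] (f : ℕ → M) (hf : ∀ j, f (2 * j + 1) = 0)
    (z : ℕ) : ∑ i ∈ Finset.range (2 * z + 1), f i = ∑ k ∈ Finset.range (z + 1), f (2 * k) := by
  induction z with
  | zero => simp
  | succ z ih =>
    rw [show 2 * (z + 1) + 1 = 2 * z + 1 + 1 + 1 by ring, Finset.sum_range_succ,
      Finset.sum_range_succ, ih, hf, add_zero, Finset.sum_range_succ _ (z + 1)]
    rfl

/-- Binomial expansion in which the odd Gaussian moments vanish. -/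
theorem integral_shift_pow_mul_exp {b : ℝ} (hb : 0 < b) (m : ℝ) (z : ℕ) :
    ∫ y : ℝ, (m + y) ^ (2 * z) * Real.exp (-b * y ^ 2) = ∑ k ∈ Finset.range (z + 1),
      m ^ (2 * k) * (2 * z).choose (2 * k) *
        (Real.Gamma ((z - k : ℕ) + 1 / 2) / (b ^ (z - k) * √b)) := by
  have h1 : ∀ y : ℝ, (m + y) ^ (2 * z) * Real.exp (-b * y ^ 2) =
      ∑ i ∈ Finset.range (2 * z + 1), (m ^ i * (2 * z).choose i) *
        (y ^ (2 * z - i) * Real.exp (-b * y ^ 2)) := by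
    intro y
    rw [add_pow, Finset.sum_mul]
    exact Finset.sum_congr rfl fun i _ => by ring
  simp_rw [h1]
  rw [integral_finsetSum _ fun i _ => (integrable_pow_mul_exp_neg_mul_sq hb _).const_mul _]
  simp_rw [integral_const_mul]
  -- `sum_range_even` wants all odd terms to vanish, also out of range, where the truncated exponent
  -- 2z - i is no longer odd; hence the guard.
  have h2 : ∑ i ∈ Finset.range (2 * z + 1), (m ^ i * ((2 * z).choose i : ℝ)) *
        ∫ y : ℝ, (y ^ (2 * z - i) * Real.exp (-b * y ^ 2)) =
      ∑ i ∈ Finset.range (2 * z + 1), if i ≤ 2 * z then (m ^ i * ((2 * z).choose i : ℝ)) *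
        ∫ y : ℝ, (y ^ (2 * z - i) * Real.exp (-b * y ^ 2)) else 0 :=
    Finset.sum_congr rfl fun i hi => by
      rw [if_pos (Nat.lt_succ_iff.mp (Finset.mem_range.mp hi))]
  rw [h2, sum_range_even]
  · refine Finset.sum_congr rfl fun k hk => ?_
    have hk' : k ≤ z := Nat.lt_succ_iff.mp (Finset.mem_range.mp hk)
    rw [if_pos (by omega), show 2 * z - 2 * k = 2 * (z - k) by omega,
      integral_even_pow_mul_exp_neg_mul_sq hb]
  · intro j
    split_ifs with h
    · rw [show 2 * z - (2 * j + 1) = 2 * (z - j - 1) + 1 by omega,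
        integral_odd_pow_mul_exp_neg_mul_sq, mul_zero]
    · rfl

/-- The binomial probability of `x` successes among `z` trials. -/
def binomialWeight (p : ℝ) (z x : ℕ) : ℝ := z.choose x * p ^ x * (1 - p) ^ (z - x)

/-- The density of a symmetric variable whose square is gamma distributed with shape `x + 1/2`
and rate `ρ`. -/
def rootPDFReal (x : ℕ) (ρ θ : ℝ) : ℝ :=
  ρ ^ x * √ρ / Real.Gamma (x + 1 / 2) * (θ ^ (2 * x) * Real.exp (-ρ * θ ^ 2))

/-- The symmetric law whose image under squaring is the gamma law with shape `x + 1/2` and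
rate `ρ`. -/
def rootMeasure (x : ℕ) (ρ : ℝ) : Measure ℝ :=
  volume.withDensity fun θ => ENNReal.ofReal (rootPDFReal x ρ θ)

theorem measurable_rootPDFReal (x : ℕ) (ρ : ℝ) : Measurable (rootPDFReal x ρ) := by
  unfold rootPDFReal
  fun_prop

theorem rootPDFReal_nonneg (x : ℕ) {ρ : ℝ} (hρ : 0 < ρ) (θ : ℝ) : 0 ≤ rootPDFReal x ρ θ := by
  have := Real.Gamma_pos_of_pos (by positivity : (0 : ℝ) < x + 1 / 2)
  unfold rootPDFReal
  rw [pow_mul]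
  positivity

theorem integrable_rootPDFReal (x : ℕ) {ρ : ℝ} (hρ : 0 < ρ) : Integrable (rootPDFReal x ρ) :=
  (integrable_pow_mul_exp_neg_mul_sq hρ _).const_mul _

theorem isProbabilityMeasure_rootMeasure (x : ℕ) {ρ : ℝ} (hρ : 0 < ρ) :
    IsProbabilityMeasure (rootMeasure x ρ) := by
  constructor
  have hΓ := Real.Gamma_pos_of_pos (by positivity : (0 : ℝ) < x + 1 / 2)
  rw [rootMeasure, withDensity_apply _ MeasurableSet.univ, setLIntegral_univ,
    ← ofReal_integral_eq_lintegral_ofReal (integrable_rootPDFReal x hρ)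
      (ae_of_all _ (rootPDFReal_nonneg x hρ))]
  simp_rw [rootPDFReal]
  rw [integral_const_mul, integral_even_pow_mul_exp_neg_mul_sq hρ, div_mul_div_comm,
    mul_comm (Real.Gamma _), div_self (by positivity), ENNReal.ofReal_one]

/-- Completing the square in u centres the integrand at m = ρθ/τ and leaves the factor exp(-ρθ²).
The moments about m form an even polynomial in θ, and the factorial formula for Γ at half-integers
turns its coefficients C(2z,2k) Γ(z-k+1/2) into binomial probabilities. -/
theorem integral_rootPDFReal_mul_gaussianPDFReal (z : ℕ) {ρ τ : ℝ} (hρ : 0 < ρ) (hτ : ρ < τ)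
    {v : NNReal} (hv : (v : ℝ) = (1 / ρ - 1 / τ) / 2) (θ : ℝ) :
    ∫ u, rootPDFReal z τ u * gaussianPDFReal u v θ = ∑ k ∈ Finset.range (z + 1),
      binomialWeight (ρ / τ) z k * rootPDFReal k ρ θ := by
  have hτ0 : 0 < τ := hρ.trans hτ
  have hδ : 0 < τ - ρ := sub_pos.mpr hτ
  set b := τ ^ 2 / (τ - ρ) with hb
  have hb0 : 0 < b := by positivity
  set m := ρ * θ / τ with hm
  have hv2 : (v : ℝ) = (τ - ρ) / (2 * ρ * τ) := by
    rw [hv]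
    field_simp
  have hΓ := Real.Gamma_pos_of_pos (by positivity : (0 : ℝ) < z + 1 / 2)
  set A := τ ^ z * √τ / Real.Gamma (z + 1 / 2) * (√(2 * Real.pi * v))⁻¹ *
    Real.exp (-ρ * θ ^ 2) with hA
  have h1 : ∀ u, rootPDFReal z τ u * gaussianPDFReal u v θ =
      A * ((m + (u - m)) ^ (2 * z) * Real.exp (-b * (u - m) ^ 2)) := by
    intro u
    have e : Real.exp (-τ * u ^ 2) * Real.exp (-(θ - u) ^ 2 / (2 * v)) =
        Real.exp (-ρ * θ ^ 2) * Real.exp (-b * (u - m) ^ 2) := by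
      rw [← Real.exp_add, ← Real.exp_add, hv2, hb, hm]
      congr 1
      field_simp
      ring
    rw [rootPDFReal, gaussianPDFReal, hA, add_sub_cancel]
    linear_combination (τ ^ z * √τ / Real.Gamma (z + 1 / 2) * (√(2 * Real.pi * v))⁻¹ *
      u ^ (2 * z)) * e
  simp_rw [h1]
  rw [integral_const_mul, integral_sub_right_eq_self
    (fun y => (m + y) ^ (2 * z) * Real.exp (-b * y ^ 2)) m, integral_shift_pow_mul_exp hb0,
    Finset.mul_sum]
  refine Finset.sum_congr rfl fun k hk => ?_
  have hk' : k ≤ z := Nat.lt_succ_iff.mp (Finset.mem_range.mp hk)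
  obtain ⟨j, rfl⟩ := Nat.exists_eq_add_of_le hk'
  have es : √(2 * Real.pi * v) = √Real.pi * √(τ - ρ) / (√ρ * √τ) := by
    rw [hv2, ← Real.sqrt_mul Real.pi_pos.le, ← Real.sqrt_mul hρ.le, ← Real.sqrt_div (by positivity)]
    congr 1
    field_simp
  have eb : √b = τ / √(τ - ρ) := by
    rw [hb, Real.sqrt_div (by positivity), Real.sqrt_sq hτ0.le]
  have e1 : 1 - ρ / τ = (τ - ρ) / τ := by field_simp
  have c1 : ((2 * (k + j)).choose (2 * k) : ℝ) =
      (2 * (k + j)).factorial / ((2 * k).factorial * (2 * j).factorial) := by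
    rw [Nat.cast_choose ℝ (by omega), show 2 * (k + j) - 2 * k = 2 * j by omega]
  have c2 : ((k + j).choose k : ℝ) = (k + j).factorial / (k.factorial * j.factorial) := by
    rw [Nat.cast_choose ℝ (by omega), Nat.add_sub_cancel_left]
  rw [binomialWeight, Nat.add_sub_cancel_left, rootPDFReal, hA, es, eb, e1, c1, c2, Gamma_nat_add_half_eq,
    Gamma_nat_add_half_eq, Gamma_nat_add_half_eq, hm, hb]
  have hs1 := Real.sq_sqrt hτ0.le
  have hs2 := Real.sq_sqrt Real.pi_pos.le
  have : 0 < √τ := Real.sqrt_pos.mpr hτ0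
  have : 0 < √ρ := Real.sqrt_pos.mpr hρ
  have : 0 < √(τ - ρ) := Real.sqrt_pos.mpr hδ
  have : 0 < √Real.pi := Real.sqrt_pos.mpr Real.pi_pos
  simp only [div_pow, mul_pow, pow_add, pow_mul]
  field_simp
  rw [hs1]
  ring

end PoissonPrediction

/-! ### Gaussian noise as binomial thinning, and symmetrization by signs -/

namespace PoissonPrediction

theorem binomialWeight_nonneg {p : ℝ} (h0 : 0 ≤ p) (h1 : p ≤ 1) (z x : ℕ) :
    0 ≤ binomialWeight p z x := by
  have := sub_nonneg.mpr h1
  unfold binomialWeight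
  positivity

/-- The density identity tested against functions, by Tonelli. It links the passage from durations r
+ s to r, which thins counts, with heat flow on the square-root scale. -/
theorem rootMeasure_conv_gaussianReal (z : ℕ) {ρ τ : ℝ} (hρ : 0 < ρ) (hτ : ρ < τ)
    {v : NNReal} (hv : (v : ℝ) = (1 / ρ - 1 / τ) / 2) :
    rootMeasure z τ ∗ gaussianReal 0 v = ∑ x ∈ Finset.range (z + 1),
      ENNReal.ofReal (binomialWeight (ρ / τ) z x) • rootMeasure x ρ := by
  have hτ0 : 0 < τ := hρ.trans hτ
  have hv0 : v ≠ 0 := by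
    rw [← NNReal.coe_ne_zero, hv, ne_eq, div_eq_zero_iff, not_or]
    refine ⟨(sub_pos.mpr ?_).ne', two_ne_zero⟩
    exact one_div_lt_one_div_of_lt hρ hτ
  have hp1 : ρ / τ ≤ 1 := (div_le_one hτ0).mpr hτ.le
  have := isProbabilityMeasure_rootMeasure z hτ0
  refine Measure.ext_of_lintegral _ fun f hf => ?_
  have hk := measurable_rootPDFReal z τ
  have hg : Measurable fun p : ℝ × ℝ => gaussianPDFReal p.1 v p.2 := by fun_prop
  rw [Measure.lintegral_conv hf, rootMeasure, lintegral_withDensity_eq_lintegral_mul _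
    hk.ennreal_ofReal (Measurable.lintegral_prod_right (by fun_prop))]
  have h1 : ∀ u, ∫⁻ w, f (u + w) ∂gaussianReal 0 v =
      ∫⁻ θ, ENNReal.ofReal (gaussianPDFReal u v θ) * f θ := by
    intro u
    have : gaussianReal u v = (gaussianReal 0 v).map (u + ·) := by
      rw [gaussianReal_map_const_add, zero_add]
    rw [← lintegral_map (f := f) hf (by fun_prop), ← this, gaussianReal_of_var_ne_zero _ hv0,
      lintegral_withDensity_eq_lintegral_mul _ (measurable_gaussianPDF u v) hf]
    rfl
  simp only [Pi.mul_apply, h1]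
  calc ∫⁻ u, ENNReal.ofReal (rootPDFReal z τ u) *
          ∫⁻ θ, ENNReal.ofReal (gaussianPDFReal u v θ) * f θ
      = ∫⁻ u, ∫⁻ θ, ENNReal.ofReal (rootPDFReal z τ u * gaussianPDFReal u v θ) * f θ := by
        refine lintegral_congr fun u => ?_
        rw [← lintegral_const_mul _ (by fun_prop)]
        refine lintegral_congr fun θ => ?_
        rw [ENNReal.ofReal_mul (rootPDFReal_nonneg z hτ0 u), mul_assoc]
    _ = ∫⁻ θ, ∫⁻ u, ENNReal.ofReal (rootPDFReal z τ u * gaussianPDFReal u v θ) * f θ := by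
        refine lintegral_lintegral_swap (Measurable.aemeasurable ?_)
        fun_prop
    _ = ∫⁻ θ, ∑ x ∈ Finset.range (z + 1), ENNReal.ofReal (binomialWeight (ρ / τ) z x) *
          (ENNReal.ofReal (rootPDFReal x ρ θ) * f θ) := by
        refine lintegral_congr fun θ => ?_
        have hi : Integrable fun u => rootPDFReal z τ u * gaussianPDFReal u v θ := by
          refine Integrable.mul_bdd (c := (√(2 * Real.pi * v))⁻¹) (integrable_rootPDFReal z hτ0)
            (by fun_prop) (ae_of_all _ fun u => ?_)
          rw [Real.norm_of_nonneg (gaussianPDFReal_nonneg _ _ _), gaussianPDFReal]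
          refine mul_le_of_le_one_right (by positivity) (Real.exp_le_one_iff.mpr ?_)
          exact div_nonpos_of_nonpos_of_nonneg (neg_nonpos.mpr (sq_nonneg _)) (by positivity)
        rw [lintegral_mul_const _ (by fun_prop), ← ofReal_integral_eq_lintegral_ofReal hi
          (ae_of_all _ fun u => mul_nonneg (rootPDFReal_nonneg z hτ0 u)
            (gaussianPDFReal_nonneg _ _ _)),
          integral_rootPDFReal_mul_gaussianPDFReal z hρ hτ hv, ENNReal.ofReal_sum_of_nonneg
            fun x _ => mul_nonneg (binomialWeight_nonneg (by positivity) hp1 z x)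
              (rootPDFReal_nonneg x hρ θ), Finset.sum_mul]
        refine Finset.sum_congr rfl fun x _ => ?_
        rw [ENNReal.ofReal_mul (binomialWeight_nonneg (by positivity) hp1 z x), mul_assoc]
    _ = _ := by
        rw [lintegral_finsetSum _ fun x _ => by
          have := measurable_rootPDFReal x ρ
          fun_prop, lintegral_finsetSum_measure]
        refine Finset.sum_congr rfl fun x _ => ?_
        have := measurable_rootPDFReal x ρ
        rw [lintegral_const_mul _ (by fun_prop), lintegral_smul_measure, smul_eq_mul, rootMeasure,
          lintegral_withDensity_eq_lintegral_mul _ this.ennreal_ofReal hf]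
        rfl

/-- Under t = cθ² each sign fills one half-line with density twice the symmetric one, so the two
signs together have mass 2. This is why f is summed over all sign changes. -/
theorem sum_map_sqrt_gammaMeasure (x : ℕ) {r c : ℝ} (hr : 0 < r) (hc : 0 < c) :
    ∑ a ∈ ({1, -1} : Finset ℝ), (gammaMeasure (x + 1 / 2) r).map (fun t => a * √(t / c)) =
      (2 : ℝ≥0∞) • rootMeasure x (r * c) := by
  refine Measure.ext_of_lintegral _ fun f hf => ?_
  have hk := measurable_rootPDFReal x (r * c)
  have hrc : 0 < r * c := by positivity
  have hΓ := Real.Gamma_pos_of_pos (by positivity : (0 : ℝ) < x + 1 / 2)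
  have himage : (fun θ : ℝ => c * θ ^ 2) '' Set.Ioi 0 = Set.Ioi 0 := by
    ext t
    constructor
    · rintro ⟨θ, hθ, rfl⟩
      have : (0 : ℝ) < θ := hθ
      exact Set.mem_Ioi.mpr (by positivity)
    · intro ht
      have ht0 : (0 : ℝ) < t := ht
      refine ⟨√(t / c), Set.mem_Ioi.mpr (by positivity), ?_⟩
      simp only
      rw [Real.sq_sqrt (by positivity)]
      field_simp
  have hdisj : Disjoint (Set.Iio (0 : ℝ)) (Set.Ici 0) := Set.Iio_disjoint_Ici le_rfl
  have hone : ∀ a : ℝ, ∫⁻ t, f t ∂(gammaMeasure (x + 1 / 2) r).map (fun t => a * √(t / c)) =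
      ∫⁻ θ in Set.Ioi 0, 2 * ENNReal.ofReal (rootPDFReal x (r * c) θ) * f (a * θ) := by
    intro a
    have hm : Measurable fun t : ℝ => a * √(t / c) := by fun_prop
    have hγ : Measurable (gammaPDF (x + 1 / 2) r) :=
      (measurable_gammaPDFReal _ _).ennreal_ofReal
    rw [lintegral_map hf hm, gammaMeasure, lintegral_withDensity_eq_lintegral_mul _ hγ
      (g := fun t => f (a * √(t / c))) (hf.comp hm)]
    have hsupp : ∫⁻ t, (gammaPDF (x + 1 / 2) r * fun t => f (a * √(t / c))) t =
        ∫⁻ t in Set.Ioi 0, gammaPDF (x + 1 / 2) r t * f (a * √(t / c)) := by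
      rw [← setLIntegral_univ, ← Set.Iio_union_Ici (a := (0 : ℝ)), lintegral_union measurableSet_Ici hdisj,
        setLIntegral_congr_fun (g := fun _ => 0) measurableSet_Iio fun t ht => by
          simp [gammaPDF_of_neg ht], lintegral_zero, zero_add]
      exact setLIntegral_congr Ioi_ae_eq_Ici.symm
    rw [hsupp]
    nth_rw 1 [← himage]
    rw [lintegral_image_eq_lintegral_abs_deriv_mul (f' := fun θ => 2 * c * θ) measurableSet_Ioi
      (fun θ _ => ?_) (fun y hy w hw h => ?_)]
    · refine setLIntegral_congr_fun measurableSet_Ioi fun θ hθ => ?_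
      have hθ0 : (0 : ℝ) < θ := hθ
      rw [mul_div_cancel_left₀ _ hc.ne', Real.sqrt_sq hθ0.le, ← mul_assoc, gammaPDF,
        ← ENNReal.ofReal_mul (abs_nonneg _), ← ENNReal.ofReal_ofNat 2,
        ← ENNReal.ofReal_mul zero_le_two]
      congr 2
      rw [gammaPDFReal, if_pos (by positivity), rootPDFReal, abs_of_nonneg (by positivity),
        Real.rpow_add hr, Real.rpow_natCast, ← Real.sqrt_eq_rpow, mul_pow, Real.sqrt_mul hr.le,
        show (x : ℝ) + 1 / 2 - 1 = x - 1 / 2 by ring, Real.rpow_sub (by positivity),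
        Real.rpow_natCast, ← Real.sqrt_eq_rpow, Real.sqrt_mul hc.le, Real.sqrt_sq hθ0.le, mul_pow,
        ← pow_mul, show -(r * (c * θ ^ 2)) = -(r * c) * θ ^ 2 by ring]
      have hs := Real.sq_sqrt hc.le
      have : 0 < √c := Real.sqrt_pos.mpr hc
      field_simp
      linear_combination -hs
    · refine (((hasDerivAt_pow 2 θ).const_mul c).congr_deriv ?_).hasDerivWithinAt
      simp
      ring
    · have hy0 : (0 : ℝ) < y := hy
      have hw0 : (0 : ℝ) < w := hw
      have h2 : y ^ 2 = w ^ 2 := mul_left_cancel₀ hc.ne' h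
      exact (pow_left_inj₀ hy0.le hw0.le two_ne_zero).mp h2
  rw [lintegral_finsetSum_measure, Finset.sum_pair (by norm_num), hone, hone,
    lintegral_smul_measure, smul_eq_mul, rootMeasure, lintegral_withDensity_eq_lintegral_mul _
      hk.ennreal_ofReal hf]
  have hneg : ∫⁻ θ in Set.Ioi 0, 2 * ENNReal.ofReal (rootPDFReal x (r * c) θ) * f (-1 * θ) =
      ∫⁻ θ in Set.Iio 0, 2 * ENNReal.ofReal (rootPDFReal x (r * c) θ) * f θ := by
    have := (Measure.measurePreserving_neg (volume : Measure ℝ)).setLIntegral_comp_preimage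
      (s := Set.Iio 0) (f := fun θ => 2 * ENNReal.ofReal (rootPDFReal x (r * c) θ) * f θ)
      measurableSet_Iio (by fun_prop)
    rw [← this]
    simp [rootPDFReal, pow_mul]
  rw [hneg, ← lintegral_const_mul _ (by fun_prop), add_comm]
  simp only [one_mul, Pi.mul_apply, ← mul_assoc]
  rw [← setLIntegral_congr (Ioi_ae_eq_Ici (a := (0 : ℝ))).symm, ← lintegral_union measurableSet_Ici hdisj,
    Set.Iio_union_Ici,
    setLIntegral_univ]

end PoissonPrediction

/-! ### Several coordinates: thinning identity and integrability -/

namespace PoissonPrediction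

variable {d : ℕ}

theorem pi_conv_pi (μ ν : Fin d → Measure ℝ) [∀ i, IsFiniteMeasure (μ i)]
    [∀ i, IsFiniteMeasure (ν i)] :
    Measure.pi μ ∗ Measure.pi ν = Measure.pi fun i => μ i ∗ ν i := by
  refine (Measure.pi_eq fun s hs => ?_).symm
  have hS := MeasurableSet.univ_pi hs
  rw [← lintegral_indicator_one hS, Measure.lintegral_conv (measurable_one.indicator hS)]
  have h1 : ∀ x y : Fin d → ℝ, (Set.univ.pi s).indicator (1 : (Fin d → ℝ) → ℝ≥0∞) (x + y) =
      ∏ i, (s i).indicator 1 (x i + y i) := by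
    intro x y
    by_cases h : x + y ∈ Set.univ.pi s
    · rw [Set.indicator_of_mem h]
      exact (Finset.prod_eq_one fun i _ => Set.indicator_of_mem (h i trivial) _).symm
    · rw [Set.indicator_of_notMem h]
      simp only [Set.mem_pi, Set.mem_univ, true_imp_iff, not_forall] at h
      obtain ⟨i, hi⟩ := h
      exact (Finset.prod_eq_zero (Finset.mem_univ i) (Set.indicator_of_notMem hi _)).symm
  have hm : ∀ i, Measurable ((s i).indicator (1 : ℝ → ℝ≥0∞)) := fun i =>
    measurable_one.indicator (hs i)
  simp_rw [h1]
  have h2 : ∀ x : Fin d → ℝ, ∫⁻ y, ∏ i, (s i).indicator 1 (x i + y i) ∂Measure.pi ν =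
      ∏ i, ∫⁻ t, (s i).indicator 1 (x i + t) ∂ν i := fun x =>
    lintegral_pi_prod ν (fun i t => (s i).indicator 1 (x i + t)) fun i =>
      (hm i).comp (measurable_const_add _)
  simp_rw [h2]
  rw [lintegral_pi_prod μ (fun i u => ∫⁻ t, (s i).indicator 1 (u + t) ∂ν i) fun i =>
    Measurable.lintegral_prod_right ((hm i).comp measurable_add)]
  refine Finset.prod_congr rfl fun i _ => ?_
  rw [← lintegral_indicator_one (hs i), Measure.lintegral_conv (hm i)]

/-- The convolution identity coordinate by coordinate. The variance is required to be common to all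
coordinates so that the noise is isotropic and subspaces in arbitrary position can be treated. -/
theorem sum_binomial_lintegral_rootMeasure {ρ τ : Fin d → ℝ} (hρ : ∀ i, 0 < ρ i)
    (hτ : ∀ i, ρ i < τ i) {v : NNReal} (hv : ∀ i, (v : ℝ) = (1 / ρ i - 1 / τ i) / 2)
    (z : Fin d → ℕ) {g : (Fin d → ℝ) → ℝ≥0∞} (hg : Measurable g) :
    ∑ x ∈ Fintype.piFinset fun i => Finset.range (z i + 1),
      (∏ i, ENNReal.ofReal (binomialWeight (ρ i / τ i) (z i) (x i))) *
        ∫⁻ θ, g θ ∂Measure.pi (fun i => rootMeasure (x i) (ρ i)) =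
    ∫⁻ u, ∫⁻ w, g (u + w) ∂Measure.pi (fun _ : Fin d => gaussianReal 0 v)
      ∂Measure.pi (fun i => rootMeasure (z i) (τ i)) := by
  have hτ0 : ∀ i, 0 < τ i := fun i => (hρ i).trans (hτ i)
  have i1 : ∀ i x, IsProbabilityMeasure (rootMeasure x (ρ i)) := fun i x =>
    isProbabilityMeasure_rootMeasure x (hρ i)
  have i2 : ∀ i x, IsProbabilityMeasure (rootMeasure x (τ i)) := fun i x =>
    isProbabilityMeasure_rootMeasure x (hτ0 i)
  have i3 : ∀ i x, IsFiniteMeasure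
      (ENNReal.ofReal (binomialWeight (ρ i / τ i) (z i) x) • rootMeasure x (ρ i)) := fun i x =>
    (rootMeasure x (ρ i)).smul_finite ENNReal.ofReal_ne_top
  rw [← Measure.lintegral_conv hg, pi_conv_pi]
  simp_rw [rootMeasure_conv_gaussianReal _ (hρ _) (hτ _) (hv _)]
  rw [pi_sum (fun i => Finset.range (z i + 1)) fun i x =>
    ENNReal.ofReal (binomialWeight (ρ i / τ i) (z i) x) • rootMeasure x (ρ i),
    lintegral_finsetSum_measure]
  refine Finset.sum_congr rfl fun x _ => ?_
  rw [pi_smul _ (fun i => ENNReal.ofReal_ne_top), lintegral_smul_measure, smul_eq_mul]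

/-- Half of the decay exp(-ρθ²) absorbs the power of θ, the other half is dominated by a wide
Gaussian. The centre is left free so that it can later be placed off the subspace. -/
theorem rootPDFReal_le_gaussianPDFReal (x : ℕ) {ρ : ℝ} (hρ : 0 < ρ) {v : NNReal}
    (hv : 2 / ρ ≤ v) (m : ℝ) : ∃ C : ℝ, 0 ≤ C ∧ ∀ θ, rootPDFReal x ρ θ ≤ C * gaussianPDFReal m v θ := by
  have hv0 : 0 < (v : ℝ) := lt_of_lt_of_le (by positivity) hv
  have hΓ := Real.Gamma_pos_of_pos (by positivity : (0 : ℝ) < x + 1 / 2)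
  set K := ρ ^ x * √ρ / Real.Gamma (x + 1 / 2) with hK
  have hK0 : 0 < K := by positivity
  have hsq : 0 < √(2 * Real.pi * v) := by positivity
  refine ⟨K * (x.factorial * (2 / ρ) ^ x) * Real.exp (m ^ 2 / v) * √(2 * Real.pi * v),
    by positivity, fun θ => ?_⟩
  have h1 : θ ^ (2 * x) ≤ x.factorial * (2 / ρ) ^ x * Real.exp (ρ / 2 * θ ^ 2) := by
    have h := Real.pow_div_factorial_le_exp (ρ / 2 * θ ^ 2) (by positivity) x
    rw [div_le_iff₀ (by positivity)] at h
    calc θ ^ (2 * x) = (2 / ρ) ^ x * (ρ / 2 * θ ^ 2) ^ x := by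
          rw [← mul_pow, pow_mul]
          congr 1
          field_simp
      _ ≤ (2 / ρ) ^ x * (Real.exp (ρ / 2 * θ ^ 2) * x.factorial) := by gcongr
      _ = _ := by ring
  have h2 : Real.exp (ρ / 2 * θ ^ 2) * Real.exp (-ρ * θ ^ 2) ≤
      Real.exp (m ^ 2 / v) * Real.exp (-(θ - m) ^ 2 / (2 * v)) := by
    rw [← Real.exp_add, ← Real.exp_add]
    refine Real.exp_le_exp.mpr ?_
    have h3 : (θ - m) ^ 2 / (2 * v) ≤ (θ ^ 2 + m ^ 2) / v := by
      rw [div_le_div_iff₀ (by positivity) hv0]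
      nlinarith [sq_nonneg (θ + m), mul_nonneg hv0.le (sq_nonneg (θ + m))]
    have h4 : θ ^ 2 / v ≤ ρ / 2 * θ ^ 2 := by
      rw [div_le_iff₀ hv0]
      have : 1 ≤ ρ / 2 * v := by
        rw [div_le_iff₀ hρ] at hv
        linarith
      nlinarith [mul_le_mul_of_nonneg_right this (sq_nonneg θ)]
    rw [add_div] at h3
    rw [neg_div]
    linarith
  calc rootPDFReal x ρ θ = K * (θ ^ (2 * x) * Real.exp (-ρ * θ ^ 2)) := rfl
    _ ≤ K * (x.factorial * (2 / ρ) ^ x * Real.exp (ρ / 2 * θ ^ 2) * Real.exp (-ρ * θ ^ 2)) := by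
        gcongr
    _ = K * (x.factorial * (2 / ρ) ^ x) * (Real.exp (ρ / 2 * θ ^ 2) * Real.exp (-ρ * θ ^ 2)) := by
        ring
    _ ≤ K * (x.factorial * (2 / ρ) ^ x) *
        (Real.exp (m ^ 2 / v) * Real.exp (-(θ - m) ^ 2 / (2 * v))) := by gcongr
    _ = _ := by
        rw [gaussianPDFReal]
        field_simp

theorem pi_rootMeasure_eq (x : Fin d → ℕ) {ρ : Fin d → ℝ} (hρ : ∀ i, 0 < ρ i) :
    Measure.pi (fun i => rootMeasure (x i) (ρ i)) = (volume : Measure (Fin d → ℝ)).withDensity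
      fun θ => ∏ i, ENNReal.ofReal (rootPDFReal (x i) (ρ i) (θ i)) := by
  have h : ∀ i, IsProbabilityMeasure (volume.withDensity fun θ : ℝ =>
    ENNReal.ofReal (rootPDFReal (x i) (ρ i) θ)) := fun i =>
      isProbabilityMeasure_rootMeasure (x i) (hρ i)
  exact pi_withDensity (fun _ => volume) _ fun i => (measurable_rootPDFReal _ _).ennreal_ofReal

/-- No local analysis near `V` is needed: the law is dominated by a multiple of a Gaussian centred
at a point off `V`, and superharmonicity bounds the Gaussian average by the finite value at the
centre. -/
theorem lintegral_sqDist_rpow_rootMeasure_lt_top (V : Submodule ℝ (EuclideanSpace ℝ (Fin d)))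
    {α : ℝ} (hα : 0 < α) (hα' : α ≤ ((d : ℝ) - Module.finrank ℝ V - 2) / 2)
    (x : Fin d → ℕ) {ρ : Fin d → ℝ} (hρ : ∀ i, 0 < ρ i) :
    ∫⁻ θ, ENNReal.ofReal (sqDist V θ ^ (-α)) ∂Measure.pi (fun i => rootMeasure (x i) (ρ i)) < ∞ := by
  have hm := measurable_sqDist V
  have hV : Module.finrank ℝ V < d := by
    have : (Module.finrank ℝ V : ℝ) < d := by linarith
    exact_mod_cast this
  obtain ⟨m, hmpos⟩ := (ae_sqDist_pos V hV).exists
  -- One variance that is large enough for every coordinate at once.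
  obtain ⟨v, hv⟩ : ∃ v : NNReal, (v : ℝ) = ∑ i, 2 / ρ i + 1 :=
    ⟨NNReal.mk (∑ i, 2 / ρ i + 1) (add_nonneg (Finset.sum_nonneg fun i _ =>
      (div_pos two_pos (hρ i)).le) zero_le_one), rfl⟩
  have hvi : ∀ i, 2 / ρ i ≤ v := by
    intro i
    have := Finset.single_le_sum (f := fun i => 2 / ρ i) (fun i _ => (div_pos two_pos (hρ i)).le)
      (Finset.mem_univ i)
    rw [hv]
    linarith
  have hv0 : v ≠ 0 := by
    rw [← NNReal.coe_ne_zero, hv]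
    have : 0 ≤ ∑ i, 2 / ρ i := Finset.sum_nonneg fun i _ => (div_pos two_pos (hρ i)).le
    positivity
  choose C hC0 hC using fun i => rootPDFReal_le_gaussianPDFReal (x i) (hρ i) (hvi i) (m i)
  have hg : Measurable fun θ => ENNReal.ofReal (sqDist V θ ^ (-α)) := by fun_prop
  have hpdf : ∀ i, Measurable fun θ : Fin d → ℝ => rootPDFReal (x i) (ρ i) (θ i) := fun i =>
    (measurable_rootPDFReal _ _).comp (measurable_pi_apply i)
  have hpi : Measure.pi (fun i => gaussianReal (m i) v) = (volume : Measure (Fin d → ℝ)).withDensity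
      fun θ => ∏ i, gaussianPDF (m i) v (θ i) := by
    have h : ∀ i, IsProbabilityMeasure (volume.withDensity (gaussianPDF (m i) v)) := fun i => by
      rw [← gaussianReal_of_var_ne_zero _ hv0]
      infer_instance
    simp_rw [gaussianReal_of_var_ne_zero _ hv0]
    exact pi_withDensity (fun _ => volume) _ fun i => measurable_gaussianPDF _ _
  have hpi2 : Measure.pi (fun i => gaussianReal (m i) v) =
      (Measure.pi (fun _ : Fin d => gaussianReal 0 v)).map fun w => m + w := by
    have := Measure.pi_map_pi (μ := fun _ : Fin d => gaussianReal 0 v) (f := fun i t => m i + t)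
      (by fun_prop)
    rw [show (fun w : Fin d → ℝ => m + w) = fun w i => m i + w i from rfl, this]
    congr 1
    funext i
    rw [gaussianReal_map_const_add, zero_add]
  calc ∫⁻ θ, ENNReal.ofReal (sqDist V θ ^ (-α)) ∂Measure.pi (fun i => rootMeasure (x i) (ρ i))
      = ∫⁻ θ, (∏ i, ENNReal.ofReal (rootPDFReal (x i) (ρ i) (θ i))) *
          ENNReal.ofReal (sqDist V θ ^ (-α)) := by
        rw [pi_rootMeasure_eq x hρ, lintegral_withDensity_eq_lintegral_mul _ (by fun_prop) hg]
        rfl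
    _ ≤ ∫⁻ θ, (∏ i, ENNReal.ofReal (C i)) * ((∏ i, gaussianPDF (m i) v (θ i)) *
          ENNReal.ofReal (sqDist V θ ^ (-α))) := by
        refine lintegral_mono fun θ => ?_
        rw [← mul_assoc, ← Finset.prod_mul_distrib]
        refine mul_le_mul_left (Finset.prod_le_prod' fun i _ => ?_) _
        rw [gaussianPDF, ← ENNReal.ofReal_mul (hC0 i)]
        exact ENNReal.ofReal_le_ofReal (hC i (θ i))
    _ = (∏ i, ENNReal.ofReal (C i)) * ∫⁻ w, ENNReal.ofReal (sqDist V (m + w) ^ (-α))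
          ∂Measure.pi (fun _ : Fin d => gaussianReal 0 v) := by
        have hgm : Measurable fun θ : Fin d → ℝ => ∏ i, gaussianPDF (m i) v (θ i) :=
          Finset.measurable_prod _ fun i _ =>
            (measurable_gaussianPDF _ _).comp (measurable_pi_apply i)
        rw [lintegral_const_mul _ (by exact hgm.mul hg), ← lintegral_map (f := fun θ => ENNReal.ofReal
          (sqDist V θ ^ (-α))) (g := fun w => m + w) hg (by fun_prop), ← hpi2, hpi,
          lintegral_withDensity_eq_lintegral_mul _ hgm hg]
        rfl
    _ < ∞ := ENNReal.mul_lt_top (ENNReal.prod_lt_top fun i _ => ENNReal.ofReal_lt_top)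
        ((lintegral_sqDist_rpow_gaussian_lt V hv0 hα hα' hmpos).trans ENNReal.ofReal_lt_top)

end PoissonPrediction

/-! ### Posterior means of the shrinkage function -/

namespace PoissonPrediction

variable {d n : ℕ}

/-- The average of `f(θ)`, `θ_i = √(lam_i / c_i)`, when the `lam_i` are independent gamma variables
with shapes `x_i + 1/2` and rates `r_i`: the posterior mean of `f(θ)` under the Jeffreys prior. -/
def gammaMean (r c : Fin d → ℝ) (f : (Fin d → ℝ) → ℝ) (x : Fin d → ℕ) : ℝ≥0∞ :=
  ∫⁻ lam, ENNReal.ofReal (f fun i => √(lam i / c i))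
    ∂Measure.pi (fun i => gammaMeasure (x i + 1 / 2) (r i))

/-- Summing the signed images of a product law gives the product of the one-dimensional sign sums,
each twice a symmetric law; hence the factor 2^d. -/
theorem gammaMean_mixSubspace (V : Fin n → Submodule ℝ (EuclideanSpace ℝ (Fin d)))
    (α : Fin n → ℝ) {r c : Fin d → ℝ} (hr : ∀ i, 0 < r i) (hc : ∀ i, 0 < c i) (x : Fin d → ℕ) :
    gammaMean r c (mixSubspace V α) x = ∑ j, 2 ^ d *
      ∫⁻ θ, ENNReal.ofReal (sqDist (V j) θ ^ (-α j))
        ∂Measure.pi (fun i => rootMeasure (x i) (r i * c i)) := by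
  have hm := fun j => measurable_sqDist (V j)
  have i1 : ∀ i, IsProbabilityMeasure (gammaMeasure (x i + 1 / 2) (r i)) := fun i =>
    isProbabilityMeasure_gammaMeasure (by positivity) (hr i)
  have i2 : ∀ i, IsProbabilityMeasure (rootMeasure (x i) (r i * c i)) := fun i =>
    isProbabilityMeasure_rootMeasure _ (mul_pos (hr i) (hc i))
  have h1 : ∀ lam : Fin d → ℝ,
      ENNReal.ofReal (mixSubspace V α fun i => √(lam i / c i)) =
      ∑ j, ∑ a ∈ Fintype.piFinset (fun _ : Fin d => ({1, -1} : Finset ℝ)),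
        ENNReal.ofReal (sqDist (V j) (fun i => a i * √(lam i / c i)) ^ (-α j)) := by
    intro lam
    rw [mixSubspace, ENNReal.ofReal_sum_of_nonneg fun j _ => Finset.sum_nonneg fun a _ =>
      Real.rpow_nonneg (sqDist_nonneg _ _) _]
    refine Finset.sum_congr rfl fun j _ => ?_
    rw [ENNReal.ofReal_sum_of_nonneg fun a _ => Real.rpow_nonneg (sqDist_nonneg _ _) _]
    rfl
  have hmm : ∀ j (a : Fin d → ℝ), Measurable fun lam : Fin d → ℝ =>
      ENNReal.ofReal (sqDist (V j) (fun i => a i * √(lam i / c i)) ^ (-α j)) := by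
    intro j a
    have := hm j
    fun_prop
  simp_rw [gammaMean, h1]
  rw [lintegral_finsetSum _ fun j _ => Finset.measurable_sum _ fun a _ => hmm j a]
  refine Finset.sum_congr rfl fun j _ => ?_
  rw [lintegral_finsetSum _ fun a _ => hmm j a]
  have h2 : ∀ a : Fin d → ℝ,
      ∫⁻ lam, ENNReal.ofReal (sqDist (V j) (fun i => a i * √(lam i / c i)) ^ (-α j))
        ∂Measure.pi (fun i => gammaMeasure (x i + 1 / 2) (r i)) =
      ∫⁻ θ, ENNReal.ofReal (sqDist (V j) θ ^ (-α j)) ∂Measure.pi (fun i =>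
        (gammaMeasure (x i + 1 / 2) (r i)).map fun t => a i * √(t / c i)) := by
    intro a
    have := hm j
    rw [← Measure.pi_map_pi (f := fun i t => a i * √(t / c i)) (by fun_prop),
      lintegral_map (by fun_prop) (by fun_prop)]
  have i3 : ∀ (i : Fin d) (b : ℝ), IsFiniteMeasure
      ((gammaMeasure (x i + 1 / 2) (r i)).map fun t => b * √(t / c i)) := fun i b => by infer_instance
  have h3 := pi_sum (fun _ : Fin d => ({1, -1} : Finset ℝ)) fun i b =>
    (gammaMeasure (x i + 1 / 2) (r i)).map fun t => b * √(t / c i)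
  simp_rw [h2]
  rw [← lintegral_finsetSum_measure, ← h3]
  simp_rw [sum_map_sqrt_gammaMeasure (x _) (hr _) (hc _)]
  rw [pi_smul _ (fun _ => ENNReal.ofNat_ne_top), lintegral_smul_measure, smul_eq_mul,
    Finset.prod_const, Finset.card_univ, Fintype.card_fin]

theorem finrank_lt_of_exponent (V : Submodule ℝ (EuclideanSpace ℝ (Fin d))) {α : ℝ}
    (hα : 0 < α ∧ α ≤ ((d : ℝ) - (Module.finrank ℝ V : ℝ) - 2) / 2) : Module.finrank ℝ V < d := by
  have : (Module.finrank ℝ V : ℝ) < d := by linarith [hα.1, hα.2]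
  exact_mod_cast this

theorem ae_pi_rootMeasure_sqDist_pos (V : Submodule ℝ (EuclideanSpace ℝ (Fin d)))
    (hV : Module.finrank ℝ V < d) (x : Fin d → ℕ) {ρ : Fin d → ℝ} (hρ : ∀ i, 0 < ρ i) :
    ∀ᵐ θ ∂Measure.pi (fun i => rootMeasure (x i) (ρ i)), 0 < sqDist V θ := by
  rw [pi_rootMeasure_eq x hρ]
  exact (withDensity_absolutelyContinuous _ _).ae_le (ae_sqDist_pos V hV)

theorem gammaMean_mixSubspace_lt_top (V : Fin n → Submodule ℝ (EuclideanSpace ℝ (Fin d)))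
    {α : Fin n → ℝ} (hα : ∀ j, 0 < α j ∧ α j ≤ ((d : ℝ) - (Module.finrank ℝ (V j) : ℝ) - 2) / 2)
    {r c : Fin d → ℝ} (hr : ∀ i, 0 < r i) (hc : ∀ i, 0 < c i) (x : Fin d → ℕ) :
    gammaMean r c (mixSubspace V α) x < ∞ := by
  rw [gammaMean_mixSubspace V α hr hc]
  exact ENNReal.sum_lt_top.mpr fun j _ => ENNReal.mul_lt_top (by simp)
    (lintegral_sqDist_rpow_rootMeasure_lt_top (V j) (hα j).1 (hα j).2 x
      fun i => mul_pos (hr i) (hc i))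

theorem gammaMean_mixSubspace_ne_zero (hn : 0 < n)
    (V : Fin n → Submodule ℝ (EuclideanSpace ℝ (Fin d)))
    {α : Fin n → ℝ} (hα : ∀ j, 0 < α j ∧ α j ≤ ((d : ℝ) - (Module.finrank ℝ (V j) : ℝ) - 2) / 2)
    {r c : Fin d → ℝ} (hr : ∀ i, 0 < r i) (hc : ∀ i, 0 < c i) (x : Fin d → ℕ) :
    gammaMean r c (mixSubspace V α) x ≠ 0 := by
  have hm := fun j => measurable_sqDist (V j)
  have hrc := fun i => mul_pos (hr i) (hc i)
  have i2 : ∀ i, IsProbabilityMeasure (rootMeasure (x i) (r i * c i)) := fun i =>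
    isProbabilityMeasure_rootMeasure _ (hrc i)
  rw [gammaMean_mixSubspace V α hr hc]
  intro h
  have h0 := (Finset.sum_eq_zero_iff.mp h) ⟨0, hn⟩ (Finset.mem_univ _)
  rw [mul_eq_zero, or_iff_right (by simp), lintegral_eq_zero_iff (by have := hm ⟨0, hn⟩; fun_prop)]
    at h0
  obtain ⟨θ, hθ1, hθ2⟩ := (h0.and (ae_pi_rootMeasure_sqDist_pos (V ⟨0, hn⟩)
    (finrank_lt_of_exponent _ (hα _)) x hrc)).exists
  have := Real.rpow_pos_of_pos hθ2 (-α ⟨0, hn⟩)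
  simp only [Pi.zero_apply, ENNReal.ofReal_eq_zero] at hθ1
  linarith

/-- Averaging over binomially thinned counts strictly decreases the posterior mean of the mix
subspace shrinkage function. -/
theorem sum_binomial_gammaMean_lt (hn : 0 < n)
    (V : Fin n → Submodule ℝ (EuclideanSpace ℝ (Fin d)))
    {α : Fin n → ℝ} (hα : ∀ j, 0 < α j ∧ α j ≤ ((d : ℝ) - (Module.finrank ℝ (V j) : ℝ) - 2) / 2)
    {r t c : Fin d → ℝ} (hr : ∀ i, 0 < r i) (ht : ∀ i, r i < t i) (hc : ∀ i, 0 < c i) {v : ℝ}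
    (hv0 : 0 < v) (hv : ∀ i, v = (1 / r i - 1 / t i) / c i) (z : Fin d → ℕ) :
    ∑ x ∈ Fintype.piFinset fun i => Finset.range (z i + 1),
      (∏ i, ENNReal.ofReal (binomialWeight (r i / t i) (z i) (x i))) *
        gammaMean r c (mixSubspace V α) x < gammaMean t c (mixSubspace V α) z := by
  have hm := fun j => measurable_sqDist (V j)
  have ht0 : ∀ i, 0 < t i := fun i => (hr i).trans (ht i)
  have hrc := fun i => mul_pos (hr i) (hc i)
  have htc := fun i => mul_pos (ht0 i) (hc i)
  have i2 : ∀ i, IsProbabilityMeasure (rootMeasure (z i) (t i * c i)) := fun i =>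
    isProbabilityMeasure_rootMeasure _ (htc i)
  -- The half is the one in the variance (1/ρ - 1/τ)/2 of the convolution identity.
  obtain ⟨w, hw⟩ : ∃ w : NNReal, (w : ℝ) = v / 2 := ⟨NNReal.mk (v / 2) (by positivity), rfl⟩
  have hw0 : w ≠ 0 := by
    rw [← NNReal.coe_ne_zero, hw]
    positivity
  have hwi : ∀ i, (w : ℝ) = (1 / (r i * c i) - 1 / (t i * c i)) / 2 := by
    intro i
    have h1 := (hr i).ne'
    have h2 := (ht0 i).ne'
    have h3 := (hc i).ne'
    rw [hw, hv i]
    field_simp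
  simp_rw [gammaMean_mixSubspace V α hr hc, gammaMean_mixSubspace V α ht0 hc, Finset.mul_sum]
  rw [Finset.sum_comm]
  refine ENNReal.sum_lt_sum_of_nonempty ⟨⟨0, hn⟩, Finset.mem_univ _⟩ fun j _ => ?_
  have hg : Measurable fun θ => ENNReal.ofReal (sqDist (V j) θ ^ (-α j)) := by
    have := hm j
    fun_prop
  have h1 := sum_binomial_lintegral_rootMeasure hrc
    (fun i => mul_lt_mul_of_pos_right (ht i) (hc i)) hwi z hg
  have h2 : ∀ i, r i * c i / (t i * c i) = r i / t i := fun i =>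
    mul_div_mul_right _ _ (hc i).ne'
  simp_rw [h2] at h1
  simp_rw [mul_left_comm _ ((2 : ℝ≥0∞) ^ d)]
  rw [← Finset.mul_sum, h1]
  refine ENNReal.mul_lt_mul_right (by simp) (by simp) ?_
  have hlt : ∀ᵐ u ∂Measure.pi (fun i => rootMeasure (z i) (t i * c i)),
      ∫⁻ y, ENNReal.ofReal (sqDist (V j) (u + y) ^ (-α j))
        ∂Measure.pi (fun _ : Fin d => gaussianReal 0 w) <
      ENNReal.ofReal (sqDist (V j) u ^ (-α j)) := by
    filter_upwards [ae_pi_rootMeasure_sqDist_pos (V j) (finrank_lt_of_exponent _ (hα j)) z htc]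
      with u hu
    exact lintegral_sqDist_rpow_gaussian_lt (V j) hw0 (hα j).1 (hα j).2 hu
  -- An almost everywhere strict inequality stays strict after integration because the smaller
  -- integral is finite.
  refine lintegral_strict_mono (IsProbabilityMeasure.ne_zero _) hg.aemeasurable ?_ hlt
  refine ((lintegral_mono_ae (hlt.mono fun _ h => h.le)).trans_lt ?_).ne
  exact lintegral_sqDist_rpow_rootMeasure_lt_top (V j) (hα j).1 (hα j).2 z htc

end PoissonPrediction

namespace PoissonPrediction

/-! ### Marginal and predictive probabilities -/

variable {d : ℕ}

/-- The marginal probability of the counts `x` for durations `t` and prior density `π`. -/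
def marginal (t : Fin d → ℝ) (π : (Fin d → ℝ) → ℝ≥0∞) (x : Fin d → ℕ) : ℝ≥0∞ :=
  ∫⁻ lam in paramSpace d, likelihood t lam x * π lam

theorem isProbabilityMeasure_poissonVec (m : Fin d → ℝ) : IsProbabilityMeasure (poissonVec m) := by
  unfold poissonVec
  infer_instance

theorem tsum_likelihood (t lam : Fin d → ℝ) : ∑' x, likelihood t lam x = 1 := by
  have := isProbabilityMeasure_poissonVec (t * lam)
  have h : ∫⁻ _, 1 ∂poissonVec (t * lam) = 1 := by simp
  rw [lintegral_countable'] at h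
  simpa [likelihood] using h

theorem measurable_likelihood (t : Fin d → ℝ) (x : Fin d → ℕ) :
    Measurable fun lam => likelihood t lam x := by
  simp_rw [likelihood, poissonVec, Measure.pi_singleton, poissonMeasure_singleton, Pi.mul_apply]
  fun_prop

theorem likelihood_pos {t lam : Fin d → ℝ} (ht : ∀ i, 0 < t i) (hl : lam ∈ paramSpace d)
    (x : Fin d → ℕ) : likelihood t lam x ≠ 0 := by
  have h : ∀ i, 0 < t i * lam i := fun i => mul_pos (ht i) (hl i)
  rw [likelihood_eq t lam (fun i => (h i).le), ne_eq, ENNReal.ofReal_eq_zero, not_le]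
  exact Finset.prod_pos fun i _ => by
    have := h i
    positivity

theorem likelihood_ne_top (t lam : Fin d → ℝ) (x : Fin d → ℕ) : likelihood t lam x ≠ ∞ := by
  have := isProbabilityMeasure_poissonVec (t * lam)
  exact measure_ne_top _ _

theorem measurableSet_paramSpace (d : ℕ) : MeasurableSet (paramSpace d) := by
  have : paramSpace d = Set.univ.pi fun _ => Set.Ioi 0 := by
    ext
    simp [paramSpace]
  rw [this]
  exact MeasurableSet.univ_pi fun _ => measurableSet_Ioi

/-- The probability that independent binomial thinning of the counts `z` yields `x`. -/
def thinning (r t : Fin d → ℝ) (z x : Fin d → ℕ) : ℝ≥0∞ :=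
  ∏ i, ENNReal.ofReal (binomialWeight (r i / t i) (z i) (x i))

theorem thinning_ne_top (r t : Fin d → ℝ) (z x : Fin d → ℕ) : thinning r t z x ≠ ∞ :=
  ENNReal.prod_ne_top fun _ _ => ENNReal.ofReal_ne_top

theorem thinning_ne_zero {r s : Fin d → ℝ} (hr : ∀ i, 0 < r i) (hs : ∀ i, 0 < s i)
    (x y : Fin d → ℕ) : thinning r (r + s) (x + y) x ≠ 0 := by
  refine Finset.prod_ne_zero_iff.mpr fun i _ => ?_
  have h1 := hr i
  have h2 := hs i
  have h3 : 0 < 1 - r i / (r + s) i := by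
    rw [Pi.add_apply, sub_pos, div_lt_one (by positivity)]
    linarith
  have h4 : 0 < ((x + y) i).choose (x i) := Nat.choose_pos (by simp)
  have h5 : 0 < r i / (r + s) i := by
    rw [Pi.add_apply]
    positivity
  rw [ne_eq, ENNReal.ofReal_eq_zero, not_le, binomialWeight]
  positivity

/-- The total x + y is sufficient: given it, x is binomial with success probabilities r_i/(r_i +
s_i), free of λ. All joint quantities therefore reduce to marginals for durations r + s. -/
theorem likelihood_mul_likelihood {r s lam : Fin d → ℝ} (hr : ∀ i, 0 < r i) (hs : ∀ i, 0 < s i)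
    (hl : lam ∈ paramSpace d) (x y : Fin d → ℕ) :
    likelihood r lam x * likelihood s lam y =
      thinning r (r + s) (x + y) x * likelihood (r + s) lam (x + y) := by
  have h1 : ∀ i, 0 < r i * lam i := fun i => mul_pos (hr i) (hl i)
  have h2 : ∀ i, 0 < s i * lam i := fun i => mul_pos (hs i) (hl i)
  have h3 : ∀ i, 0 < (r + s) i * lam i := fun i => mul_pos (add_pos (hr i) (hs i)) (hl i)
  rw [likelihood_eq r lam (fun i => (h1 i).le), likelihood_eq s lam (fun i => (h2 i).le),
    likelihood_eq (r + s) lam (fun i => (h3 i).le), thinning, ← ENNReal.ofReal_prod_of_nonneg,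
    ← ENNReal.ofReal_mul, ← ENNReal.ofReal_mul, ← Finset.prod_mul_distrib,
    ← Finset.prod_mul_distrib]
  · congr 1
    refine Finset.prod_congr rfl fun i _ => ?_
    have := hr i
    have := hs i
    have := hl i
    have e1 : Real.exp (-((r + s) i * lam i)) =
        Real.exp (-(r i * lam i)) * Real.exp (-(s i * lam i)) := by
      rw [← Real.exp_add, Pi.add_apply]
      congr 1
      ring
    have e2 : 1 - r i / (r i + s i) = s i / (r i + s i) := by
      field_simp
      ring
    rw [e1, binomialWeight, Pi.add_apply, Pi.add_apply, Nat.cast_choose ℝ (Nat.le_add_right _ _),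
      Nat.add_sub_cancel_left, e2]
    simp only [div_pow, mul_pow, pow_add]
    field_simp
  · exact Finset.prod_nonneg fun i _ => binomialWeight_nonneg
      (div_pos (hr i) (add_pos (hr i) (hs i))).le
      ((div_le_one (add_pos (hr i) (hs i))).mpr (le_add_of_nonneg_right (hs i).le)) _ _
  · exact Finset.prod_nonneg fun i _ => by
      have := h1 i
      positivity
  · exact fun i _ => binomialWeight_nonneg
      (div_pos (hr i) (add_pos (hr i) (hs i))).le
      ((div_le_one (add_pos (hr i) (hs i))).mpr (le_add_of_nonneg_right (hs i).le)) _ _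

theorem joint_marginal {r s : Fin d → ℝ} (hr : ∀ i, 0 < r i) (hs : ∀ i, 0 < s i)
    (π : (Fin d → ℝ) → ℝ≥0∞) (x y : Fin d → ℕ) :
    ∫⁻ lam in paramSpace d, likelihood r lam x * likelihood s lam y * π lam =
      thinning r (r + s) (x + y) x * marginal (r + s) π (x + y) := by
  rw [marginal, ← lintegral_const_mul' _ _ (thinning_ne_top _ _ _ _)]
  refine setLIntegral_congr_fun (measurableSet_paramSpace d) fun lam hl => ?_
  rw [likelihood_mul_likelihood hr hs hl, mul_assoc]

theorem bayesPredictiveMass_eq {r s : Fin d → ℝ} (hr : ∀ i, 0 < r i) (hs : ∀ i, 0 < s i)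
    (π : (Fin d → ℝ) → ℝ≥0∞) (x y : Fin d → ℕ) :
    bayesPredictiveMass r s π x y =
      thinning r (r + s) (x + y) x * marginal (r + s) π (x + y) / marginal r π x := by
  rw [bayesPredictiveMass, joint_marginal hr hs]
  rfl

theorem bayesPredictive_singleton (r s : Fin d → ℝ) (π : (Fin d → ℝ) → ℝ≥0∞)
    (x y : Fin d → ℕ) : bayesPredictive r s π x {y} = bayesPredictiveMass r s π x y := by
  rw [bayesPredictive, withDensity_apply _ (measurableSet_singleton y), lintegral_singleton]
  simp

theorem isPredictive_bayesPredictive (r s : Fin d → ℝ) {π : (Fin d → ℝ) → ℝ≥0∞}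
    (hπ : Measurable π) (h0 : ∀ x, marginal r π x ≠ 0) (htop : ∀ x, marginal r π x ≠ ∞) :
    IsPredictive (bayesPredictive r s π) := by
  intro x
  constructor
  rw [bayesPredictive, withDensity_apply _ MeasurableSet.univ, setLIntegral_univ, lintegral_count]
  simp_rw [bayesPredictiveMass, div_eq_mul_inv]
  rw [ENNReal.tsum_mul_right, ← lintegral_tsum (by
    exact fun y =>
      (((measurable_likelihood r x).mul (measurable_likelihood s y)).mul hπ).aemeasurable)]
  have h : ∀ lam, ∑' y, likelihood r lam x * likelihood s lam y * π lam =
      likelihood r lam x * π lam := by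
    intro lam
    rw [ENNReal.tsum_mul_right, ENNReal.tsum_mul_left, tsum_likelihood, mul_one]
  simp_rw [h]
  exact ENNReal.mul_inv_cancel (h0 x) (htop x)

/-- The divergence comparison averaged over x. It serves twice: against the Jeffreys rule for
domination, and against an arbitrary rule, with a Bayes rule on the left, for the minimax bound. -/
theorem klRisk_add_one_le {r s lam : Fin d → ℝ} (hs : ∀ i, 0 < s i) (hl : lam ∈ paramSpace d)
    {q q' : (Fin d → ℕ) → Measure (Fin d → ℕ)} (hq : IsPredictive q) (hq' : IsPredictive q')
    (hpos : ∀ x y, q x {y} ≠ 0) :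
    klRisk r s q lam + 1 ≤ klRisk r s q' lam +
      ∑' x, ∑' y, likelihood r lam x * likelihood s lam y * (q' x {y} / q x {y}) := by
  have i1 := isProbabilityMeasure_poissonVec (r * lam)
  have i2 := isProbabilityMeasure_poissonVec (s * lam)
  have h : ∀ x, InformationTheory.klDiv (poissonVec (s * lam)) (q x) + 1 ≤
      InformationTheory.klDiv (poissonVec (s * lam)) (q' x) +
        ∑' y, likelihood s lam y * (q' x {y} / q x {y}) := fun x => by
    have := hq x
    have := hq' x
    exact klDiv_add_one_le _ _ _ (likelihood_pos hs hl) (hpos x)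
  have h2 := lintegral_mono (μ := poissonVec (r * lam)) h
  rw [lintegral_add_left (Measurable.of_discrete), lintegral_add_left (Measurable.of_discrete),
    lintegral_const, measure_univ, mul_one] at h2
  refine h2.trans (le_of_eq ?_)
  rw [klRisk]
  congr 1
  rw [lintegral_countable']
  refine tsum_congr fun x => ?_
  rw [mul_comm, ← ENNReal.tsum_mul_left]
  exact tsum_congr fun y => (mul_assoc _ _ _).symm

theorem tsum_tsum_add (h : (Fin d → ℕ) → (Fin d → ℕ) → ℝ≥0∞) :
    ∑' x, ∑' y, h x (x + y) =
      ∑' z, ∑ x ∈ Fintype.piFinset fun i => Finset.range (z i + 1), h x z := by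
  classical
  have h1 : ∀ z : Fin d → ℕ, ∑ x ∈ Fintype.piFinset fun i => Finset.range (z i + 1), h x z =
      ∑' x, if x ≤ z then h x z else 0 := by
    intro z
    rw [tsum_eq_sum (s := Fintype.piFinset fun i => Finset.range (z i + 1))]
    · refine Finset.sum_congr rfl fun x hx => ?_
      have hle : x ≤ z := fun i =>
        Nat.lt_succ_iff.mp (Finset.mem_range.mp (Fintype.mem_piFinset.mp hx i))
      rw [if_pos hle]
    · intro x hx
      have hle : ¬ x ≤ z := fun hle => hx (Fintype.mem_piFinset.mpr fun i =>
        Finset.mem_range.mpr (Nat.lt_succ_iff.mpr (hle i)))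
      rw [if_neg hle]
  simp_rw [h1]
  refine Eq.trans ?_ ENNReal.tsum_comm
  refine tsum_congr fun x => ?_
  have hinj : Function.Injective fun y : Fin d → ℕ => x + y := add_right_injective x
  have h2 := hinj.tsum_eq (f := fun z => if x ≤ z then h x z else 0) (fun z hz => by
    by_contra hne
    refine hz (if_neg fun hle => hne ⟨z - x, ?_⟩)
    simp [add_tsub_cancel_of_le hle])
  refine Eq.trans ?_ h2
  exact tsum_congr fun y => (if_pos le_self_add).symm

/-! ### Priors of gamma type -/

/-- The marginal probability of `x` under the unnormalized gamma prior `lam^(a-1) e^(-b lam)`. -/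
def gammaWeight (a b t : ℝ) (x : ℕ) : ℝ :=
  t ^ x * Real.Gamma (x + a) / (x.factorial * (t + b) ^ (x + a))

theorem gammaWeight_pos {a b t : ℝ} (ha : 0 < a) (hb : 0 ≤ b) (ht : 0 < t) (x : ℕ) :
    0 < gammaWeight a b t x := by
  have := Real.Gamma_pos_of_pos (by positivity : 0 < (x : ℝ) + a)
  unfold gammaWeight
  positivity

/-- Gamma–Poisson conjugacy: likelihood times prior is the marginal weight times the gamma posterior
density. Hyperplanes where a coordinate is 0 are null, so boundary values of the gamma density do
not matter. -/
theorem setLIntegral_likelihood_mul {a b : ℝ} (ha : 0 < a) (hb : 0 ≤ b) {t : Fin d → ℝ}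
    (ht : ∀ i, 0 < t i) (x : Fin d → ℕ) {g : (Fin d → ℝ) → ℝ≥0∞} (hg : Measurable g) :
    ∫⁻ lam in paramSpace d, likelihood t lam x *
        (ENNReal.ofReal (∏ i, lam i ^ (a - 1) * Real.exp (-b * lam i)) * g lam) =
      ENNReal.ofReal (∏ i, gammaWeight a b (t i) (x i)) *
        ∫⁻ lam, g lam ∂Measure.pi (fun i => gammaMeasure (x i + a) (t i + b)) := by
  have hγ : ∀ i, Measurable (gammaPDF (x i + a) (t i + b)) := fun i =>
    (measurable_gammaPDFReal _ _).ennreal_ofReal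
  have i1 : ∀ i, IsProbabilityMeasure (volume.withDensity (gammaPDF (x i + a) (t i + b))) :=
    fun i => isProbabilityMeasure_gammaMeasure (by positivity) (add_pos_of_pos_of_nonneg (ht i) hb)
  have hpi : Measure.pi (fun i => gammaMeasure (x i + a) (t i + b)) =
      (volume : Measure (Fin d → ℝ)).withDensity
        fun lam => ∏ i, gammaPDF (x i + a) (t i + b) (lam i) :=
    pi_withDensity (fun _ => volume) _ hγ
  have hγm : Measurable fun lam : Fin d → ℝ => ∏ i, gammaPDF (x i + a) (t i + b) (lam i) :=
    Finset.measurable_prod _ fun i _ => (hγ i).comp (measurable_pi_apply i)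
  rw [hpi, lintegral_withDensity_eq_lintegral_mul _ hγm hg]
  have hsupp : ∫⁻ lam, ((fun lam : Fin d → ℝ => ∏ i, gammaPDF (x i + a) (t i + b) (lam i)) * g) lam =
      ∫⁻ lam in paramSpace d, (∏ i, gammaPDF (x i + a) (t i + b) (lam i)) * g lam := by
    rw [← lintegral_indicator (measurableSet_paramSpace d)]
    have hne : ∀ᵐ lam : Fin d → ℝ, ∀ i, lam i ≠ 0 := by
      rw [ae_all_iff]
      exact fun i => Measure.ae_eval_ne (μ := fun _ : Fin d => (volume : Measure ℝ)) i 0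
    refine lintegral_congr_ae ?_
    filter_upwards [hne] with lam hlam
    by_cases h : lam ∈ paramSpace d
    · rw [Set.indicator_of_mem h]
      rfl
    · rw [Set.indicator_of_notMem h, Pi.mul_apply]
      simp only [paramSpace, Set.mem_ofPred_eq, not_forall, not_lt] at h
      obtain ⟨i, hi⟩ := h
      rw [Finset.prod_eq_zero (Finset.mem_univ i) (gammaPDF_of_neg (hi.lt_of_ne (hlam i))), zero_mul]
  rw [hsupp, ← lintegral_const_mul' _ _ ENNReal.ofReal_ne_top]
  refine setLIntegral_congr_fun (measurableSet_paramSpace d) fun lam hl => ?_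
  have hl' : ∀ i, 0 < lam i := hl
  rw [← mul_assoc, ← mul_assoc, likelihood_eq t lam (fun i => (mul_pos (ht i) (hl' i)).le)]
  congr 1
  simp_rw [gammaPDF]
  rw [← ENNReal.ofReal_prod_of_nonneg fun i _ => gammaPDFReal_nonneg (by positivity)
    (add_pos_of_pos_of_nonneg (ht i) hb) _, ← ENNReal.ofReal_mul, ← ENNReal.ofReal_mul,
    ← Finset.prod_mul_distrib, ← Finset.prod_mul_distrib]
  · congr 1
    refine Finset.prod_congr rfl fun i _ => ?_
    have h1 := ht i
    have h2 := hl' i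
    have hΓ := Real.Gamma_pos_of_pos (by positivity : 0 < (x i : ℝ) + a)
    have htb := add_pos_of_pos_of_nonneg (ht i) hb
    rw [gammaPDFReal, if_pos h2.le, gammaWeight]
    have e1 : Real.exp (-((t i + b) * lam i)) =
        Real.exp (-(t i * lam i)) * Real.exp (-b * lam i) := by
      rw [← Real.exp_add]
      congr 1
      ring
    have e2 : lam i ^ ((x i : ℝ) + a - 1) = lam i ^ (x i) * lam i ^ (a - 1) := by
      rw [show (x i : ℝ) + a - 1 = x i + (a - 1) by ring, Real.rpow_add h2, Real.rpow_natCast]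
    have : 0 < (t i + b) ^ ((x i : ℝ) + a) := by positivity
    rw [e1, e2, mul_pow]
    field_simp
  · exact Finset.prod_nonneg fun i _ => (gammaWeight_pos ha hb (ht i) _).le
  · exact Finset.prod_nonneg fun i _ => by
      have := ht i
      have := hl' i
      positivity

end PoissonPrediction

namespace PoissonPrediction

/-! ### Priors with Jeffreys factor, and domination -/

variable {d n : ℕ}

theorem measurable_jeffreysPrior : Measurable (jeffreysPrior (d := d)) := by
  unfold jeffreysPrior
  fun_prop

theorem measurable_mixSubspace (V : Fin n → Submodule ℝ (EuclideanSpace ℝ (Fin d)))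
    (α : Fin n → ℝ) : Measurable (mixSubspace V α) := by
  unfold mixSubspace
  refine Finset.measurable_sum _ fun j _ => Finset.measurable_sum _ fun a _ => ?_
  exact ((measurable_sqDist (V j)).comp (measurable_const.mul measurable_id)).pow_const _

theorem mixSubspace_nonneg (V : Fin n → Submodule ℝ (EuclideanSpace ℝ (Fin d)))
    (α : Fin n → ℝ) (θ : Fin d → ℝ) : 0 ≤ mixSubspace V α θ :=
  Finset.sum_nonneg fun _ _ => Finset.sum_nonneg fun _ _ => Real.rpow_nonneg (sqDist_nonneg _ _) _

theorem measurable_priorJ (c : Fin d → ℝ) {f : (Fin d → ℝ) → ℝ} (hf : Measurable f) :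
    Measurable (priorJ c f) := by
  unfold priorJ
  have : Measurable fun lam : Fin d → ℝ => f fun i => √(lam i / c i) :=
    hf.comp (by fun_prop)
  fun_prop

/-- The Jeffreys factor is the gamma prior with shape 1/2 and rate 0, so conjugacy splits off the
posterior mean of f. -/
theorem marginal_priorJ {t : Fin d → ℝ} (ht : ∀ i, 0 < t i) (c : Fin d → ℝ)
    {f : (Fin d → ℝ) → ℝ} (hf : Measurable f) (hf0 : ∀ θ, 0 ≤ f θ) (x : Fin d → ℕ) :
    marginal t (priorJ c f) x =
      ENNReal.ofReal (∏ i, gammaWeight (1 / 2) 0 (t i) (x i)) * gammaMean t c f x := by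
  have hm : Measurable fun lam : Fin d → ℝ => ENNReal.ofReal (f fun i => √(lam i / c i)) :=
    (hf.comp (by fun_prop)).ennreal_ofReal
  have h := setLIntegral_likelihood_mul (by norm_num : (0 : ℝ) < 1 / 2) le_rfl ht x hm
  simp only [add_zero] at h
  rw [gammaMean, ← h, marginal]
  congr 1 with lam
  rw [priorJ, ENNReal.ofReal_mul (hf0 _), mul_comm (ENNReal.ofReal (f _))]
  congr 4 with i
  norm_num

theorem marginal_jeffreysPrior {t : Fin d → ℝ} (ht : ∀ i, 0 < t i) (x : Fin d → ℕ) :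
    marginal t jeffreysPrior x = ENNReal.ofReal (∏ i, gammaWeight (1 / 2) 0 (t i) (x i)) := by
  have h := marginal_priorJ ht 1 (f := fun _ => 1) measurable_const (fun _ => zero_le_one) x
  have i1 : ∀ i, IsProbabilityMeasure (gammaMeasure ((x i : ℝ) + 1 / 2) (t i)) :=
    fun i => isProbabilityMeasure_gammaMeasure (by positivity) (ht i)
  have h1 : gammaMean t 1 (fun _ => 1) x = 1 := by
    rw [gammaMean, ENNReal.ofReal_one, lintegral_const, measure_univ, one_mul]
  rw [h1, mul_one] at h
  rw [← h]
  congr 1 with lam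
  simp [priorJ, jeffreysPrior]

theorem marginal_jeffreysPrior_ne_zero {t : Fin d → ℝ} (ht : ∀ i, 0 < t i) (x : Fin d → ℕ) :
    marginal t jeffreysPrior x ≠ 0 := by
  rw [marginal_jeffreysPrior ht, ne_eq, ENNReal.ofReal_eq_zero, not_le]
  exact Finset.prod_pos fun i _ => gammaWeight_pos (by norm_num) le_rfl (ht i) _

theorem marginal_jeffreysPrior_ne_top {t : Fin d → ℝ} (ht : ∀ i, 0 < t i) (x : Fin d → ℕ) :
    marginal t jeffreysPrior x ≠ ∞ := by
  rw [marginal_jeffreysPrior ht]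
  exact ENNReal.ofReal_ne_top

theorem isPredictive_jeffreysPredictive {r : Fin d → ℝ} (hr : ∀ i, 0 < r i) (s : Fin d → ℝ) :
    IsPredictive (jeffreysPredictive r s) :=
  isPredictive_bayesPredictive r s measurable_jeffreysPrior
    (marginal_jeffreysPrior_ne_zero hr) (marginal_jeffreysPrior_ne_top hr)

variable {V : Fin n → Submodule ℝ (EuclideanSpace ℝ (Fin d))} {α : Fin n → ℝ}

theorem marginal_mix {t : Fin d → ℝ} (ht : ∀ i, 0 < t i) (c : Fin d → ℝ) (x : Fin d → ℕ) :
    marginal t (priorJ c (mixSubspace V α)) x =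
      marginal t jeffreysPrior x * gammaMean t c (mixSubspace V α) x := by
  rw [marginal_priorJ ht c (measurable_mixSubspace V α) (mixSubspace_nonneg V α),
    marginal_jeffreysPrior ht]

theorem marginal_mix_ne_zero (hn : 0 < n)
    (hα : ∀ j, 0 < α j ∧ α j ≤ ((d : ℝ) - (Module.finrank ℝ (V j) : ℝ) - 2) / 2)
    {t c : Fin d → ℝ} (ht : ∀ i, 0 < t i) (hc : ∀ i, 0 < c i) (x : Fin d → ℕ) :
    marginal t (priorJ c (mixSubspace V α)) x ≠ 0 := by
  rw [marginal_mix ht]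
  exact mul_ne_zero (marginal_jeffreysPrior_ne_zero ht x)
    (gammaMean_mixSubspace_ne_zero hn V hα ht hc x)

theorem marginal_mix_ne_top
    (hα : ∀ j, 0 < α j ∧ α j ≤ ((d : ℝ) - (Module.finrank ℝ (V j) : ℝ) - 2) / 2)
    {t c : Fin d → ℝ} (ht : ∀ i, 0 < t i) (hc : ∀ i, 0 < c i) (x : Fin d → ℕ) :
    marginal t (priorJ c (mixSubspace V α)) x ≠ ∞ := by
  rw [marginal_mix ht]
  exact ENNReal.mul_ne_top (marginal_jeffreysPrior_ne_top ht x)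
    (gammaMean_mixSubspace_lt_top V hα ht hc x).ne

theorem isPredictive_mixPredictive (hn : 0 < n)
    (hα : ∀ j, 0 < α j ∧ α j ≤ ((d : ℝ) - (Module.finrank ℝ (V j) : ℝ) - 2) / 2)
    {r c : Fin d → ℝ} (hr : ∀ i, 0 < r i) (s : Fin d → ℝ) (hc : ∀ i, 0 < c i) :
    IsPredictive (mixPredictive r s c V α) :=
  isPredictive_bayesPredictive r s (measurable_priorJ c (measurable_mixSubspace V α))
    (marginal_mix_ne_zero hn hα hr hc) (marginal_mix_ne_top hα hr hc)

theorem mixPredictive_singleton_ne_zero (hn : 0 < n)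
    (hα : ∀ j, 0 < α j ∧ α j ≤ ((d : ℝ) - (Module.finrank ℝ (V j) : ℝ) - 2) / 2)
    {r s c : Fin d → ℝ} (hr : ∀ i, 0 < r i) (hs : ∀ i, 0 < s i) (hc : ∀ i, 0 < c i)
    (x y : Fin d → ℕ) : mixPredictive r s c V α x {y} ≠ 0 := by
  rw [mixPredictive, bayesPredictive_singleton, bayesPredictiveMass_eq hr hs]
  exact ENNReal.div_ne_zero.mpr ⟨mul_ne_zero (thinning_ne_zero hr hs x y)
    (marginal_mix_ne_zero hn hα (fun i => add_pos (hr i) (hs i)) hc _),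
    marginal_mix_ne_top hα hr hc x⟩

/-- The thinning probabilities and the Jeffreys marginals occur in both predictive masses and
cancel. -/
theorem jeffreysPredictive_div_mixPredictive (hn : 0 < n)
    (hα : ∀ j, 0 < α j ∧ α j ≤ ((d : ℝ) - (Module.finrank ℝ (V j) : ℝ) - 2) / 2)
    {r s c : Fin d → ℝ} (hr : ∀ i, 0 < r i) (hs : ∀ i, 0 < s i) (hc : ∀ i, 0 < c i)
    (x y : Fin d → ℕ) :
    jeffreysPredictive r s x {y} / mixPredictive r s c V α x {y} =
      gammaMean r c (mixSubspace V α) x / gammaMean (r + s) c (mixSubspace V α) (x + y) := by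
  have ht : ∀ i, 0 < (r + s) i := fun i => add_pos (hr i) (hs i)
  rw [jeffreysPredictive, mixPredictive, bayesPredictive_singleton, bayesPredictive_singleton,
    bayesPredictiveMass_eq hr hs, bayesPredictiveMass_eq hr hs, marginal_mix hr, marginal_mix ht]
  have a0 := thinning_ne_zero hr hs x y
  have a1 := thinning_ne_top r (r + s) (x + y) x
  have b0 := marginal_jeffreysPrior_ne_zero hr x
  have b1 := marginal_jeffreysPrior_ne_top hr x
  have c0 := marginal_jeffreysPrior_ne_zero ht (x + y)
  have c1 := marginal_jeffreysPrior_ne_top ht (x + y)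
  have d0 := gammaMean_mixSubspace_ne_zero hn V hα hr hc x
  have d1 := (gammaMean_mixSubspace_lt_top V hα hr hc x).ne
  have e0 := gammaMean_mixSubspace_ne_zero hn V hα ht hc (x + y)
  have e1 := (gammaMean_mixSubspace_lt_top V hα ht hc (x + y)).ne
  generalize thinning r (r + s) (x + y) x = A at *
  generalize marginal r jeffreysPrior x = B at *
  generalize marginal (r + s) jeffreysPrior (x + y) = C at *
  generalize gammaMean r c (mixSubspace V α) x = D at *
  generalize gammaMean (r + s) c (mixSubspace V α) (x + y) = E at *
  rw [← ENNReal.toReal_eq_toReal_iff'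
    (ENNReal.div_ne_top (ENNReal.div_ne_top (ENNReal.mul_ne_top a1 c1) b0)
      (ENNReal.div_ne_zero.mpr ⟨mul_ne_zero a0 (mul_ne_zero c0 e0), ENNReal.mul_ne_top b1 d1⟩))
    (ENNReal.div_ne_top d1 e0)]
  have := ENNReal.toReal_pos a0 a1
  have := ENNReal.toReal_pos b0 b1
  have := ENNReal.toReal_pos c0 c1
  have := ENNReal.toReal_pos d0 d1
  have := ENNReal.toReal_pos e0 e1
  simp only [ENNReal.toReal_div, ENNReal.toReal_mul]
  field_simp

/-- Grouping by the total z = x + y leaves, for each z, its likelihood times a ratio below 1 by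
`sum_binomial_gammaMean_lt`; the likelihoods sum to 1. -/
theorem tsum_jeffreys_div_mix_lt_one (hn : 0 < n)
    (hα : ∀ j, 0 < α j ∧ α j ≤ ((d : ℝ) - (Module.finrank ℝ (V j) : ℝ) - 2) / 2)
    {r s c lam : Fin d → ℝ} (hr : ∀ i, 0 < r i) (hs : ∀ i, 0 < s i) (hc : ∀ i, 0 < c i)
    {v : ℝ} (hv0 : 0 < v) (hv : ∀ i, v = gam r s i / c i) (hl : lam ∈ paramSpace d) :
    ∑' x, ∑' y, likelihood r lam x * likelihood s lam y *
      (jeffreysPredictive r s x {y} / mixPredictive r s c V α x {y}) < 1 := by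
  have ht : ∀ i, 0 < (r + s) i := fun i => add_pos (hr i) (hs i)
  have hrt : ∀ i, r i < (r + s) i := fun i => lt_add_of_pos_right _ (hs i)
  simp_rw [jeffreysPredictive_div_mixPredictive hn hα hr hs hc, likelihood_mul_likelihood hr hs hl]
  have h1 := tsum_tsum_add fun x z => thinning r (r + s) z x * likelihood (r + s) lam z *
    (gammaMean r c (mixSubspace V α) x / gammaMean (r + s) c (mixSubspace V α) z)
  rw [h1]
  have h2 : ∀ z, ∑ x ∈ Fintype.piFinset fun i => Finset.range (z i + 1),
      thinning r (r + s) z x * likelihood (r + s) lam z *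
      (gammaMean r c (mixSubspace V α) x / gammaMean (r + s) c (mixSubspace V α) z) <
      likelihood (r + s) lam z := by
    intro z
    have hE0 := gammaMean_mixSubspace_ne_zero hn V hα ht hc z
    have hE1 := (gammaMean_mixSubspace_lt_top V hα ht hc z).ne
    have h3 := sum_binomial_gammaMean_lt hn V hα hr hrt hc hv0 hv z
    have h4 : ∀ x, thinning r (r + s) z x * likelihood (r + s) lam z *
      (gammaMean r c (mixSubspace V α) x / gammaMean (r + s) c (mixSubspace V α) z) =
      likelihood (r + s) lam z / gammaMean (r + s) c (mixSubspace V α) z *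
      (thinning r (r + s) z x * gammaMean r c (mixSubspace V α) x) := fun x => by
      simp only [div_eq_mul_inv]
      ring
    simp_rw [h4, ← Finset.mul_sum]
    have h5 := ENNReal.mul_lt_mul_right (a := likelihood (r + s) lam z /
      gammaMean (r + s) c (mixSubspace V α) z)
      (ENNReal.div_ne_zero.mpr ⟨likelihood_pos ht hl z, hE1⟩)
      (ENNReal.div_ne_top (likelihood_ne_top _ _ z) hE0) h3
    rwa [ENNReal.div_mul_cancel hE0 hE1] at h5
  rw [← tsum_likelihood (r + s) lam]
  refine ENNReal.tsum_lt_tsum (i := 0) ?_ (fun z => (h2 z).le) (h2 0)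
  refine ne_top_of_le_ne_top ?_ (ENNReal.tsum_le_tsum fun z => (h2 z).le)
  rw [tsum_likelihood]
  exact ENNReal.one_ne_top

theorem klRisk_mixPredictive_lt (hn : 0 < n)
    (hα : ∀ j, 0 < α j ∧ α j ≤ ((d : ℝ) - (Module.finrank ℝ (V j) : ℝ) - 2) / 2)
    {r s c lam : Fin d → ℝ} (hr : ∀ i, 0 < r i) (hs : ∀ i, 0 < s i) (hc : ∀ i, 0 < c i)
    {v : ℝ} (hv0 : 0 < v) (hv : ∀ i, v = gam r s i / c i) (hl : lam ∈ paramSpace d)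
    (hfin : klRisk r s (jeffreysPredictive r s) lam ≠ ∞) :
    klRisk r s (mixPredictive r s c V α) lam < klRisk r s (jeffreysPredictive r s) lam := by
  have h1 := klRisk_add_one_le (r := r) hs hl (isPredictive_mixPredictive hn hα hr s hc)
    (isPredictive_jeffreysPredictive hr s)
    (mixPredictive_singleton_ne_zero hn hα hr hs hc)
  have h2 := ENNReal.add_lt_add_left hfin
    (tsum_jeffreys_div_mix_lt_one hn hα hr hs hc hv0 hv hl)
  exact (ENNReal.add_lt_add_iff_right ENNReal.one_ne_top).mp (h1.trans_lt h2)

end PoissonPrediction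

namespace PoissonPrediction

/-! ### Risk of the predictive distributions based on gamma priors -/

variable {d : ℕ}

/-- The unnormalized prior density `∏ lam_i^(a-1) e^(-b lam_i)`. -/
def gammaPrior (a b : ℝ) (lam : Fin d → ℝ) : ℝ≥0∞ :=
  ENNReal.ofReal (∏ i, lam i ^ (a - 1) * Real.exp (-b * lam i))

theorem jeffreysPrior_eq_gammaPrior :
    jeffreysPrior (d := d) = gammaPrior (1 / 2) 0 := by
  funext lam
  rw [jeffreysPrior, gammaPrior]
  congr 2 with i
  norm_num

theorem measurable_gammaPrior (a b : ℝ) : Measurable (gammaPrior (d := d) a b) := by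
  unfold gammaPrior
  fun_prop

theorem marginal_gammaPrior {a b : ℝ} (ha : 0 < a) (hb : 0 ≤ b) {t : Fin d → ℝ}
    (ht : ∀ i, 0 < t i) (x : Fin d → ℕ) :
    marginal t (gammaPrior a b) x = ENNReal.ofReal (∏ i, gammaWeight a b (t i) (x i)) := by
  have i1 : ∀ i, IsProbabilityMeasure (gammaMeasure ((x i : ℝ) + a) (t i + b)) :=
    fun i => isProbabilityMeasure_gammaMeasure (by positivity) (add_pos_of_pos_of_nonneg (ht i) hb)
  have h := setLIntegral_likelihood_mul ha hb ht x (g := fun _ => 1) measurable_const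
  rw [lintegral_const, measure_univ, mul_one, mul_one] at h
  rw [← h, marginal]
  congr 1 with lam
  rw [gammaPrior, mul_one]

theorem marginal_gammaPrior_ne_zero {a b : ℝ} (ha : 0 < a) (hb : 0 ≤ b) {t : Fin d → ℝ}
    (ht : ∀ i, 0 < t i) (x : Fin d → ℕ) : marginal t (gammaPrior a b) x ≠ 0 := by
  rw [marginal_gammaPrior ha hb ht, ne_eq, ENNReal.ofReal_eq_zero, not_le]
  exact Finset.prod_pos fun i _ => gammaWeight_pos ha hb (ht i) _

theorem marginal_gammaPrior_ne_top {a b : ℝ} (ha : 0 < a) (hb : 0 ≤ b) {t : Fin d → ℝ}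
    (ht : ∀ i, 0 < t i) (x : Fin d → ℕ) : marginal t (gammaPrior a b) x ≠ ∞ := by
  rw [marginal_gammaPrior ha hb ht]
  exact ENNReal.ofReal_ne_top

theorem isPredictive_gammaPrior {a b : ℝ} (ha : 0 < a) (hb : 0 ≤ b) {r : Fin d → ℝ}
    (hr : ∀ i, 0 < r i) (s : Fin d → ℝ) : IsPredictive (bayesPredictive r s (gammaPrior a b)) :=
  isPredictive_bayesPredictive r s (measurable_gammaPrior a b)
    (marginal_gammaPrior_ne_zero ha hb hr) (marginal_gammaPrior_ne_top ha hb hr)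

/-- Negative binomial probabilities. -/
def negBinMass (a b r s : ℝ) (x y : ℕ) : ℝ :=
  s ^ y / y.factorial * (Real.Gamma ((x + y : ℕ) + a) / Real.Gamma (x + a)) *
    ((r + b) ^ (x + a) / (r + s + b) ^ ((x + y : ℕ) + a))

theorem negBinMass_pos {a b r s : ℝ} (ha : 0 < a) (hb : 0 ≤ b) (hr : 0 < r) (hs : 0 < s)
    (x y : ℕ) : 0 < negBinMass a b r s x y := by
  have := Real.Gamma_pos_of_pos (by positivity : 0 < ((x + y : ℕ) : ℝ) + a)
  have := Real.Gamma_pos_of_pos (by positivity : 0 < (x : ℝ) + a)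
  unfold negBinMass
  positivity

theorem binomialWeight_mul_gammaWeight {a b r s : ℝ} (ha : 0 < a) (hb : 0 ≤ b) (hr : 0 < r)
    (hs : 0 < s) (x y : ℕ) :
    binomialWeight (r / (r + s)) (x + y) x * gammaWeight a b (r + s) (x + y) /
      gammaWeight a b r x = negBinMass a b r s x y := by
  have := Real.Gamma_pos_of_pos (by positivity : 0 < ((x + y : ℕ) : ℝ) + a)
  have := Real.Gamma_pos_of_pos (by positivity : 0 < (x : ℝ) + a)
  have e2 : 1 - r / (r + s) = s / (r + s) := by
    field_simp
    ring
  have h3 : 0 < (r + s + b) ^ (((x + y : ℕ) : ℝ) + a) := by positivity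
  have h4 : 0 < (r + b) ^ ((x : ℝ) + a) := by positivity
  rw [binomialWeight, gammaWeight, gammaWeight, negBinMass,
    Nat.cast_choose ℝ (Nat.le_add_right _ _), Nat.add_sub_cancel_left, e2]
  simp only [div_pow, pow_add]
  field_simp

theorem bayesPredictive_gammaPrior_singleton {a b : ℝ} (ha : 0 < a) (hb : 0 ≤ b)
    {r s : Fin d → ℝ} (hr : ∀ i, 0 < r i) (hs : ∀ i, 0 < s i) (x y : Fin d → ℕ) :
    bayesPredictive r s (gammaPrior a b) x {y} =
      ENNReal.ofReal (∏ i, negBinMass a b (r i) (s i) (x i) (y i)) := by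
  have ht : ∀ i, 0 < (r + s) i := fun i => add_pos (hr i) (hs i)
  have hbw : ∀ i, 0 ≤ binomialWeight (r i / (r + s) i) ((x + y) i) (x i) := fun i =>
    binomialWeight_nonneg (div_pos (hr i) (ht i)).le
      ((div_le_one (ht i)).mpr (le_add_of_nonneg_right (hs i).le)) _ _
  rw [bayesPredictive_singleton, bayesPredictiveMass_eq hr hs, marginal_gammaPrior ha hb hr,
    marginal_gammaPrior ha hb ht, thinning, ← ENNReal.ofReal_prod_of_nonneg fun i _ => hbw i,
    ← ENNReal.ofReal_mul (Finset.prod_nonneg fun i _ => hbw i), ← ENNReal.ofReal_div_of_pos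
      (Finset.prod_pos fun i _ => gammaWeight_pos ha hb (hr i) _), ← Finset.prod_mul_distrib,
    ← Finset.prod_div_distrib]
  congr 1
  exact Finset.prod_congr rfl fun i _ =>
    binomialWeight_mul_gammaWeight ha hb (hr i) (hs i) (x i) (y i)

theorem bayesPredictive_gammaPrior_ne_zero {a b : ℝ} (ha : 0 < a) (hb : 0 ≤ b)
    {r s : Fin d → ℝ} (hr : ∀ i, 0 < r i) (hs : ∀ i, 0 < s i) (x y : Fin d → ℕ) :
    bayesPredictive r s (gammaPrior a b) x {y} ≠ 0 := by
  rw [bayesPredictive_gammaPrior_singleton ha hb hr hs, ne_eq, ENNReal.ofReal_eq_zero, not_le]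
  exact Finset.prod_pos fun i _ => negBinMass_pos ha hb (hr i) (hs i) _ _

/-- The function `k ↦ log Γ(k + a)`. -/
def logGamma (a : ℝ) (k : ℕ) : ℝ := Real.log (Real.Gamma (k + a))

theorem logGamma_succ_sub {a : ℝ} (ha : 0 < a) (k : ℕ) :
    logGamma a (k + 1) - logGamma a k = Real.log (k + a) := by
  have h : 0 < (k : ℝ) + a := by positivity
  have := Real.Gamma_pos_of_pos h
  rw [logGamma, logGamma, show ((k + 1 : ℕ) : ℝ) + a = k + a + 1 by push_cast; ring,
    Real.Gamma_add_one h.ne', Real.log_mul h.ne' this.ne']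
  ring

theorem hasGrowth_logGamma {a : ℝ} (ha : 0 < a) : HasGrowth (logGamma a) :=
  HasGrowth.of_diff (by simpa only [logGamma_succ_sub ha] using hasGrowth_log ha)

theorem HasGrowth.shift_add {g : ℕ → ℝ} (hg : HasGrowth g) (x : ℕ) :
    HasGrowth fun y => g (x + y) := by
  obtain ⟨C, hC⟩ := hg
  refine ⟨C * 2 ^ x, fun y => (hC (x + y)).trans (le_of_eq ?_)⟩
  rw [pow_add]
  ring

/-- The bound 2^(x+y) factors, so averaging over y keeps geometric growth in x. -/
theorem HasGrowth.poissonMean_shift_add {g : ℕ → ℝ} (hg : HasGrowth g) {μ : ℝ} (hμ : 0 ≤ μ) :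
    HasGrowth fun x => poissonMean (fun y => g (x + y)) μ := by
  have hpow : HasGrowth fun y => (2 : ℝ) ^ y := ⟨1, fun y => by simp⟩
  obtain ⟨C, hC⟩ := hg
  refine ⟨C * poissonMean (fun y => 2 ^ y) μ, fun x => ?_⟩
  have h : ∀ y, |g (x + y)| ≤ C * 2 ^ x * 2 ^ y := fun y =>
    (hC (x + y)).trans (le_of_eq (by rw [pow_add]; ring))
  have hgx : HasGrowth fun y => g (x + y) := ⟨_, h⟩
  have hup := poissonMean_mono hgx (hpow.const_mul (C * 2 ^ x)) (fun y => (abs_le.mp (h y)).2) hμ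
  have hlo := poissonMean_mono ((hpow.const_mul (C * 2 ^ x)).const_mul (-1)) hgx
    (fun y => by linarith [(abs_le.mp (h y)).1]) hμ
  rw [poissonMean_const_mul] at hup
  rw [poissonMean_const_mul, poissonMean_const_mul] at hlo
  rw [abs_le]
  constructor <;> linarith

/-- Sums of independent Poisson variables are Poisson. Consequently the risk involves log Γ only
through its means at rl and (r+s)l. -/
theorem poissonMean_poissonMean_add {g : ℕ → ℝ} (hg : HasGrowth g) {μ ν : ℝ} (hμ : 0 ≤ μ)
    (hν : 0 ≤ ν) :
    poissonMean (fun x => poissonMean (fun y => g (x + y)) ν) μ = poissonMean g (μ + ν) := by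
  have h := integrable_poissonMeasure hg (add_nonneg hμ hν)
  rw [← integral_poissonMeasure_eq _ (add_nonneg hμ hν)]
  rw [Real.toNNReal_add hμ hν, ← poissonMeasure_conv_poissonMeasure] at h ⊢
  rw [integral_conv h, ← integral_poissonMeasure_eq _ hμ]
  simp_rw [integral_poissonMeasure_eq _ hν]

/-- Logarithm of the ratio of a Poisson to a negative binomial probability. -/
def logRatio (a b r s l : ℝ) (x y : ℕ) : ℝ :=
  (-(s * l) + logGamma a x - (x + a) * Real.log (r + b) + (x + a) * Real.log (r + s + b)) +
    (Real.log l + Real.log (r + s + b)) * y - logGamma a (x + y)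

theorem log_poisson_div_negBinMass {a b r s l : ℝ} (ha : 0 < a) (hb : 0 ≤ b) (hr : 0 < r)
    (hs : 0 < s) (hl : 0 < l) (x y : ℕ) :
    Real.log (Real.exp (-(s * l)) * (s * l) ^ y / y.factorial / negBinMass a b r s x y) =
      logRatio a b r s l x y := by
  have g1 := Real.Gamma_pos_of_pos (by positivity : 0 < ((x + y : ℕ) : ℝ) + a)
  have g2 := Real.Gamma_pos_of_pos (by positivity : 0 < (x : ℝ) + a)
  have h3 : 0 < (r + s + b) ^ (((x + y : ℕ) : ℝ) + a) := by positivity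
  have h4 : 0 < (r + b) ^ ((x : ℝ) + a) := by positivity
  have e : Real.exp (-(s * l)) * (s * l) ^ y / y.factorial / negBinMass a b r s x y =
      Real.exp (-(s * l)) * l ^ y * Real.Gamma (x + a) * (r + s + b) ^ (((x + y : ℕ) : ℝ) + a) /
        (Real.Gamma ((x + y : ℕ) + a) * (r + b) ^ ((x : ℝ) + a)) := by
    rw [negBinMass, mul_pow]
    field_simp
  rw [e, Real.log_div (by positivity) (by positivity), Real.log_mul (by positivity) h3.ne',
    Real.log_mul (by positivity) g2.ne', Real.log_mul (by positivity) (by positivity),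
    Real.log_mul g1.ne' h4.ne', Real.log_exp, Real.log_pow, Real.log_rpow (by positivity),
    Real.log_rpow (by positivity), logRatio, logGamma, logGamma]
  push_cast
  ring

theorem hasGrowth_logRatio {a : ℝ} (ha : 0 < a) (b r s l : ℝ) (x : ℕ) :
    HasGrowth (logRatio a b r s l x) :=
  ((HasGrowth.const _).add (HasGrowth.cast.const_mul _)).sub ((hasGrowth_logGamma ha).shift_add x)

theorem poissonMean_logRatio {a : ℝ} (ha : 0 < a) (b r s l : ℝ) (x : ℕ) (μ : ℝ) :
    poissonMean (logRatio a b r s l x) μ =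
      (-(s * l) + logGamma a x - (x + a) * Real.log (r + b) + (x + a) * Real.log (r + s + b)) +
        (Real.log l + Real.log (r + s + b)) * μ - poissonMean (fun y => logGamma a (x + y)) μ := by
  unfold logRatio
  rw [poissonMean_sub ((HasGrowth.const _).add (HasGrowth.cast.const_mul _))
    ((hasGrowth_logGamma ha).shift_add x), poissonMean_add (HasGrowth.const _)
    (HasGrowth.cast.const_mul _), poissonMean_const, poissonMean_const_mul, poissonMean_cast]

theorem hasGrowth_poissonMean_logRatio {a : ℝ} (ha : 0 < a) (b r s l : ℝ) {μ : ℝ} (hμ : 0 ≤ μ) :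
    HasGrowth fun x => poissonMean (logRatio a b r s l x) μ := by
  simp_rw [poissonMean_logRatio ha]
  exact (((((HasGrowth.const _).add (hasGrowth_logGamma ha)).sub
    ((((HasGrowth.cast.add (HasGrowth.const a)).const_mul (Real.log (r + b)))).mono fun k => by
      rw [mul_comm])).add
    ((((HasGrowth.cast.add (HasGrowth.const a)).const_mul (Real.log (r + s + b)))).mono fun k => by
      rw [mul_comm])).add (HasGrowth.const _)).sub
    ((hasGrowth_logGamma ha).poissonMean_shift_add hμ)

/-- The contribution of one coordinate to the risk. -/
def coordRisk (a b r s l : ℝ) : ℝ :=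
  -(s * l) + s * l * Real.log l - poissonMean (logGamma a) ((r + s) * l) +
    poissonMean (logGamma a) (r * l) - (r * l + a) * Real.log (r + b) +
      ((r + s) * l + a) * Real.log (r + s + b)

theorem poissonMean_poissonMean_logRatio {a r s l : ℝ} (ha : 0 < a) (b : ℝ) (hr : 0 < r)
    (hs : 0 < s) (hl : 0 < l) :
    poissonMean (fun x => poissonMean (logRatio a b r s l x) (s * l)) (r * l) =
      coordRisk a b r s l := by
  have h1 : 0 ≤ r * l := by positivity
  have h2 : 0 ≤ s * l := by positivity
  have hL := hasGrowth_logGamma ha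
  have e : (fun x => poissonMean (logRatio a b r s l x) (s * l)) = fun x : ℕ =>
      ((-(s * l) - a * Real.log (r + b) + a * Real.log (r + s + b) +
        (Real.log l + Real.log (r + s + b)) * (s * l)) +
        (Real.log (r + s + b) - Real.log (r + b)) * x) + logGamma a x -
        poissonMean (fun y => logGamma a (x + y)) (s * l) := by
    funext x
    rw [poissonMean_logRatio ha]
    ring
  rw [e, poissonMean_sub (((HasGrowth.const _).add (HasGrowth.cast.const_mul _)).add hL)
    (hL.poissonMean_shift_add h2), poissonMean_add ((HasGrowth.const _).add
    (HasGrowth.cast.const_mul _)) hL, poissonMean_add (HasGrowth.const _)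
    (HasGrowth.cast.const_mul _), poissonMean_const, poissonMean_const_mul, poissonMean_cast,
    poissonMean_poissonMean_add hL h1 h2, coordRisk, ← add_mul]
  ring

theorem integrable_poissonVec_eval {m : Fin d → ℝ} (i : Fin d) (hm : 0 ≤ m i) {g : ℕ → ℝ}
    (hg : HasGrowth g) : Integrable (fun x : Fin d → ℕ => g (x i)) (poissonVec m) :=
  integrable_comp_eval (integrable_poissonMeasure hg hm)

theorem integral_poissonVec_eval {m : Fin d → ℝ} (i : Fin d) (hm : 0 ≤ m i) (g : ℕ → ℝ) :
    ∫ x : Fin d → ℕ, g (x i) ∂poissonVec m = poissonMean g (m i) := by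
  rw [← integral_poissonMeasure_eq _ hm]
  exact integral_comp_eval (μ := fun i => poissonMeasure (m i).toNNReal)
    (Measurable.of_discrete).aestronglyMeasurable

/-- Both laws are products, so the log-likelihood ratio is a sum over coordinates. Nonnegativity of
the sum is carried along because the next averaging converts a lower integral of `ENNReal.ofReal`
into a real integral. -/
theorem klDiv_poissonVec {a b : ℝ} (ha : 0 < a) (hb : 0 ≤ b) {r s lam : Fin d → ℝ}
    (hr : ∀ i, 0 < r i) (hs : ∀ i, 0 < s i) (hl : lam ∈ paramSpace d) (x : Fin d → ℕ) :
    0 ≤ ∑ i, poissonMean (logRatio a b (r i) (s i) (lam i) (x i)) (s i * lam i) ∧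
    InformationTheory.klDiv (poissonVec (s * lam)) (bayesPredictive r s (gammaPrior a b) x) =
      ENNReal.ofReal (∑ i, poissonMean (logRatio a b (r i) (s i) (lam i) (x i)) (s i * lam i)) := by
  have hl' : ∀ i, 0 < lam i := hl
  have hm : ∀ i, 0 ≤ (s * lam) i := fun i => (mul_pos (hs i) (hl' i)).le
  have i1 := isProbabilityMeasure_poissonVec (s * lam)
  have i2 := isPredictive_gammaPrior ha hb hr s x
  have hne := bayesPredictive_gammaPrior_ne_zero ha hb hr hs x
  have hac := absolutelyContinuous_of_singleton_ne_zero (poissonVec (s * lam)) _ hne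
  have hllr : llr (poissonVec (s * lam)) (bayesPredictive r s (gammaPrior a b) x) =
      fun y => ∑ i, logRatio a b (r i) (s i) (lam i) (x i) (y i) := by
    funext y
    rw [llr, rnDeriv_eq_div_singleton _ _ hne, bayesPredictive_gammaPrior_singleton ha hb hr hs]
    have hP : poissonVec (s * lam) {y} = likelihood s lam y := rfl
    rw [hP, likelihood_eq s lam hm, ENNReal.toReal_div,
      ENNReal.toReal_ofReal (Finset.prod_nonneg fun i _ => by
        have : 0 ≤ s i * lam i := hm i
        positivity),
      ENNReal.toReal_ofReal (Finset.prod_nonneg fun i _ =>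
        (negBinMass_pos ha hb (hr i) (hs i) _ _).le), ← Finset.prod_div_distrib, Real.log_prod]
    · exact Finset.sum_congr rfl fun i _ =>
        log_poisson_div_negBinMass ha hb (hr i) (hs i) (hl' i) (x i) (y i)
    · intro i _
      have := negBinMass_pos ha hb (hr i) (hs i) (x i) (y i)
      have := mul_pos (hs i) (hl' i)
      positivity
  have hint : ∀ i, Integrable (fun y : Fin d → ℕ => logRatio a b (r i) (s i) (lam i) (x i) (y i))
      (poissonVec (s * lam)) := fun i =>
    integrable_poissonVec_eval i (hm i) (hasGrowth_logRatio ha _ _ _ _ _)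
  have hllrint : Integrable (llr (poissonVec (s * lam))
      (bayesPredictive r s (gammaPrior a b) x)) (poissonVec (s * lam)) := by
    rw [hllr]
    exact integrable_finsetSum _ fun i _ => hint i
  have hval := InformationTheory.toReal_klDiv_of_measure_eq hac (by rw [measure_univ, measure_univ])
  rw [hllr, integral_finsetSum _ fun i _ => hint i] at hval
  simp_rw [fun i => integral_poissonVec_eval i (hm i) (logRatio a b (r i) (s i) (lam i) (x i)),
    Pi.mul_apply] at hval
  rw [← hval]
  exact ⟨ENNReal.toReal_nonneg,
    (ENNReal.ofReal_toReal (InformationTheory.klDiv_ne_top hac hllrint)).symm⟩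

theorem klRisk_gammaPrior {a b : ℝ} (ha : 0 < a) (hb : 0 ≤ b) {r s lam : Fin d → ℝ}
    (hr : ∀ i, 0 < r i) (hs : ∀ i, 0 < s i) (hl : lam ∈ paramSpace d) :
    klRisk r s (bayesPredictive r s (gammaPrior a b)) lam =
      ENNReal.ofReal (∑ i, coordRisk a b (r i) (s i) (lam i)) := by
  have hl' : ∀ i, 0 < lam i := hl
  have hm : ∀ i, 0 ≤ (r * lam) i := fun i => (mul_pos (hr i) (hl' i)).le
  set K : Fin d → ℕ → ℝ := fun i k =>
    poissonMean (logRatio a b (r i) (s i) (lam i) k) (s i * lam i) with hK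
  have hint : ∀ i, Integrable (fun x : Fin d → ℕ => K i (x i)) (poissonVec (r * lam)) := fun i =>
    integrable_poissonVec_eval i (hm i)
      (hasGrowth_poissonMean_logRatio ha _ _ _ _ (mul_pos (hs i) (hl' i)).le)
  have h1 : klRisk r s (bayesPredictive r s (gammaPrior a b)) lam =
      ∫⁻ x, ENNReal.ofReal (∑ i, K i (x i)) ∂poissonVec (r * lam) :=
    lintegral_congr fun x => (klDiv_poissonVec ha hb hr hs hl x).2
  rw [h1, ← ofReal_integral_eq_lintegral_ofReal (integrable_finsetSum _ fun i _ => hint i)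
    (Filter.Eventually.of_forall fun x => (klDiv_poissonVec ha hb hr hs hl x).1),
    integral_finsetSum _ fun i _ => hint i]
  congr 1
  refine Finset.sum_congr rfl fun i _ => ?_
  rw [integral_poissonVec_eval i (hm i) (K i), hK,
    ← poissonMean_poissonMean_logRatio ha b (hr i) (hs i) (hl' i), Pi.mul_apply]

end PoissonPrediction

namespace PoissonPrediction

/-! ### Bounds for the risk of one coordinate -/

/-- The part of the risk of one coordinate that depends on the intensity. -/
def entropyGap (a μ : ℝ) : ℝ := μ * Real.log μ - μ - poissonMean (logGamma a) μ

theorem hasDerivAt_entropyGap {a μ : ℝ} (ha : 0 < a) (hμ : 0 < μ) :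
    HasDerivAt (entropyGap a) (Real.log μ - poissonMean (fun k => Real.log (k + a)) μ) μ := by
  have h := hasDerivAt_poissonMean (hasGrowth_logGamma ha) μ
  simp_rw [logGamma_succ_sub ha] at h
  have h2 := ((Real.hasDerivAt_mul_log hμ.ne').sub (hasDerivAt_id μ)).sub h
  convert! h2 using 1
  ring

/-- Isolates the increment of a single function of the mean. For b = 0 the term proportional to l
vanishes. -/
theorem coordRisk_eq {r s l : ℝ} (a b : ℝ) (hr : 0 < r) (hs : 0 < s) (hl : 0 < l) :
    coordRisk a b r s l = entropyGap a ((r + s) * l) - entropyGap a (r * l) +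
      a * (Real.log (r + s + b) - Real.log (r + b)) +
      l * ((r + s) * (Real.log (r + s + b) - Real.log (r + s)) -
        r * (Real.log (r + b) - Real.log r)) := by
  rw [coordRisk, entropyGap, entropyGap, Real.log_mul (by positivity) hl.ne',
    Real.log_mul hr.ne' hl.ne']
  ring

/-- Subtracting 0.02 log μ makes the gap strictly decreasing, so its increment is below 0.02
log((r+s)/r); and 0.5 + 0.02 = 1.04 · 0.5. -/
theorem coordRisk_jeffreys_lt {r s l : ℝ} (hr : 0 < r) (hs : 0 < s) (hl : 0 < l) :
    coordRisk (1 / 2) 0 r s l < 1.04 * (0.5 * Real.log ((r + s) / r)) := by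
  have hd : ∀ μ : ℝ, 0 < μ → HasDerivAt (fun μ => entropyGap (1 / 2) μ - 0.02 * Real.log μ)
      (Real.log μ - poissonMean (fun k => Real.log (k + 1 / 2)) μ - 0.02 * μ⁻¹) μ := fun μ hμ =>
    (hasDerivAt_entropyGap (by norm_num) hμ).sub ((Real.hasDerivAt_log hμ.ne').const_mul _)
  have hanti := strictAntiOn_of_deriv_neg (convex_Ioi (0 : ℝ))
    (fun μ hμ => (hd μ hμ).continuousAt.continuousWithinAt) (fun μ hμ => by
      rw [interior_Ioi] at hμ
      rw [(hd μ hμ).deriv, ← div_eq_mul_inv]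
      linarith [log_sub_poissonMean_log_lt hμ])
  have h1 : 0 < r * l := by positivity
  have h2 : 0 < (r + s) * l := by positivity
  have h := hanti h1 h2 (by nlinarith [mul_pos hs hl])
  simp only at h
  rw [Real.log_mul (by positivity) hl.ne', Real.log_mul hr.ne' hl.ne'] at h
  rw [coordRisk_eq _ _ hr hs hl, Real.log_div (by positivity) hr.ne', add_zero, add_zero]
  linarith

/-- Bernoulli's inequality with real exponent t/r applied to 1 + b/t, followed by logarithms. -/
theorem mul_log_add_sub_log_mono {r t b : ℝ} (hr : 0 < r) (hrt : r ≤ t) (hb : 0 ≤ b) :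
    r * (Real.log (r + b) - Real.log r) ≤ t * (Real.log (t + b) - Real.log t) := by
  have ht := hr.trans_le hrt
  have h := one_add_mul_self_le_rpow_one_add (s := b / t)
    (by linarith [div_nonneg hb ht.le]) ((one_le_div hr).mpr hrt)
  have e : 1 + t / r * (b / t) = (r + b) / r := by
    field_simp
  have e2 : 1 + b / t = (t + b) / t := by
    field_simp
  rw [e, e2] at h
  have h2 := Real.log_le_log (by positivity) h
  rw [Real.log_rpow (by positivity), Real.log_div (by positivity) hr.ne',
    Real.log_div (by positivity) ht.ne', div_mul_eq_mul_div, le_div_iff₀ hr] at h2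
  linarith

/-- Adding (3/2) log μ - 3/μ makes the gap nondecreasing, by `poissonMean_log_add_two_le`. The term
proportional to l is nonnegative and is dropped. At b = 0 the logarithms combine with coefficient 2
- 3/2 = 1/2. -/
theorem le_coordRisk_two {b r s l : ℝ} (hb : 0 ≤ b) (hr : 0 < r) (hs : 0 < s) (hl : 0 < l) :
    2 * (Real.log (r + s + b) - Real.log (r + b)) - 3 / 2 * (Real.log (r + s) - Real.log r) ≤
      coordRisk 2 b r s l + 3 / r * l⁻¹ := by
  have hd : ∀ μ : ℝ, 0 < μ → HasDerivAt
      (fun μ => entropyGap 2 μ + 3 / 2 * Real.log μ - 3 * μ⁻¹)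
      (Real.log μ - poissonMean (fun k => Real.log (k + 2)) μ + 3 / 2 * μ⁻¹ -
        3 * (-(μ ^ 2)⁻¹)) μ := fun μ hμ =>
    ((hasDerivAt_entropyGap (by norm_num) hμ).add ((Real.hasDerivAt_log hμ.ne').const_mul _)).sub
      ((hasDerivAt_inv hμ.ne').const_mul _)
  have hmono := monotoneOn_of_deriv_nonneg (convex_Ioi (0 : ℝ))
    (fun μ hμ => (hd μ hμ).continuousAt.continuousWithinAt)
    (fun μ hμ => by
      rw [interior_Ioi] at hμ
      exact (hd μ hμ).differentiableAt.differentiableWithinAt)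
    (fun μ hμ => by
      rw [interior_Ioi] at hμ
      rw [(hd μ hμ).deriv]
      have := poissonMean_log_add_two_le hμ
      rw [div_eq_mul_inv _ μ, div_eq_mul_inv _ (μ ^ 2)] at this
      linarith)
  have h1 : 0 < r * l := by positivity
  have h2 : 0 < (r + s) * l := by positivity
  have h := hmono h1 h2 (by nlinarith [mul_pos hs hl])
  simp only at h
  rw [Real.log_mul hr.ne' hl.ne', Real.log_mul (x := r + s) (by positivity) hl.ne'] at h
  have h3 := mul_log_add_sub_log_mono hr (by linarith : r ≤ r + s) hb
  have h4 := mul_nonneg hl.le (sub_nonneg.mpr h3)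
  have h5 : 0 < ((r + s) * l)⁻¹ := by positivity
  have h6 : 3 / r * l⁻¹ = 3 * (r * l)⁻¹ := by
    field_simp
  rw [coordRisk_eq _ _ hr hs hl, h6]
  linarith

variable {d : ℕ}

theorem klRisk_jeffreysPredictive_lt (hd : 0 < d) {r s lam : Fin d → ℝ} (hr : ∀ i, 0 < r i)
    (hs : ∀ i, 0 < s i) (hl : lam ∈ paramSpace d) :
    klRisk r s (jeffreysPredictive r s) lam < ENNReal.ofReal (1.04 * minimaxBound r s) := by
  have hl' : ∀ i, 0 < lam i := hl
  have : Nonempty (Fin d) := ⟨⟨0, hd⟩⟩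
  rw [jeffreysPredictive, jeffreysPrior_eq_gammaPrior,
    klRisk_gammaPrior (by norm_num) le_rfl hr hs hl, minimaxBound]
  refine (ENNReal.ofReal_lt_ofReal_iff ?_).mpr ?_
  · have : 0 < ∑ i, Real.log ((r i + s i) / r i) := Finset.sum_pos (fun i _ => Real.log_pos
      ((one_lt_div (hr i)).mpr (lt_add_of_pos_right _ (hs i)))) Finset.univ_nonempty
    positivity
  · rw [Finset.mul_sum, Finset.mul_sum]
    exact Finset.sum_lt_sum_of_nonempty Finset.univ_nonempty fun i _ =>
      coordRisk_jeffreys_lt (hr i) (hs i) (hl' i)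

end PoissonPrediction

namespace PoissonPrediction

/-! ### The minimax lower bound -/

variable {d : ℕ}

/-- The product of the gamma distributions with shape two and rate `b`. -/
def gammaTwoVec (d : ℕ) (b : ℝ) : Measure (Fin d → ℝ) := Measure.pi fun _ => gammaMeasure 2 b

theorem isProbabilityMeasure_gammaTwoVec {b : ℝ} (hb : 0 < b) :
    IsProbabilityMeasure (gammaTwoVec d b) := by
  have := isProbabilityMeasure_gammaMeasure two_pos hb
  unfold gammaTwoVec
  infer_instance

theorem ae_gammaMeasure_pos (a b : ℝ) : ∀ᵐ l ∂gammaMeasure a b, 0 < l := by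
  have hm : Measurable (gammaPDF a b) := (measurable_gammaPDFReal a b).ennreal_ofReal
  rw [gammaMeasure, ae_withDensity_iff hm]
  filter_upwards [compl_mem_ae_iff.mpr (measure_singleton (0 : ℝ))] with l hl hpdf
  by_contra h
  exact hpdf (gammaPDF_of_neg ((not_lt.mp h).lt_of_ne hl))

theorem ae_gammaTwoVec_mem_paramSpace {b : ℝ} (hb : 0 < b) :
    ∀ᵐ lam ∂gammaTwoVec d b, lam ∈ paramSpace d := by
  have := isProbabilityMeasure_gammaMeasure two_pos hb
  exact ae_all_iff.mpr fun i => Measure.tendsto_eval_ae_ae (i := i) (ae_gammaMeasure_pos 2 b)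

/-- Dividing by l lowers the shape from two to one. For shape one the mean of 1/l would be infinite,
and the error 3/(rl) could not be averaged. -/
theorem lintegral_inv_gammaMeasure_two {b : ℝ} (hb : 0 < b) :
    ∫⁻ l, ENNReal.ofReal l⁻¹ ∂gammaMeasure 2 b = ENNReal.ofReal b := by
  have h := lintegral_gammaPDF_eq_one one_pos hb
  have hm : Measurable (gammaPDF 2 b) := (measurable_gammaPDFReal 2 b).ennreal_ofReal
  rw [gammaMeasure, lintegral_withDensity_eq_lintegral_mul _ hm (by fun_prop),
    ← mul_one (ENNReal.ofReal b), ← h,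
    ← lintegral_const_mul' _ _ ENNReal.ofReal_ne_top]
  refine lintegral_congr_ae ?_
  filter_upwards [compl_mem_ae_iff.mpr (measure_singleton (0 : ℝ))] with l hl
  rw [Pi.mul_apply]
  rcases lt_or_gt_of_ne (show l ≠ 0 from hl) with h0 | h0
  · rw [gammaPDF_of_neg h0, gammaPDF_of_neg h0, zero_mul, mul_zero]
  · rw [gammaPDF, gammaPDF, ← ENNReal.ofReal_mul (gammaPDFReal_nonneg two_pos hb l),
      ← ENNReal.ofReal_mul hb.le, gammaPDFReal, gammaPDFReal, if_pos h0.le, if_pos h0.le]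
    congr 1
    rw [Real.Gamma_two, Real.Gamma_one, show (2 : ℝ) - 1 = 1 by norm_num, sub_self,
      Real.rpow_one, Real.rpow_zero, Real.rpow_one, Real.rpow_two]
    field_simp

theorem lintegral_inv_gammaTwoVec {b : ℝ} (hb : 0 < b) (i : Fin d) :
    ∫⁻ lam, ENNReal.ofReal (lam i)⁻¹ ∂gammaTwoVec d b = ENNReal.ofReal b := by
  have := isProbabilityMeasure_gammaMeasure two_pos hb
  rw [← lintegral_inv_gammaMeasure_two hb]
  exact (measurePreserving_eval (fun _ : Fin d => gammaMeasure 2 b) i).lintegral_comp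
    (f := fun l => ENNReal.ofReal l⁻¹) (by fun_prop)

theorem exists_setLIntegral_mul_gammaPrior (d : ℕ) {b : ℝ} (hb : 0 < b) :
    ∃ W : ℝ≥0∞, W ≠ 0 ∧ W ≠ ∞ ∧ ∀ g : (Fin d → ℝ) → ℝ≥0∞, Measurable g →
      ∫⁻ lam in paramSpace d, g lam * gammaPrior 2 b lam = W * ∫⁻ lam, g lam ∂gammaTwoVec d b := by
  refine ⟨ENNReal.ofReal (∏ _i : Fin d, gammaWeight 2 0 b 0), ?_, ENNReal.ofReal_ne_top, ?_⟩
  · rw [ne_eq, ENNReal.ofReal_eq_zero, not_le]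
    exact Finset.prod_pos fun i _ => gammaWeight_pos two_pos le_rfl hb 0
  · intro g hg
    -- Conjugacy at count 0 with all durations b: the likelihood exp(-b λ) supplies the exponential
    -- factor of the prior.
    have h := setLIntegral_likelihood_mul two_pos le_rfl (t := fun _ : Fin d => b)
      (fun _ => hb) 0 hg
    simp only [Pi.zero_apply, Nat.cast_zero, zero_add, add_zero] at h
    rw [gammaTwoVec, ← h]
    refine setLIntegral_congr_fun (measurableSet_paramSpace d) fun lam hl => ?_
    have hl' : ∀ i, 0 < lam i := hl
    rw [← mul_assoc, mul_comm (g lam)]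
    congr 1
    rw [likelihood_eq _ _ (fun i => (mul_pos hb (hl' i)).le), gammaPrior, ← ENNReal.ofReal_mul
      (Finset.prod_nonneg fun i _ => by
        have := mul_pos hb (hl' i)
        positivity), ← Finset.prod_mul_distrib]
    congr 1
    refine Finset.prod_congr rfl fun i _ => ?_
    simp
    ring

/-- The Bayes mass is the prior mean of the joint likelihood over that of the likelihood of x, so
the joint term cancels and only total masses remain. This expresses the optimality of the Bayes rule
without subtracting possibly infinite risks. -/
theorem lintegral_tsum_div_bayesPredictive {b : ℝ} (hb : 0 < b) {r s : Fin d → ℝ}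
    (hr : ∀ i, 0 < r i) (hs : ∀ i, 0 < s i) {q : (Fin d → ℕ) → Measure (Fin d → ℕ)}
    (hq : IsPredictive q) :
    ∫⁻ lam, ∑' x, ∑' y, likelihood r lam x * likelihood s lam y *
      (q x {y} / bayesPredictive r s (gammaPrior 2 b) x {y}) ∂gammaTwoVec d b = 1 := by
  have i0 := isProbabilityMeasure_gammaTwoVec (d := d) hb
  obtain ⟨W, hW0, hW1, hW⟩ := exists_setLIntegral_mul_gammaPrior d hb
  have hmr := fun x => measurable_likelihood r x
  have hmm : ∀ x y, Measurable fun lam => likelihood r lam x * likelihood s lam y :=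
    fun x y => (hmr x).mul (measurable_likelihood s y)
  have hle : ∀ (t lam : Fin d → ℝ) x, likelihood t lam x ≤ 1 := fun t lam x =>
    (ENNReal.le_tsum x).trans (tsum_likelihood t lam).le
  have hint : ∀ g : (Fin d → ℝ) → ℝ≥0∞, (∀ lam, g lam ≤ 1) → ∫⁻ lam, g lam ∂gammaTwoVec d b ≠ ∞ :=
    fun g hg => ne_top_of_le_ne_top ENNReal.one_ne_top ((lintegral_mono hg).trans (by simp))
  have key : ∀ x y, ∫⁻ lam, likelihood r lam x * likelihood s lam y *
      (q x {y} / bayesPredictive r s (gammaPrior 2 b) x {y}) ∂gammaTwoVec d b =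
      q x {y} * ∫⁻ lam, likelihood r lam x ∂gammaTwoVec d b := by
    intro x y
    have hq0 := bayesPredictive_gammaPrior_ne_zero two_pos hb.le hr hs x y
    have hm0 := marginal_gammaPrior_ne_zero two_pos hb.le hr x
    rw [marginal, hW _ (hmr x)] at hm0
    rw [bayesPredictive_singleton, bayesPredictiveMass, hW _ (hmm x y), hW _ (hmr x),
      ENNReal.mul_div_mul_left _ _ hW0 hW1] at hq0 ⊢
    have hP0 := right_ne_zero_of_mul hm0
    have hP1 := hint _ (fun lam => hle r lam x)
    have hJ1 := hint _ (fun lam => mul_le_one' (hle r lam x) (hle s lam y))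
    have hJ0 := (ENNReal.div_ne_zero.mp hq0).1
    rw [lintegral_mul_const _ (hmm x y), div_eq_mul_inv (q x {y}),
      ENNReal.inv_div (Or.inl hP1) (Or.inl hP0), mul_left_comm, ENNReal.mul_div_cancel hJ0 hJ1]
  rw [lintegral_tsum fun x => (Measurable.tsum fun y =>
    (hmm x y).mul_const _).aemeasurable]
  simp_rw [fun x => lintegral_tsum (μ := gammaTwoVec d b) fun y => ((hmm x y).mul_const
    (q x {y} / bayesPredictive r s (gammaPrior 2 b) x {y})).aemeasurable, key,
    ENNReal.tsum_mul_right]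
  have hq1 : ∀ x, ∑' y, q x {y} = 1 := by
    intro x
    have := hq x
    have h : ∫⁻ _, 1 ∂q x = 1 := by simp
    rw [lintegral_countable'] at h
    simpa using h
  simp_rw [hq1, one_mul]
  rw [← lintegral_tsum fun x => (hmr x).aemeasurable]
  simp [tsum_likelihood]

/-- The risk comparison with the Bayes rule is averaged over the prior: the ratio term averages to 1
and cancels, and the error terms average to 3b/r_i. -/
theorem ofReal_le_iSup_klRisk_add {b : ℝ} (hb : 0 < b) {r s : Fin d → ℝ}
    (hr : ∀ i, 0 < r i) (hs : ∀ i, 0 < s i) {q : (Fin d → ℕ) → Measure (Fin d → ℕ)}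
    (hq : IsPredictive q) :
    ENNReal.ofReal (∑ i, (2 * (Real.log (r i + s i + b) - Real.log (r i + b)) -
      3 / 2 * (Real.log (r i + s i) - Real.log (r i)))) ≤
      (⨆ lam ∈ paramSpace d, klRisk r s q lam) + ENNReal.ofReal (∑ i, 3 / r i * b) := by
  have i0 := isProbabilityMeasure_gammaTwoVec (d := d) hb
  set M := ⨆ lam ∈ paramSpace d, klRisk r s q lam
  set C := ENNReal.ofReal (∑ i, (2 * (Real.log (r i + s i + b) - Real.log (r i + b)) -
      3 / 2 * (Real.log (r i + s i) - Real.log (r i))))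
  have hmeas : Measurable fun lam : Fin d → ℝ => ∑ i, ENNReal.ofReal (3 / r i * (lam i)⁻¹) := by
    fun_prop
  have h1 : ∀ᵐ lam ∂gammaTwoVec d b, C + 1 ≤ M + ∑' x, ∑' y, likelihood r lam x *
      likelihood s lam y * (q x {y} / bayesPredictive r s (gammaPrior 2 b) x {y}) +
      ∑ i, ENNReal.ofReal (3 / r i * (lam i)⁻¹) := by
    filter_upwards [ae_gammaTwoVec_mem_paramSpace hb] with lam hl
    have hl' : ∀ i, 0 < lam i := hl
    have hpos : ∀ i, 0 ≤ 3 / r i * (lam i)⁻¹ := fun i => by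
      have := hr i
      have := hl' i
      positivity
    have h2 := klRisk_add_one_le (r := r) hs hl (isPredictive_gammaPrior two_pos hb.le hr s) hq
      (bayesPredictive_gammaPrior_ne_zero two_pos hb.le hr hs)
    have h3 : C ≤ klRisk r s (bayesPredictive r s (gammaPrior 2 b)) lam +
        ∑ i, ENNReal.ofReal (3 / r i * (lam i)⁻¹) := by
      rw [klRisk_gammaPrior two_pos hb.le hr hs hl,
        ← ENNReal.ofReal_sum_of_nonneg fun i _ => hpos i]
      refine le_trans (ENNReal.ofReal_le_ofReal ?_) ENNReal.ofReal_add_le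
      rw [← Finset.sum_add_distrib]
      exact Finset.sum_le_sum fun i _ => le_coordRisk_two hb.le (hr i) (hs i) (hl' i)
    calc C + 1 ≤ (klRisk r s (bayesPredictive r s (gammaPrior 2 b)) lam + 1) +
          ∑ i, ENNReal.ofReal (3 / r i * (lam i)⁻¹) := by
          rw [add_right_comm]
          gcongr
      _ ≤ _ := by
          refine add_le_add_left ?_ _
          refine h2.trans (add_le_add_left ?_ _)
          exact le_iSup₂ (f := fun lam (_ : lam ∈ paramSpace d) => klRisk r s q lam) lam hl
  have h4 := lintegral_mono_ae h1
  rw [lintegral_add_right _ hmeas, lintegral_add_left measurable_const,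
    lintegral_add_left measurable_const,
    lintegral_tsum_div_bayesPredictive hb hr hs hq, lintegral_const, lintegral_const, measure_univ,
    mul_one, lintegral_const, measure_univ, mul_one, mul_one,
    lintegral_finsetSum _ (fun i _ => by fun_prop), add_right_comm] at h4
  have h5 := (ENNReal.add_le_add_iff_right ENNReal.one_ne_top).mp h4
  refine h5.trans (le_of_eq ?_)
  congr 1
  rw [ENNReal.ofReal_sum_of_nonneg fun i _ => by
    have := hr i
    positivity]
  refine Finset.sum_congr rfl fun i _ => ?_
  have h3 : 0 ≤ 3 / r i := by
    have := hr i
    positivity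
  simp_rw [ENNReal.ofReal_mul h3]
  rw [lintegral_const_mul' _ _ ENNReal.ofReal_ne_top, lintegral_inv_gammaTwoVec hb]

theorem isMinimaxLowerBound_minimaxBound {r s : Fin d → ℝ} (hr : ∀ i, 0 < r i)
    (hs : ∀ i, 0 < s i) : IsMinimaxLowerBound r s (minimaxBound r s) := by
  intro q hq
  set M := ⨆ lam ∈ paramSpace d, klRisk r s q lam
  have hcont : ContinuousAt (fun b : ℝ => ∑ i,
      (2 * (Real.log (r i + s i + b) - Real.log (r i + b)) -
        3 / 2 * (Real.log (r i + s i) - Real.log (r i)))) 0 := by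
    refine tendsto_finsetSum _ fun i _ => ?_
    have h1 : r i + s i + 0 ≠ 0 := by linarith [hr i, hs i]
    have h2 : r i + 0 ≠ 0 := by linarith [hr i]
    exact ((((continuousAt_const.add continuousAt_id).log h1).sub
      ((continuousAt_const.add continuousAt_id).log h2)).const_mul 2).sub continuousAt_const
  have hB : minimaxBound r s = ∑ i, (2 * (Real.log (r i + s i + 0) - Real.log (r i + 0)) -
        3 / 2 * (Real.log (r i + s i) - Real.log (r i))) := by
    rw [minimaxBound, Finset.mul_sum]
    refine Finset.sum_congr rfl fun i _ => ?_
    rw [Real.log_div (by linarith [hr i, hs i]) (hr i).ne', add_zero, add_zero]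
    ring
  have hlim := (ENNReal.tendsto_ofReal hcont.tendsto).mono_left
    (nhdsWithin_le_nhds (s := Set.Ioi 0))
  rw [← hB] at hlim
  have hlin : ContinuousAt (fun b : ℝ => ∑ i, 3 / r i * b) 0 := by fun_prop
  have hlim2 := (ENNReal.tendsto_ofReal hlin.tendsto).mono_left
    (nhdsWithin_le_nhds (s := Set.Ioi 0))
  simp only [mul_zero, Finset.sum_const_zero, ENNReal.ofReal_zero] at hlim2
  have hlim3 := (tendsto_const_nhds (x := M)).add hlim2
  rw [add_zero] at hlim3
  exact le_of_tendsto_of_tendsto hlim hlim3 (Filter.eventually_of_mem self_mem_nhdsWithin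
    fun b hb => ofReal_le_iSup_klRisk_add hb hr hs hq)

end PoissonPrediction

/-! ### Assembly -/

namespace PoissonPrediction

theorem gam_pos {d : ℕ} {r s : Fin d → ℝ} (hr : ∀ i, 0 < r i) (hs : ∀ i, 0 < s i) (i : Fin d) :
    0 < gam r s i :=
  sub_pos.mpr (one_div_lt_one_div_of_lt (hr i) (lt_add_of_pos_right _ (hs i)))

theorem mixImproves {d n : ℕ} (hn : 0 < n)
    {V : Fin n → Submodule ℝ (EuclideanSpace ℝ (Fin d))} {α : Fin n → ℝ}
    (hα : ∀ j, 0 < α j ∧ α j ≤ ((d : ℝ) - (Module.finrank ℝ (V j) : ℝ) - 2) / 2)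
    {r s c : Fin d → ℝ} (hr : ∀ i, 0 < r i) (hs : ∀ i, 0 < s i) (hc : ∀ i, 0 < c i)
    {v : ℝ} (hv0 : 0 < v) (hv : ∀ i, v = gam r s i / c i) : MixImproves r s c V α := by
  -- The admissible range of exponents is empty unless d exceeds 2.
  have hd : 0 < d := by
    have h := hα ⟨0, hn⟩
    have h2 : (0 : ℝ) ≤ (Module.finrank ℝ (V ⟨0, hn⟩) : ℝ) := Nat.cast_nonneg _
    have h3 : (0 : ℝ) < d := by linarith [h.1.trans_le h.2]
    exact_mod_cast h3
  have hJ : ∀ lam ∈ paramSpace d,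
      klRisk r s (jeffreysPredictive r s) lam < ENNReal.ofReal (1.04 * minimaxBound r s) :=
    fun lam hl => klRisk_jeffreysPredictive_lt hd hr hs hl
  have hlt : ∀ lam ∈ paramSpace d, klRisk r s (mixPredictive r s c V α) lam <
      klRisk r s (jeffreysPredictive r s) lam := fun lam hl =>
    klRisk_mixPredictive_lt hn hα hr hs hc hv0 hv hl (hJ lam hl).ne_top
  exact ⟨isPredictive_jeffreysPredictive hr s, isPredictive_mixPredictive hn hα hr s hc,
    ⟨fun lam hl => (hlt lam hl).le, 1, fun _ => one_pos, hlt 1 fun _ => one_pos⟩,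
    isMinimaxLowerBound_minimaxBound hr hs, fun lam hl => (hlt lam hl).trans (hJ lam hl)⟩

end PoissonPrediction

end

/-- First conjunct: equal durations, `θ_i = √lam_i`. Second conjunct: different durations,
`θ_i = √(lam_i / γ_i)`. -/
theorem mainTheorem9 {d n : ℕ} (hn : 0 < n)
    (V : Fin n → Submodule ℝ (EuclideanSpace ℝ (Fin d))) (α : Fin n → ℝ)
    (hα : ∀ j, 0 < α j ∧ α j ≤ ((d : ℝ) - (Module.finrank ℝ (V j) : ℝ) - 2) / 2) :
    (∀ r s : ℝ, 0 < r → 0 < s →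
      PoissonPrediction.MixImproves (fun _ => r) (fun _ => s) (fun _ => 1) V α) ∧
    (∀ r s : Fin d → ℝ, (∀ i, 0 < r i) → (∀ i, 0 < s i) →
      PoissonPrediction.MixImproves r s (PoissonPrediction.gam r s) V α) := by
  refine ⟨fun r s hr hs => ?_, fun r s hr hs => ?_⟩
  · exact PoissonPrediction.mixImproves hn hα (fun _ => hr) (fun _ => hs) (fun _ => one_pos)
      (v := 1 / r - 1 / (r + s))
      (sub_pos.mpr (one_div_lt_one_div_of_lt hr (lt_add_of_pos_right r hs)))
      (fun _ => (div_one _).symm)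
  -- Scaling by γ_i itself makes the common ratio v equal to 1.
  · exact PoissonPrediction.mixImproves hn hα hr hs (PoissonPrediction.gam_pos hr hs) one_pos
      (fun i => (div_self (PoissonPrediction.gam_pos hr hs i).ne').symm)
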